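/- **Computational model.** Consider the word RAM with unit-cost instructions (addition, truncated subtraction, multiplication, integer division and remainder, bitwise operations, shifts, indirect reads and writes) on words of $O(\log n)$ bits, where $n$ is the size parameter of the instance. A problem with polynomially bounded integer entries *requires $\Omega(f)^{1-o(1)}$ time* on a class of instances if for every $\varepsilon>0$ there is a constant $c$ such that no deterministic algorithm solves all instances of the class whose entries are at most $n^c$ in time $O(f^{1-\varepsilon})$. **APSP.** Given an undirected graph on $n\ge 1$ vertices with positive, polynomially bounded integer edge weights, find a shortest path between $u$ and $v$ for all vertices $u,v$ (all the paths being output in the form of an $n\times n$ matrix of next vertices). The *APSP Conjecture* states that this problem requires $\Omega(n^3)^{1-o(1)}$ time. **Viterbi Path.** Given an $n\times n$ matrix $A$ and an $n\times\sigma$ matrix $B$ with non-negative entries (here: polynomially bounded integers), and a sequence $S=(s_1,\dots,s_T)$ of observations from an alphabet $[\sigma]$ of size $\sigma$, output a sequence of states $u_0,u_1,\dots,u_T\in[n]$ with $u_0=1$ that minimizes $$\sum_{t=1}^{T}\bigl[A(u_{t-1},u_t)+B(u_t,s_t)\bigr].$$ **Theorem.** Assume the APSP Conjecture. Then the Viterbi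 Path problem requires $\Omega(Tn^2)^{1-o(1)}$ time on the instances with $1\le T\le n$, even if the alphabet has size $\sigma=1$. Moreover, this holds at every polynomial length of the observation sequence: for every rational $\alpha$ with $0<\alpha\le 1$, the Viterbi Path problem restricted to the instances with $\sigma=1$ and $T=\lfloor n^{\alpha}\rfloor$ requires $\Omega(Tn^2)^{1-o(1)}$ time. -/

import Mathlib

/-!
A word RAM with unit-cost instructions, search problems on it, the all-pairs shortest paths
problem and the Viterbi path problem.
-/

namespace WordRAM

/-- Unit-cost operations on machine words. -/
inductive BinOp where
  | add | sub | mul | div | mod | and | or | xor | shl | shr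

/-- Meaning of the operations; `sub` is truncated and division by zero gives `0`. -/
def BinOp.eval : BinOp → ℕ → ℕ → ℕ
  | .add, x, y => x + y
  | .sub, x, y => x - y
  | .mul, x, y => x * y
  | .div, x, y => x / y
  | .mod, x, y => x % y
  | .and, x, y => x &&& y
  | .or, x, y => x ||| y
  | .xor, x, y => x ^^^ y
  | .shl, x, y => x <<< y
  | .shr, x, y => x >>> y

/-- Programs. A program mentions finitely many registers and finitely many arrays; the cells of an
array are addressed indirectly, through the content of a register.
* `const r k` : `r := k`
* `op o r a b` : `r := a o b`
* `load r m i` : `r := m[i]`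
* `store m i a` : `m[i] := a`
* `ite r c d` : run `c` if `r ≠ 0`, else `d`
* `loop r c` : while `r ≠ 0` run `c`. -/
inductive Program where
  | const (r k : ℕ)
  | op (o : BinOp) (r a b : ℕ)
  | load (r m i : ℕ)
  | store (m i a : ℕ)
  | seq (c d : Program)
  | ite (r : ℕ) (c d : Program)
  | loop (r : ℕ) (c : Program)

/-- Contents of the registers and of the arrays. -/
@[ext] structure State where
  reg : ℕ → ℕ
  mem : ℕ → ℕ → ℕ

/-- Write the value `v` to register `r`. -/
def State.setReg (s : State) (r v : ℕ) : State :=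
  { s with reg := Function.update s.reg r v }

/-- Write the value `v` to cell `i` of array `m`. -/
def State.setMem (s : State) (m i v : ℕ) : State :=
  { s with mem := Function.update s.mem m (Function.update (s.mem m) i v) }

/-- `Exec B c s s' t`: on a machine whose words hold the numbers below `B`, the program `c` started
in state `s` halts in state `s'` after `t` steps. Every instruction and every evaluation of a test
is one step. A value that does not fit into a word cannot be written: a computation that attempts
this has no result. -/
inductive Exec (B : ℕ) : Program → State → State → ℕ → Prop
  | const {r k : ℕ} {s : State} (h : k < B) : Exec B (.const r k) s (s.setReg r k) 1
  | op {o : BinOp} {r a b : ℕ} {s : State} (h : o.eval (s.reg a) (s.reg b) < B) :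
      Exec B (.op o r a b) s (s.setReg r (o.eval (s.reg a) (s.reg b))) 1
  | load {r m i : ℕ} {s : State} (h : s.mem m (s.reg i) < B) :
      Exec B (.load r m i) s (s.setReg r (s.mem m (s.reg i))) 1
  | store {m i a : ℕ} {s : State} (h : s.reg a < B) :
      Exec B (.store m i a) s (s.setMem m (s.reg i) (s.reg a)) 1
  | seq {c d : Program} {s s₁ s₂ : State} {t₁ t₂ : ℕ}
      (h₁ : Exec B c s s₁ t₁) (h₂ : Exec B d s₁ s₂ t₂) : Exec B (.seq c d) s s₂ (t₁ + t₂)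
  | ite_true {r : ℕ} {c d : Program} {s s₁ : State} {t : ℕ} (h : s.reg r ≠ 0)
      (h₁ : Exec B c s s₁ t) : Exec B (.ite r c d) s s₁ (1 + t)
  | ite_false {r : ℕ} {c d : Program} {s s₁ : State} {t : ℕ} (h : s.reg r = 0)
      (h₁ : Exec B d s s₁ t) : Exec B (.ite r c d) s s₁ (1 + t)
  | loop_done {r : ℕ} {c : Program} {s : State} (h : s.reg r = 0) : Exec B (.loop r c) s s 1
  | loop_step {r : ℕ} {c : Program} {s s₁ s₂ : State} {t₁ t₂ : ℕ} (h : s.reg r ≠ 0)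
      (h₁ : Exec B c s s₁ t₁) (h₂ : Exec B (.loop r c) s₁ s₂ t₂) :
      Exec B (.loop r c) s s₂ (1 + t₁ + t₂)

/-- A search problem whose inputs and outputs are placed in the memory of the machine. -/
structure SearchProblem where
  /-- The instances. -/
  Inst : Type
  /-- The size parameter `n`; machine words have `O(log n)` bits. -/
  size : Inst → ℕ
  /-- `EntriesLE x W`: the numbers (weights) in the instance `x` are at most `W`. -/
  EntriesLE : Inst → ℕ → Prop
  /-- The initial state of the machine on the instance. -/
  input : Inst → State
  /-- The final state holds a correct answer to the instance. -/
  Correct : Inst → State → Prop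

/-- Some program solves all instances of `Q` that satisfy `D` within `O(f)` steps, on words of
`O(log n)` bits, i.e. words that hold the numbers below `(n + 2) ^ κ` for a constant `κ`. -/
def SearchProblem.SolvableInTime (Q : SearchProblem) (D : Q.Inst → Prop) (f : Q.Inst → ℝ) : Prop :=
  ∃ (P : Program) (κ : ℕ) (C : ℝ), ∀ x : Q.Inst, D x →
    ∃ (s : State) (t : ℕ),
      Exec ((Q.size x + 2) ^ κ) P (Q.input x) s t ∧ (t : ℝ) ≤ C * f x ∧ Q.Correct x s

/-- `Q` with polynomially bounded entries, restricted to the instances that satisfy `D`, requires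
`Ω(f) ^ (1 - o(1))` time: for no `ε > 0` it is solvable in time `O(f ^ (1 - ε))`, as soon as the
entries may be as large as a suitable polynomial in `n`. -/
def SearchProblem.RequiresTime (Q : SearchProblem) (D : Q.Inst → Prop) (f : Q.Inst → ℝ) : Prop :=
  ∀ ε : ℝ, 0 < ε → ∃ c : ℕ,
    ¬ Q.SolvableInTime (fun x => D x ∧ Q.EntriesLE x (Q.size x ^ c)) (fun x => f x ^ (1 - ε))

/-- A matrix, stored row by row in an array (padded with zeros). -/
def rowMajor {m n : ℕ} (M : Fin m → Fin n → ℕ) (k : ℕ) : ℕ :=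
  if h : k / n < m ∧ k % n < n then M ⟨k / n, h.1⟩ ⟨k % n, h.2⟩ else 0

end WordRAM

namespace APSP

open WordRAM

/-- An undirected graph on `n ≥ 1` vertices with positive integer edge weights, given by its weight
matrix, in which `0` stands for a missing edge. -/
structure Instance where
  n : ℕ
  n_pos : 0 < n
  weight : Fin n → Fin n → ℕ
  symm : ∀ u v, weight u v = weight v u
  loopless : ∀ u, weight u u = 0

/-- The underlying simple graph. -/
def Instance.graph (x : Instance) : SimpleGraph (Fin x.n) where
  Adj u v := x.weight u v ≠ 0
  symm := ⟨fun u v h => by rwa [x.symm v u]⟩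
  loopless := ⟨fun u h => h (x.loopless u)⟩

/-- The total weight of a walk. -/
def Instance.walkWeight (x : Instance) {u v : Fin x.n} (p : x.graph.Walk u v) : ℕ :=
  (p.darts.map fun d => x.weight d.fst d.snd).sum

/-- `next` describes a shortest path for every pair of vertices: from `u`, repeatedly moving from
the current vertex `a` to `next a v` traverses a shortest path to `v`; the value `n` reports that
there is no path. -/
def Instance.IsSolution (x : Instance) (next : Fin x.n → Fin x.n → ℕ) : Prop :=
  ∀ u v : Fin x.n,
    (x.graph.Reachable u v → ∃ p : x.graph.Walk u v,
      (∀ q : x.graph.Walk u v, x.walkWeight p ≤ x.walkWeight q) ∧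
      ∀ d ∈ p.darts, next d.fst v = d.snd) ∧
    (¬ x.graph.Reachable u v → next u v = x.n)

/-- The all-pairs shortest paths problem. Input: `n` in register `0`, the weight matrix in array
`0`. Output: the matrix of the next vertices in array `1`. -/
def problem : SearchProblem where
  Inst := Instance
  size x := x.n
  EntriesLE x W := ∀ u v, x.weight u v ≤ W
  input x :=
    { reg := fun r => if r = 0 then x.n else 0
      mem := fun m => if m = 0 then rowMajor x.weight else fun _ => 0 }
  Correct x s := x.IsSolution fun u v => s.mem 1 (u * x.n + v)

/-- The APSP conjecture: all-pairs shortest paths, with polynomially bounded weights, requires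
`Ω(n ^ 3) ^ (1 - o(1))` time. -/
def Conjecture : Prop :=
  problem.RequiresTime (fun _ => True) (fun x => (x.n : ℝ) ^ 3)

end APSP

namespace Viterbi

open WordRAM

/-- An instance `(A, B, S)` with `n ≥ 1` states, alphabet size `σ` and `T` observations. The states,
symbols and times are numbered from `0`. The entries are (scaled) negative logarithms of
probabilities. -/
structure Instance where
  n : ℕ
  n_pos : 0 < n
  σ : ℕ
  T : ℕ
  A : Fin n → Fin n → ℕ
  B : Fin n → Fin σ → ℕ
  S : Fin T → Fin σ

/-- The cost of the state sequence `u₀, …, u_T`. -/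
def Instance.cost (x : Instance) (u : Fin (x.T + 1) → Fin x.n) : ℕ :=
  ∑ t : Fin x.T, (x.A (u t.castSucc) (u t.succ) + x.B (u t.succ) (x.S t))

/-- The state sequence starts in the first state and has least cost among all such sequences. -/
def Instance.IsSolution (x : Instance) (u : Fin (x.T + 1) → Fin x.n) : Prop :=
  u 0 = ⟨0, x.n_pos⟩ ∧
    ∀ v : Fin (x.T + 1) → Fin x.n, v 0 = ⟨0, x.n_pos⟩ → x.cost u ≤ x.cost v

/-- The Viterbi path problem. Input: `n`, `T`, `σ` in registers `0`, `1`, `2`, the matrices `A`, `B`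
and the sequence `S` in arrays `0`, `1`, `2`. Output: `u₀, …, u_T` in array `3`. -/
def problem : SearchProblem where
  Inst := Instance
  size x := x.n
  EntriesLE x W := (∀ u v, x.A u v ≤ W) ∧ ∀ u s, x.B u s ≤ W
  input x :=
    { reg := fun r => if r = 0 then x.n else if r = 1 then x.T else if r = 2 then x.σ else 0
      mem := fun m =>
        if m = 0 then rowMajor x.A
        else if m = 1 then rowMajor x.B
        else if m = 2 then fun t => if h : t < x.T then (x.S ⟨t, h⟩ : ℕ) else 0
        else fun _ => 0 }
  Correct x s := ∃ u : Fin (x.T + 1) → Fin x.n, x.IsSolution u ∧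
    ∀ t : Fin (x.T + 1), s.mem 3 t = u t

end Viterbi

/-! Suppose a program `P` solves the Viterbi instances with one symbol, `N` states and `T = ⌊N ^ (a
/ q)⌋` in time `O((T N²) ^ (1 - ε))`. It is used as a subroutine that makes all-pairs shortest paths
subcubic.

Distances come from `O(log n)` min-plus squarings of a matrix of estimates (`ExactUpTo.double`). To
square `E`, one keeps estimates `D` and a threshold `g`, searches for triples with `E(i,k) + E(k,j)
+ g ≤ D(i,j)`, and lowers `D(i,j)` accordingly. When none is left, `D < M + g`, where `M` is the
square of `E`; then `g` is halved. Hence each entry can be lowered at most twice per phase, and a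
phase has at most `2n²` successful searches (`potential_le`, `runs_phases`).

The triples are cut into blocks of shape `L × z × z`, and one Viterbi call searches one block. A
path walks along a free line, leaves it at some state `i`, crosses two layers through `k` and `j`,
and enters a free ring. A path has no memory, but the line takes one step per state, so `i` is also
the time of departure. Prescribing the final state on the ring therefore forces the path to enter
the ring at position `i`, and its cost is that of a closed triangle `i, k, j`
(`exists_min_triangle`). With weights `E(i,k)`, `E(k,j)`, `V - D(i,j)` the cheapest triangle is the
best improvement. The final state is prescribed by a potential that telescopes along the path
(`sum_endCost`), so neither emission costs nor a second symbol are needed.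

The sizes are `N = (4m)^q` and `T = (4m)^a` with `m ≈ n^(1/(6q))`, `L = T/4`, `z = N/4`. There are
`O(n³/(T N²))` blocks, each searched unsuccessfully at most once per phase, so these searches take
`O(n³/(4m)^ε)` time; the successful ones take `O(n² N³) = O(n^(5/2))`. Both bounds are subcubic, and
the numbers of rounds and phases are logarithmic.

On the machine, `P` expects empty memory, which cannot be cleared before each of so many calls.
`Exec.stamped` runs `P` in arrays whose cells count only if they carry the current stamp, so that
incrementing the stamp empties them all. -/

namespace WordRAM

/-! ### Bounded states. -/

/-- All contents of registers and arrays fit into words. -/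
def State.Bounded (B : ℕ) (s : State) : Prop :=
  (∀ r, s.reg r < B) ∧ ∀ m i, s.mem m i < B

theorem State.Bounded.setReg {B : ℕ} {s : State} (hs : s.Bounded B) {r v : ℕ} (hv : v < B) :
    (s.setReg r v).Bounded B := by
  refine ⟨fun r' => ?_, hs.2⟩
  by_cases h : r' = r <;> simp [State.setReg, h, hv, hs.1 r']

theorem State.Bounded.setMem {B : ℕ} {s : State} (hs : s.Bounded B) {m i v : ℕ} (hv : v < B) :
    (s.setMem m i v).Bounded B := by
  refine ⟨hs.1, fun m' i' => ?_⟩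
  simp only [State.setMem, Function.update_apply]
  split_ifs with h
  · simp only [Function.update_apply]
    split_ifs
    exacts [hv, hs.2 _ _]
  · exact hs.2 _ _

/-- Every instruction checks the value that it writes, so only the initial state has to be bounded.
From then on, copying a register or loading a cell cannot fail. -/
theorem Exec.bounded {B : ℕ} {c : Program} {s s' : State} {t : ℕ}
    (h : Exec B c s s' t) (hs : s.Bounded B) : s'.Bounded B := by
  induction h with
  | const h => exact hs.setReg h
  | op h => exact hs.setReg h
  | load h => exact hs.setReg h
  | store h => exact hs.setMem h
  | seq _ _ h₁ h₂ => exact h₂ (h₁ hs)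
  | ite_true h _ h₁ => exact h₁ hs
  | ite_false h _ h₁ => exact h₁ hs
  | loop_done h => exact hs
  | loop_step h _ _ h₁ h₂ => exact h₂ (h₁ hs)

@[simp] theorem setReg_reg (s : State) (r v r' : ℕ) :
    (s.setReg r v).reg r' = if r' = r then v else s.reg r' := by
  simp [State.setReg, Function.update_apply]

@[simp] theorem setReg_mem (s : State) (r v : ℕ) : (s.setReg r v).mem = s.mem := rfl

@[simp] theorem setMem_reg (s : State) (m i v : ℕ) : (s.setMem m i v).reg = s.reg := rfl

@[simp] theorem setMem_mem (s : State) (m i v m' : ℕ) :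
    (s.setMem m i v).mem m' = if m' = m then Function.update (s.mem m) i v else s.mem m' := by
  simp [State.setMem, Function.update_apply]

/-! ### Compilation of expressions. -/

/-- Expressions over the registers below `40` and the arrays. -/
inductive Expr where
  | lit (k : ℕ)
  | var (r : ℕ)
  | add (a b : Expr)
  | sub (a b : Expr)
  | mul (a b : Expr)
  | div (a b : Expr)
  | mod (a b : Expr)
  | arr (m : ℕ) (a : Expr)
  | cond (c a b : Expr)

namespace Expr

/-- The value of an expression. -/
@[simp] def eval (s : State) : Expr → ℕ
  | lit k => k
  | var r => s.reg r
  | add a b => eval s a + eval s b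
  | sub a b => eval s a - eval s b
  | mul a b => eval s a * eval s b
  | div a b => eval s a / eval s b
  | mod a b => eval s a % eval s b
  | arr m a => s.mem m (eval s a)
  | cond c a b => if eval s c ≠ 0 then eval s a else eval s b

/-- The evaluation does not overflow. -/
@[simp] def Ok (B : ℕ) (s : State) : Expr → Prop
  | lit k => k < B
  | var r => r < 40
  | add a b => Ok B s a ∧ Ok B s b ∧ eval s a + eval s b < B
  | sub a b => Ok B s a ∧ Ok B s b
  | mul a b => Ok B s a ∧ Ok B s b ∧ eval s a * eval s b < B
  | div a b => Ok B s a ∧ Ok B s b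
  | mod a b => Ok B s a ∧ Ok B s b
  | arr _ a => Ok B s a
  | cond c a b => Ok B s c ∧ (eval s c ≠ 0 → Ok B s a) ∧ (eval s c = 0 → Ok B s b)

/-- Code that evaluates an expression into the register `d`, with scratch registers from `d` on. -/
def compile : Expr → ℕ → Program
  | lit k, d => .const d k
  | var r, d => .op .and d r r
  | add a b, d => .seq (a.compile d) (.seq (b.compile (d + 1)) (.op .add d d (d + 1)))
  | sub a b, d => .seq (a.compile d) (.seq (b.compile (d + 1)) (.op .sub d d (d + 1)))
  | mul a b, d => .seq (a.compile d) (.seq (b.compile (d + 1)) (.op .mul d d (d + 1)))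
  | div a b, d => .seq (a.compile d) (.seq (b.compile (d + 1)) (.op .div d d (d + 1)))
  | mod a b, d => .seq (a.compile d) (.seq (b.compile (d + 1)) (.op .mod d d (d + 1)))
  | arr m a, d => .seq (a.compile d) (.load d m d)
  | cond c a b, d => .seq (c.compile d) (.ite d (a.compile d) (b.compile d))

/-- A bound for the evaluation time. -/
def time : Expr → ℕ
  | lit _ => 1
  | var _ => 1
  | add a b => a.time + b.time + 1
  | sub a b => a.time + b.time + 1
  | mul a b => a.time + b.time + 1
  | div a b => a.time + b.time + 1
  | mod a b => a.time + b.time + 1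
  | arr _ a => a.time + 1
  | cond c a b => c.time + a.time + b.time + 1

/-- `Ok` admits only variables below `40`, so the scratch registers have no influence. -/
theorem eval_congr {B : ℕ} {s σ : State} (hr : ∀ r < 40, σ.reg r = s.reg r)
    (hm : σ.mem = s.mem) : ∀ e : Expr, e.Ok B s → e.eval σ = e.eval s ∧ e.Ok B σ
  | lit k, h => ⟨rfl, h⟩
  | var r, h => ⟨hr r h, h⟩
  | add a b, h => by
    have ha := eval_congr hr hm a h.1
    have hb := eval_congr hr hm b h.2.1
    simpa [ha.1, hb.1, ha.2, hb.2] using h.2.2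
  | sub a b, h => by
    have ha := eval_congr hr hm a h.1
    have hb := eval_congr hr hm b h.2
    simp [ha.1, hb.1, ha.2, hb.2]
  | mul a b, h => by
    have ha := eval_congr hr hm a h.1
    have hb := eval_congr hr hm b h.2.1
    simpa [ha.1, hb.1, ha.2, hb.2] using h.2.2
  | div a b, h => by
    have ha := eval_congr hr hm a h.1
    have hb := eval_congr hr hm b h.2
    simp [ha.1, hb.1, ha.2, hb.2]
  | mod a b, h => by
    have ha := eval_congr hr hm a h.1
    have hb := eval_congr hr hm b h.2
    simp [ha.1, hb.1, ha.2, hb.2]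
  | arr m a, h => by
    have ha := eval_congr hr hm a h
    simp [ha.1, ha.2, hm]
  | cond c a b, h => by
    have hc := eval_congr hr hm c h.1
    by_cases h0 : c.eval s = 0
    · have hb := eval_congr hr hm b (h.2.2 h0)
      simp [hc.1, hc.2, h0, hb.1, hb.2]
    · have ha := eval_congr hr hm a (h.2.1 h0)
      simp [hc.1, hc.2, h0, ha.1, ha.2]

/-- The registers from `d` on act as a stack: the first operand is left in `d` and survives the
evaluation of the second one, which touches only registers from `d + 1` on. Differences, quotients
and remainders do not exceed their first operand, which is why `Ok` imposes no bound on them. -/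
theorem exec_compile {B : ℕ} : ∀ (e : Expr) (d : ℕ) (s : State), 40 ≤ d → s.Bounded B → e.Ok B s →
    ∃ s' t, Exec B (e.compile d) s s' t ∧ t ≤ e.time ∧ s'.reg d = e.eval s ∧
      (∀ r < d, s'.reg r = s.reg r) ∧ s'.mem = s.mem := by
  intro e
  have next : ∀ {a b : Expr} {d : ℕ} {s : State}, 40 ≤ d → s.Bounded B → a.Ok B s → b.Ok B s →
      (∀ (d : ℕ) (s : State), 40 ≤ d → s.Bounded B → b.Ok B s →
        ∃ s' t, Exec B (b.compile d) s s' t ∧ t ≤ b.time ∧ s'.reg d = b.eval s ∧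
          (∀ r < d, s'.reg r = s.reg r) ∧ s'.mem = s.mem) →
      ∀ s₁ t₁, Exec B (a.compile d) s s₁ t₁ → (∀ r < d, s₁.reg r = s.reg r) → s₁.mem = s.mem →
      ∃ s'' t, Exec B (b.compile (d + 1)) s₁ s'' t ∧ t ≤ b.time ∧ s''.reg (d + 1) = b.eval s ∧
        (∀ r < d + 1, s''.reg r = s₁.reg r) ∧ s''.mem = s₁.mem := by
    intro a b d s hd hs _ hb ih s₁ t₁ e₁ r₁ m₁
    have hc := eval_congr (fun r hr => r₁ r (by omega)) m₁ b hb
    have := ih (d + 1) s₁ (by omega) (e₁.bounded hs) hc.2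
    rwa [hc.1] at this
  have bin : ∀ {a b : Expr} {d : ℕ} {s : State} (o : BinOp), 40 ≤ d → s.Bounded B →
      a.Ok B s → b.Ok B s → o.eval (a.eval s) (b.eval s) < B →
      (∀ (d : ℕ) (s : State), 40 ≤ d → s.Bounded B → a.Ok B s →
        ∃ s' t, Exec B (a.compile d) s s' t ∧ t ≤ a.time ∧ s'.reg d = a.eval s ∧
          (∀ r < d, s'.reg r = s.reg r) ∧ s'.mem = s.mem) →
      (∀ (d : ℕ) (s : State), 40 ≤ d → s.Bounded B → b.Ok B s →
        ∃ s' t, Exec B (b.compile d) s s' t ∧ t ≤ b.time ∧ s'.reg d = b.eval s ∧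
          (∀ r < d, s'.reg r = s.reg r) ∧ s'.mem = s.mem) →
      ∃ s' t, Exec B (.seq (a.compile d) (.seq (b.compile (d + 1)) (.op o d d (d + 1)))) s s' t ∧
        t ≤ a.time + b.time + 1 ∧ s'.reg d = o.eval (a.eval s) (b.eval s) ∧
        (∀ r < d, s'.reg r = s.reg r) ∧ s'.mem = s.mem := by
    intro a b d s o hd hs ha hb ho iha ihb
    obtain ⟨s₁, t₁, e₁, l₁, v₁, r₁, m₁⟩ := iha d s hd hs ha
    obtain ⟨s₂, t₂, e₂, l₂, v₂, r₂, m₂⟩ := next hd hs ha hb ihb s₁ t₁ e₁ r₁ m₁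
    have v₁' : s₂.reg d = a.eval s := by rw [r₂ d (by omega), v₁]
    refine ⟨_, _, .seq e₁ (.seq e₂ (.op (by rwa [v₁', v₂]))), by omega, ?_, ?_, ?_⟩
    · simp [v₁', v₂]
    · intro r hr
      simp [hr.ne, r₂ r (by omega), r₁ r hr]
    · simp [m₁, m₂]
  have small : ∀ {a : Expr} {d : ℕ} {s : State}, 40 ≤ d → s.Bounded B → a.Ok B s →
      (∀ (d : ℕ) (s : State), 40 ≤ d → s.Bounded B → a.Ok B s →
        ∃ s' t, Exec B (a.compile d) s s' t ∧ t ≤ a.time ∧ s'.reg d = a.eval s ∧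
          (∀ r < d, s'.reg r = s.reg r) ∧ s'.mem = s.mem) → a.eval s < B := by
    intro a d s hd hs ha ih
    obtain ⟨s₁, t₁, e₁, l₁, v₁, r₁, m₁⟩ := ih d s hd hs ha
    exact v₁ ▸ (e₁.bounded hs).1 d
  induction e with
  | lit k =>
    intro d s _ _ h
    exact ⟨_, _, .const h, le_rfl, by simp, fun r hr => by simp [hr.ne], rfl⟩
  | var r =>
    intro d s _ hs _
    -- A register is copied as its bitwise conjunction with itself.
    exact ⟨_, _, .op (by simpa [BinOp.eval] using hs.1 r), le_rfl, by simp [BinOp.eval],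
      fun r hr => by simp [hr.ne], rfl⟩
  | add a b iha ihb =>
    intro d s hd hs h
    exact bin .add hd hs h.1 h.2.1 h.2.2 iha ihb
  | sub a b iha ihb =>
    intro d s hd hs h
    exact bin .sub hd hs h.1 h.2
      ((Nat.sub_le _ _).trans_lt (small hd hs h.1 iha)) iha ihb
  | mul a b iha ihb =>
    intro d s hd hs h
    exact bin .mul hd hs h.1 h.2.1 h.2.2 iha ihb
  | div a b iha ihb =>
    intro d s hd hs h
    exact bin .div hd hs h.1 h.2
      ((Nat.div_le_self _ _).trans_lt (small hd hs h.1 iha)) iha ihb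
  | mod a b iha ihb =>
    intro d s hd hs h
    exact bin .mod hd hs h.1 h.2
      ((Nat.mod_le _ _).trans_lt (small hd hs h.1 iha)) iha ihb
  | arr m a iha =>
    intro d s hd hs h
    obtain ⟨s₁, t₁, e₁, l₁, v₁, r₁, m₁⟩ := iha d s hd hs h
    refine ⟨_, _, .seq e₁ (.load ((e₁.bounded hs).2 _ _)), by simpa [time] using l₁, ?_, ?_, ?_⟩
    · simp [v₁, m₁]
    · intro r hr
      simp [hr.ne, r₁ r hr]
    · simp [m₁]
  | cond c a b ihc iha ihb =>
    intro d s hd hs h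
    obtain ⟨s₁, t₁, e₁, l₁, v₁, r₁, m₁⟩ := ihc d s hd hs h.1
    by_cases h0 : c.eval s = 0
    · have hb := eval_congr (fun r hr => r₁ r (by omega)) m₁ b (h.2.2 h0)
      obtain ⟨s₂, t₂, e₂, l₂, v₂, r₂, m₂⟩ := ihb d s₁ hd (e₁.bounded hs) hb.2
      refine ⟨_, _, .seq e₁ (.ite_false (v₁.trans h0) e₂), by simp only [time]; omega, ?_, ?_, ?_⟩
      · simp [v₂, hb.1, h0]
      · intro r hr
        rw [r₂ r hr, r₁ r hr]
      · rw [m₂, m₁]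
    · have ha := eval_congr (fun r hr => r₁ r (by omega)) m₁ a (h.2.1 h0)
      obtain ⟨s₂, t₂, e₂, l₂, v₂, r₂, m₂⟩ := iha d s₁ hd (e₁.bounded hs) ha.2
      refine ⟨_, _, .seq e₁ (.ite_true (fun h' => h0 (v₁ ▸ h')) e₂), by simp only [time]; omega,
        ?_, ?_, ?_⟩
      · simp [v₂, ha.1, h0]
      · intro r hr
        rw [r₂ r hr, r₁ r hr]
      · rw [m₂, m₁]

end Expr

/-! ### Timed specifications, loops and loop-free code. -/

/-- Agreement up to the scratch registers, those from `40` on. -/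
def Sim (s σ : State) : Prop :=
  (∀ r < 40, σ.reg r = s.reg r) ∧ σ.mem = s.mem

/-- Started in `s`, up to scratch registers, the program `c` halts within `t` steps in a state that
satisfies `Q`, up to scratch registers. -/
def Runs (B : ℕ) (c : Program) (s : State) (t : ℕ) (Q : State → Prop) : Prop :=
  ∀ σ, Sim s σ → σ.Bounded B → ∃ s' σ' t', Exec B c σ σ' t' ∧ t' ≤ t ∧ Sim s' σ' ∧ Q s'

theorem Runs.mono {B : ℕ} {c : Program} {s : State} {t t' : ℕ} {Q Q' : State → Prop}
    (h : Runs B c s t Q) (ht : t ≤ t') (hQ : ∀ s', Q s' → Q' s') : Runs B c s t' Q' := by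
  intro σ h₁ h₂
  obtain ⟨s', σ', u, e, l, m, q⟩ := h σ h₁ h₂
  exact ⟨s', σ', u, e, l.trans ht, m, hQ _ q⟩

/-- The intermediate condition is itself a `Runs` statement, so a program can be verified from left
to right, each intermediate state being known up to scratch registers. -/
theorem Runs.seq {B : ℕ} {c d : Program} {s : State} {t₁ t₂ : ℕ} {Q : State → Prop}
    (h : Runs B c s t₁ fun s' => Runs B d s' t₂ Q) : Runs B (.seq c d) s (t₁ + t₂) Q := by
  intro σ h₁ h₂
  obtain ⟨s₁, σ₁, u₁, e₁, l₁, m₁, q₁⟩ := h σ h₁ h₂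
  obtain ⟨s₂, σ₂, u₂, e₂, l₂, m₂, q₂⟩ := q₁ σ₁ m₁ (e₁.bounded h₂)
  exact ⟨s₂, σ₂, _, .seq e₁ e₂, by omega, m₂, q₂⟩

/-- Strong induction on `μ`. A turn costs the body and one test; the last `1` pays for the test that
ends the loop. -/
theorem Runs.loop_of_measure {B r : ℕ} {c : Program} (hr : r < 40) (I : State → Prop)
    (μ : State → ℕ) (b : ℕ)
    (h : ∀ s, I s → s.reg r ≠ 0 → Runs B c s b fun s' => I s' ∧ μ s' < μ s) (s : State) (hs : I s) :
    Runs B (.loop r c) s (μ s * (b + 1) + 1) fun s' => I s' ∧ s'.reg r = 0 := by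
  induction hn : μ s using Nat.strong_induction_on generalizing s with
  | _ n ih =>
    intro σ h₁ h₂
    by_cases h0 : s.reg r = 0
    · exact ⟨s, σ, 1, .loop_done (by rw [h₁.1 r hr, h0]), by omega, h₁, hs, h0⟩
    · obtain ⟨s₁, σ₁, u₁, e₁, l₁, m₁, q₁, d₁⟩ := h s hs h0 σ h₁ h₂
      obtain ⟨s₂, σ₂, u₂, e₂, l₂, m₂, q₂⟩ :=
        ih (μ s₁) (hn ▸ d₁) s₁ q₁ rfl σ₁ m₁ (e₁.bounded h₂)
      refine ⟨s₂, σ₂, _, .loop_step (by rwa [h₁.1 r hr]) e₁ e₂, ?_, m₂, q₂⟩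
      have : (μ s₁ + 1) * (b + 1) ≤ n * (b + 1) := Nat.mul_le_mul_right _ (by omega)
      rw [Nat.add_mul] at this
      omega

theorem Runs.loop_countdown {B r : ℕ} {c : Program} (hr : r < 40) (I : ℕ → State → Prop) (b : ℕ)
    (h : ∀ x s, s.reg r = x + 1 → I (x + 1) s → Runs B c s b fun s' => s'.reg r = x ∧ I x s')
    (s : State) (hs : I (s.reg r) s) :
    Runs B (.loop r c) s (s.reg r * (b + 1) + 1) fun s' => s'.reg r = 0 ∧ I 0 s' := by
  refine (Runs.loop_of_measure hr (fun s => I (s.reg r) s) (fun s => s.reg r) b ?_ s hs).mono le_rfl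
    fun s' h' => ⟨h'.2, h'.2 ▸ h'.1⟩
  intro s hI h0
  obtain ⟨x, hx⟩ := Nat.exists_eq_succ_of_ne_zero h0
  rw [hx] at hI
  refine (h x s hx hI).mono le_rfl fun s' h' => ⟨?_, ?_⟩
  · rw [h'.1]
    exact h'.2
  · omega

/-- Loop-free code. -/
inductive Code where
  | set (r : ℕ) (e : Expr)
  | put (m : ℕ) (i e : Expr)
  | seq (c d : Code)
  | ite (e : Expr) (c d : Code)
  | skip

namespace Code

/-- The effect of the code. -/
@[simp] def run : Code → State → State
  | set r e, s => s.setReg r (e.eval s)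
  | put m i e, s => s.setMem m (i.eval s) (e.eval s)
  | seq c d, s => d.run (c.run s)
  | ite e c d, s => if e.eval s ≠ 0 then c.run s else d.run s
  | skip, s => s

/-- The evaluation does not overflow. -/
@[simp] def Ok (B : ℕ) : Code → State → Prop
  | set r e, s => r < 40 ∧ e.Ok B s
  | put _ i e, s => i.Ok B s ∧ e.Ok B s
  | seq c d, s => c.Ok B s ∧ d.Ok B (c.run s)
  | ite e c d, s => e.Ok B s ∧ (e.eval s ≠ 0 → c.Ok B s) ∧ (e.eval s = 0 → d.Ok B s)
  | skip, _ => 0 < B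

/-- Translation to a program. -/
def compile : Code → Program
  | set r e => .seq (e.compile 40) (.op .and r 40 40)
  | put m i e => .seq (i.compile 40) (.seq (e.compile 41) (.store m 40 41))
  | seq c d => .seq c.compile d.compile
  | ite e c d => .seq (e.compile 40) (.ite 40 c.compile d.compile)
  | skip => .const 40 0

/-- A bound for the running time. -/
def time : Code → ℕ
  | set _ e => e.time + 1
  | put _ i e => i.time + e.time + 1
  | seq c d => c.time + d.time
  | ite e c d => e.time + c.time + d.time + 1
  | skip => 1

/-- `run` is the idealized effect, without scratch registers; the machine reaches it only in the
sense of `Sim`, which is all that `Runs` asks for. -/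
theorem runs {B : ℕ} : ∀ (c : Code) (s : State), c.Ok B s →
    Runs B c.compile s c.time fun s' => s' = c.run s
  | set r e, s, h => by
    intro σ h₁ h₂
    have he := Expr.eval_congr h₁.1 h₁.2 e h.2
    obtain ⟨s₁, t₁, e₁, l₁, v₁, r₁, m₁⟩ := Expr.exec_compile e 40 σ le_rfl h₂ he.2
    refine ⟨_, _, _, .seq e₁ (.op ?_), by simpa [time] using l₁, ⟨?_, ?_⟩, rfl⟩
    · simpa [BinOp.eval] using (e₁.bounded h₂).1 40
    · intro r' hr'
      simp only [setReg_reg, BinOp.eval, Nat.and_self, run]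
      split_ifs
      · rw [v₁, he.1]
      · rw [r₁ r' hr', h₁.1 r' hr']
    · simp [m₁, h₁.2]
  | put m i e, s, h => by
    intro σ h₁ h₂
    have hi := Expr.eval_congr h₁.1 h₁.2 i h.1
    obtain ⟨s₁, t₁, e₁, l₁, v₁, r₁, m₁⟩ := Expr.exec_compile i 40 σ le_rfl h₂ hi.2
    have he := Expr.eval_congr (fun r hr => (r₁ r hr).trans (h₁.1 r hr)) (m₁.trans h₁.2) e h.2
    obtain ⟨s₂, t₂, e₂, l₂, v₂, r₂, m₂⟩ :=
      Expr.exec_compile e 41 s₁ (by omega) (e₁.bounded h₂) he.2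
    refine ⟨_, _, _, .seq e₁ (.seq e₂ (.store ((e₂.bounded (e₁.bounded h₂)).1 _))), ?_, ⟨?_, ?_⟩,
      rfl⟩
    · simp only [time]
      omega
    · intro r' hr'
      simp [r₂ r' (by omega), r₁ r' hr', h₁.1 r' hr']
    · rw [r₂ 40 (by omega), v₁, v₂, hi.1, he.1]
      simp [run, State.setMem, m₂, m₁, h₁.2]
  | seq c d, s, h => by
    exact Runs.seq ((runs c s h.1).mono le_rfl fun s' e => e ▸ runs d _ h.2)
  | ite e c d, s, h => by
    intro σ h₁ h₂
    have he := Expr.eval_congr h₁.1 h₁.2 e h.1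
    obtain ⟨s₁, t₁, e₁, l₁, v₁, r₁, m₁⟩ := Expr.exec_compile e 40 σ le_rfl h₂ he.2
    have hs₁ : Sim s s₁ := ⟨fun r hr => (r₁ r hr).trans (h₁.1 r hr), m₁.trans h₁.2⟩
    by_cases h0 : e.eval s = 0
    · obtain ⟨s₂, σ₂, u₂, e₂, l₂, m₂, q₂⟩ := runs d s (h.2.2 h0) s₁ hs₁ (e₁.bounded h₂)
      refine ⟨s₂, σ₂, _, .seq e₁ (.ite_false (by rw [v₁, he.1, h0]) e₂), ?_, m₂, ?_⟩
      · simp only [time]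
        omega
      · simp [q₂, h0]
    · obtain ⟨s₂, σ₂, u₂, e₂, l₂, m₂, q₂⟩ := runs c s (h.2.1 h0) s₁ hs₁ (e₁.bounded h₂)
      refine ⟨s₂, σ₂, _, .seq e₁ (.ite_true (by rw [v₁, he.1]; exact h0) e₂), ?_, m₂, ?_⟩
      · simp only [time]
        omega
      · simp [q₂, h0]
  | skip, s, h => by
    intro σ h₁ _
    refine ⟨s, _, 1, .const h, le_rfl, ⟨fun r hr => ?_, ?_⟩, rfl⟩
    · simp [hr.ne, h₁.1 r hr]
    · simp [h₁.2]

end Code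

end WordRAM

/-! ### Simulation of a program in lazily cleared memory. -/

namespace WordRAM

/-- A number above all registers that the program mentions. -/
def Program.regBound : Program → ℕ
  | .const r _ => r + 1
  | .op _ r a b => max (r + 1) (max (a + 1) (b + 1))
  | .load r _ i => max (r + 1) (i + 1)
  | .store _ i a => max (i + 1) (a + 1)
  | .seq c d => max c.regBound d.regBound
  | .ite r c d => max (r + 1) (max c.regBound d.regBound)
  | .loop r c => max (r + 1) c.regBound

/-- The program with its registers moved to `40, 41, …` and each of its arrays `m` kept in the
array `10 + 2 * m`; the cells in use are those whose stamp, in the array `11 + 2 * m`, is the content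
of register `16`, and all others count as `0`. -/
def Program.stamped : Program → Program
  | .const r k => .const (40 + r) k
  | .op o r a b => .op o (40 + r) (40 + a) (40 + b)
  | .load r m i => .seq (.load 39 (11 + 2 * m) (40 + i)) (.seq (.op .sub 39 16 39)
      (.ite 39 (.const (40 + r) 0) (.load (40 + r) (10 + 2 * m) (40 + i))))
  | .store m i a => .seq (.store (10 + 2 * m) (40 + i) (40 + a)) (.store (11 + 2 * m) (40 + i) 16)
  | .seq c d => .seq c.stamped d.stamped
  | .ite r c d => .ite (40 + r) c.stamped d.stamped
  | .loop r c => .loop (40 + r) c.stamped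

/-- The array cell represented by stamped arrays. -/
def State.stampedMem (s : State) (m i : ℕ) : ℕ :=
  if s.mem (11 + 2 * m) i = s.reg 16 then s.mem (10 + 2 * m) i else 0

/-- No stamp exceeds the current one. -/
def State.StampsLE (s : State) : Prop := ∀ m i, s.mem (11 + 2 * m) i ≤ s.reg 16

/-- `τ` represents `σ`, as far as the registers below `R` are concerned. -/
structure Represents (R : ℕ) (σ τ : State) : Prop where
  reg : ∀ r < R, τ.reg (40 + r) = σ.reg r
  mem : ∀ m i, τ.stampedMem m i = σ.mem m i
  stamps : τ.StampsLE

/-- `τ'` arises from `τ` by changes in scratch registers, register `39` and arrays from `10` on. -/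
structure OuterEq (τ τ' : State) : Prop where
  reg : ∀ r < 39, τ'.reg r = τ.reg r
  mem : ∀ m < 10, τ'.mem m = τ.mem m

theorem OuterEq.refl (τ : State) : OuterEq τ τ := ⟨fun _ _ => rfl, fun _ _ => rfl⟩

theorem OuterEq.trans {τ τ' τ'' : State} (h : OuterEq τ τ') (h' : OuterEq τ' τ'') :
    OuterEq τ τ'' :=
  ⟨fun r hr => (h'.reg r hr).trans (h.reg r hr), fun m hm => (h'.mem m hm).trans (h.mem m hm)⟩

theorem Represents.setReg {R r v w : ℕ} {σ τ : State} (h : Represents R σ τ) (hv : w = v) :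
    Represents R (σ.setReg r v) (τ.setReg (40 + r) w) := by
  subst hv
  refine ⟨fun r' hr' => ?_, fun m i => ?_, fun m i => ?_⟩
  · simp [h.reg r' hr']
  · have := h.mem m i
    have h16 : (16 : ℕ) ≠ 40 + r := by omega
    simpa [State.stampedMem, h16] using this
  · have h16 : (16 : ℕ) ≠ 40 + r := by omega
    simpa [h16] using h.stamps m i

theorem Represents.setReg_temp {R w : ℕ} {σ τ : State} (h : Represents R σ τ) :
    Represents R σ (τ.setReg 39 w) := by
  refine ⟨fun r' hr' => ?_, fun m i => ?_, fun m i => ?_⟩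
  · have : 40 + r' ≠ 39 := by omega
    simp [this, h.reg r' hr']
  · simpa [State.stampedMem] using h.mem m i
  · simpa using h.stamps m i

theorem OuterEq.setReg {r w : ℕ} (hr : 39 ≤ r) (τ : State) : OuterEq τ (τ.setReg r w) :=
  ⟨fun r' hr' => by simp [(hr'.trans_le hr).ne], fun _ _ => rfl⟩

theorem OuterEq.setMem {m i w : ℕ} (hm : 10 ≤ m) (τ : State) : OuterEq τ (τ.setMem m i w) :=
  ⟨fun _ _ => rfl, fun m' hm' => by simp [(hm'.trans_le hm).ne]⟩

/-- The write also refreshes the stamp, which makes the cell valid whatever an earlier call left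
there. -/
theorem Represents.setMem {R m i v : ℕ} {σ τ : State} (h : Represents R σ τ) :
    Represents R (σ.setMem m i v)
      ((τ.setMem (10 + 2 * m) i v).setMem (11 + 2 * m) i (τ.reg 16)) := by
  have h₁ : ∀ m' : ℕ, 10 + 2 * m' ≠ 11 + 2 * m := by omega
  have h₂ : ∀ m' : ℕ, 11 + 2 * m' ≠ 10 + 2 * m := by omega
  have h₃ : ∀ m' : ℕ, 11 + 2 * m' = 11 + 2 * m ↔ m' = m := by omega
  have h₄ : ∀ m' : ℕ, 10 + 2 * m' = 10 + 2 * m ↔ m' = m := by omega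
  refine ⟨fun r' hr' => ?_, fun m' i' => ?_, fun m' i' => ?_⟩
  · simp [h.reg r' hr']
  · have := h.mem m' i'
    simp only [State.stampedMem, setMem_mem, setMem_reg, h₁, h₂, h₃, h₄, if_false] at this ⊢
    by_cases e : m' = m
    · subst e
      by_cases e' : i' = i
      · subst e'
        simp
      · simpa [Function.update_apply, e'] using this
    · simpa [e] using this
  · have := h.stamps m' i'
    simp only [setMem_mem, setMem_reg, h₂, h₃, if_false]
    split_ifs with e
    · subst e
      simp only [Function.update_apply]
      split_ifs
      · exact le_rfl
      · exact this
    · exact this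

/-- Induction on the execution. The factor `4` comes from `load`, which reads the stamp, subtracts
it, tests the difference and then fetches the value or writes `0`. Truncated subtraction decides
equality here because no stamp exceeds the current one; this is the purpose of `StampsLE`. -/
theorem Exec.stamped {B₀ B R : ℕ} (hB : B₀ ≤ B) {c : Program} {σ σ' : State} {t : ℕ}
    (h : Exec B₀ c σ σ' t) : ∀ τ : State, c.regBound ≤ R → τ.Bounded B → Represents R σ τ →
    ∃ τ' t', Exec B c.stamped τ τ' t' ∧ t' ≤ 4 * t ∧ Represents R σ' τ' ∧ OuterEq τ τ' := by
  induction h with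
  | const h =>
    intro τ _ _ hr
    exact ⟨_, _, .const (h.trans_le hB), by omega, hr.setReg rfl, .setReg (by omega) τ⟩
  | @op o r a b s h =>
    intro τ hR _ hr
    simp only [Program.regBound, max_le_iff] at hR
    have ha := hr.reg a (by omega)
    have hb := hr.reg b (by omega)
    exact ⟨_, _, .op (by rw [ha, hb]; exact h.trans_le hB), by omega,
      hr.setReg (by rw [ha, hb]), .setReg (by omega) τ⟩
  | @load r m i s h =>
    intro τ hR hτ hr
    simp only [Program.regBound, max_le_iff] at hR
    have hi := hr.reg i (by omega)
    have hl := hr.stamps m (s.reg i)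
    have hm := hr.mem m (s.reg i)
    have e₁ : Exec B (.load 39 (11 + 2 * m) (40 + i)) τ _ 1 := .load (hτ.2 _ _)
    have e₂ : Exec B (.op .sub 39 16 39) (τ.setReg 39 (τ.mem (11 + 2 * m) (τ.reg (40 + i)))) _ 1 :=
      .op (((Nat.sub_le _ _).trans_lt ((e₁.bounded hτ).1 16)))
    set τ₂ := State.setReg (τ.setReg 39 (τ.mem (11 + 2 * m) (τ.reg (40 + i)))) 39
      (BinOp.sub.eval ((τ.setReg 39 (τ.mem (11 + 2 * m) (τ.reg (40 + i)))).reg 16)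
      ((τ.setReg 39 (τ.mem (11 + 2 * m) (τ.reg (40 + i)))).reg 39)) with hτ₂
    have hr₂ : Represents R s τ₂ := hr.setReg_temp.setReg_temp
    have ho₂ : OuterEq τ τ₂ := (OuterEq.setReg (by omega) _).trans (OuterEq.setReg (by omega) _)
    have hb₂ := e₂.bounded (e₁.bounded hτ)
    have h39 : τ₂.reg 39 = τ.reg 16 - τ.mem (11 + 2 * m) (s.reg i) := by
      simp [hτ₂, BinOp.eval, hi]
    have hi₂ := hr₂.reg i (by omega)
    by_cases h0 : τ₂.reg 39 = 0
    · refine ⟨_, _, .seq e₁ (.seq e₂ (.ite_false h0 (.load (hb₂.2 _ _)))), by omega,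
        hr₂.setReg ?_, ho₂.trans (.setReg (by omega) _)⟩
      rw [hi₂, ← hm, State.stampedMem, if_pos (by omega)]
      rfl
    · refine ⟨_, _, .seq e₁ (.seq e₂ (.ite_true h0 (.const ?_))), by omega,
        hr₂.setReg ?_, ho₂.trans (.setReg (by omega) _)⟩
      · exact (Nat.zero_le _).trans_lt (hτ.1 0)
      · rw [← hm, State.stampedMem, if_neg (by omega)]
  | @store m i a s h =>
    intro τ hR hτ hr
    simp only [Program.regBound, max_le_iff] at hR
    have hi := hr.reg i (by omega)
    have ha := hr.reg a (by omega)
    refine ⟨_, _, .seq (.store (hτ.1 _)) (.store (hτ.1 _)), by omega, ?_,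
      (OuterEq.setMem (by omega) _).trans (OuterEq.setMem (by omega) _)⟩
    simp only [setMem_reg, hi, ha]
    exact hr.setMem
  | seq _ _ ih₁ ih₂ =>
    intro τ hR hτ hr
    simp only [Program.regBound, max_le_iff] at hR
    obtain ⟨τ₁, u₁, e₁, l₁, r₁, o₁⟩ := ih₁ τ hR.1 hτ hr
    obtain ⟨τ₂, u₂, e₂, l₂, r₂, o₂⟩ := ih₂ τ₁ hR.2 (e₁.bounded hτ) r₁
    exact ⟨τ₂, _, .seq e₁ e₂, by omega, r₂, o₁.trans o₂⟩
  | ite_true h _ ih =>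
    intro τ hR hτ hr
    simp only [Program.regBound, max_le_iff] at hR
    obtain ⟨τ₁, u₁, e₁, l₁, r₁, o₁⟩ := ih τ hR.2.1 hτ hr
    exact ⟨τ₁, _, .ite_true (by rwa [hr.reg _ (by omega)]) e₁, by omega, r₁, o₁⟩
  | ite_false h _ ih =>
    intro τ hR hτ hr
    simp only [Program.regBound, max_le_iff] at hR
    obtain ⟨τ₁, u₁, e₁, l₁, r₁, o₁⟩ := ih τ hR.2.2 hτ hr
    exact ⟨τ₁, _, .ite_false (by rwa [hr.reg _ (by omega)]) e₁, by omega, r₁, o₁⟩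
  | loop_done h =>
    intro τ hR _ hr
    simp only [Program.regBound, max_le_iff] at hR
    exact ⟨τ, _, .loop_done (by rwa [hr.reg _ (by omega)]), by omega, hr, .refl τ⟩
  | loop_step h _ _ ih₁ ih₂ =>
    intro τ hR hτ hr
    have hR' := hR
    simp only [Program.regBound, max_le_iff] at hR'
    obtain ⟨τ₁, u₁, e₁, l₁, r₁, o₁⟩ := ih₁ τ hR'.2 hτ hr
    obtain ⟨τ₂, u₂, e₂, l₂, r₂, o₂⟩ := ih₂ τ₁ hR (e₁.bounded hτ) r₁
    exact ⟨τ₂, _, .loop_step (by rwa [hr.reg _ (by omega)]) e₁ e₂, by omega, r₂, o₁.trans o₂⟩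

/-- Set the registers `40, …, 39 + R` to `0`. -/
def clearRegs : ℕ → Program
  | 0 => .const 40 0
  | R + 1 => .seq (clearRegs R) (.const (40 + R) 0)

theorem exec_clearRegs {B : ℕ} (hB : 0 < B) (s : State) : ∀ R : ℕ,
    ∃ s', Exec B (clearRegs R) s s' (R + 1) ∧ (∀ r < R, s'.reg (40 + r) = 0) ∧
      (∀ r < 40, s'.reg r = s.reg r) ∧ s'.mem = s.mem
  | 0 => ⟨_, .const hB, by simp, fun r hr => by simp [hr.ne], rfl⟩
  | R + 1 => by
    obtain ⟨s₁, e₁, z₁, r₁, m₁⟩ := exec_clearRegs hB s R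
    refine ⟨_, .seq e₁ (.const hB), fun r hr => ?_, fun r hr => ?_, ?_⟩
    · simp only [setReg_reg]
      split_ifs with h
      · rfl
      · exact z₁ r (by omega)
    · have : r ≠ 40 + R := by omega
      simp [this, r₁ r hr]
    · simp [m₁]

end WordRAM

/-! ### Triangles as cheapest paths of prescribed length. -/

namespace Viterbi

open WordRAM Finset

/-- The cost matrix of a state graph that consists of a line `0, …, L - 1`, a ring
`L, …, 2 * L - 1` and two layers `2 * L + k` and `2 * L + z + j`, with `k, j < z`: steps along the
line and the ring are free, those from the line to the first layer, on to the second layer and on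
to the ring cost `e₁ i k`, `e₂ k j` and `e₃ j i`, and all others cost `P`. -/
def stepCost (L z P : ℕ) (e₁ e₂ e₃ : ℕ → ℕ → ℕ) (u v : ℕ) : ℕ :=
  if u < L then
    if v < L then (if v = u + 1 then 0 else P)
    else if v < 2 * L then P
    else if v < 2 * L + z then e₁ u (v - 2 * L) else P
  else if u < 2 * L then (if v = L + (u - L + 1) % L then 0 else P)
  else if u < 2 * L + z then
    if v < 2 * L + z then P
    else if v < 2 * L + 2 * z then e₂ (u - 2 * L) (v - (2 * L + z)) else P
  else if u < 2 * L + 2 * z then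
    if v < L then P
    else if v < 2 * L then e₃ (u - (2 * L + z)) (v - L) else P
  else P

/-- The step costs, modified by a potential that rewards the end of the path being `e`. -/
def endCost (P e : ℕ) (c : ℕ → ℕ → ℕ) (u v : ℕ) : ℕ :=
  c u v + P + (if u = e then P else 0) - (if v = e then P else 0)

/-- The corrections telescope. The `P` added to every step keeps the truncated subtraction exact and
contributes only the constant `T * P`. -/
theorem sum_endCost (P e : ℕ) (c : ℕ → ℕ → ℕ) (u : ℕ → ℕ) (T : ℕ) :
    ∑ t ∈ range T, endCost P e c (u t) (u (t + 1)) + (if u T = e then P else 0) =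
      ∑ t ∈ range T, c (u t) (u (t + 1)) + T * P + (if u 0 = e then P else 0) := by
  induction T with
  | zero => simp
  | succ T ih =>
    rw [sum_range_succ, sum_range_succ, Nat.succ_mul]
    have : endCost P e c (u T) (u (T + 1)) + (if u (T + 1) = e then P else 0) =
        c (u T) (u (T + 1)) + P + (if u T = e then P else 0) := by
      unfold endCost
      split_ifs <;> omega
    omega

/-- The path through the `i`-th state of the line and the states `k` and `j` of the layers. -/
def trianglePath (L z i k j t : ℕ) : ℕ :=
  if t ≤ i then t else if t = i + 1 then 2 * L + k else if t = i + 2 then 2 * L + z + j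
  else L + (t - 3) % L

/-- The path is in state `t` of the line at each time `t ≤ i`, and the shift by `3` in the ring
position makes it enter the ring at `L + i`, at time `i + 3`. Only the three steps in between are
not free. -/
theorem stepCost_trianglePath {L z P : ℕ} {e₁ e₂ e₃ : ℕ → ℕ → ℕ} {i k j : ℕ}
    (hi : i < L) (hk : k < z) (hj : j < z) (t : ℕ) :
    stepCost L z P e₁ e₂ e₃ (trianglePath L z i k j t) (trianglePath L z i k j (t + 1)) =
      (if t = i then e₁ i k else 0) + (if t = i + 1 then e₂ k j else 0) +
        (if t = i + 2 then e₃ j i else 0) := by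
  have hL : 0 < L := by omega
  rcases lt_trichotomy t i with h | h | h
  · have h₁ : trianglePath L z i k j t = t := by rw [trianglePath, if_pos (by omega)]
    have h₂ : trianglePath L z i k j (t + 1) = t + 1 := by rw [trianglePath, if_pos (by omega)]
    rw [h₁, h₂, if_neg (by omega), if_neg (by omega), if_neg (by omega), stepCost,
      if_pos (by omega), if_pos (by omega), if_pos rfl]
  · subst h
    have h₁ : trianglePath L z t k j t = t := by rw [trianglePath, if_pos (by omega)]
    have h₂ : trianglePath L z t k j (t + 1) = 2 * L + k := by
      rw [trianglePath, if_neg (by omega), if_pos rfl]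
    rw [h₁, h₂, if_pos rfl, if_neg (by omega), if_neg (by omega), stepCost,
      if_pos (by omega), if_neg (by omega), if_neg (by omega), if_pos (by omega)]
    simp
  rcases eq_or_ne t (i + 1) with h' | h'
  · subst h'
    have h₁ : trianglePath L z i k j (i + 1) = 2 * L + k := by
      rw [trianglePath, if_neg (by omega), if_pos rfl]
    have h₂ : trianglePath L z i k j (i + 1 + 1) = 2 * L + z + j := by
      rw [trianglePath, if_neg (by omega), if_neg (by omega), if_pos rfl]
    rw [h₁, h₂, if_neg (by omega), if_pos rfl, if_neg (by omega), stepCost,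
      if_neg (by omega), if_neg (by omega), if_pos (by omega), if_neg (by omega),
      if_pos (by omega)]
    simp
  rcases eq_or_ne t (i + 2) with h'' | h''
  · subst h''
    have h₁ : trianglePath L z i k j (i + 2) = 2 * L + z + j := by
      rw [trianglePath, if_neg (by omega), if_neg (by omega), if_pos rfl]
    have h₂ : trianglePath L z i k j (i + 2 + 1) = L + i := by
      rw [trianglePath, if_neg (by omega), if_neg (by omega), if_neg (by omega),
        show i + 2 + 1 - 3 = i by omega, Nat.mod_eq_of_lt hi]
    rw [h₁, h₂, if_neg (by omega), if_neg (by omega), if_pos rfl, stepCost,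
      if_neg (by omega), if_neg (by omega), if_neg (by omega), if_pos (by omega),
      if_neg (by omega), if_pos (by omega)]
    simp
  · have h₁ : trianglePath L z i k j t = L + (t - 3) % L := by
      rw [trianglePath, if_neg (by omega), if_neg (by omega), if_neg (by omega)]
    have h₂ : trianglePath L z i k j (t + 1) = L + (t + 1 - 3) % L := by
      rw [trianglePath, if_neg (by omega), if_neg (by omega), if_neg (by omega)]
    have h₃ := Nat.mod_lt (t - 3) hL
    rw [h₁, h₂, if_neg (by omega), if_neg (by omega), if_neg (by omega), stepCost,
      if_neg (by omega), if_pos (by omega), if_pos]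
    rw [show t + 1 - 3 = t - 3 + 1 by omega, Nat.add_sub_cancel_left, Nat.mod_add_mod]

theorem sum_stepCost_trianglePath {L z P : ℕ} {e₁ e₂ e₃ : ℕ → ℕ → ℕ} {i k j : ℕ}
    (hi : i < L) (hk : k < z) (hj : j < z) {T : ℕ} (hT : i + 3 ≤ T) :
    ∑ t ∈ range T, stepCost L z P e₁ e₂ e₃ (trianglePath L z i k j t)
      (trianglePath L z i k j (t + 1)) = e₁ i k + e₂ k j + e₃ j i := by
  simp_rw [stepCost_trianglePath hi hk hj, sum_add_distrib, sum_ite_eq', mem_range]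
  rw [if_pos (by omega), if_pos (by omega), if_pos (by omega)]

theorem trianglePath_lt {L z i k j N : ℕ} (hi : i < L) (hk : k < z) (hj : j < z)
    (hN : 2 * L + 2 * z ≤ N) (t : ℕ) : trianglePath L z i k j t < N := by
  have h₃ := Nat.mod_lt (t - 3) (by omega : 0 < L)
  unfold trianglePath
  split_ifs <;> omega

/-- A path of least cost runs through a triangle of least weight. -/
theorem exists_min_triangle {L z P T N : ℕ} {e₁ e₂ e₃ : ℕ → ℕ → ℕ} (hL : 0 < L) (hz : 0 < z)
    (hT : L + 2 ≤ T) (hN : 2 * L + 2 * z ≤ N)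
    (hP : ∀ i < L, ∀ k < z, ∀ j < z, e₁ i k + e₂ k j + e₃ j i < P)
    {u : ℕ → ℕ} (hu₀ : u 0 = 0)
    (hmin : ∀ v : ℕ → ℕ, v 0 = 0 → (∀ t, v t < N) →
      ∑ t ∈ range T, endCost P (L + (T - 3) % L) (stepCost L z P e₁ e₂ e₃) (u t) (u (t + 1)) ≤
      ∑ t ∈ range T, endCost P (L + (T - 3) % L) (stepCost L z P e₁ e₂ e₃) (v t) (v (t + 1))) :
    ∃ t, t + 2 ≤ T ∧ ∃ i < L, ∃ k < z, ∃ j < z,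
      u t = i ∧ u (t + 1) = 2 * L + k ∧ u (t + 2) = 2 * L + z + j ∧
      ∀ i' < L, ∀ k' < z, ∀ j' < z, e₁ i k + e₂ k j + e₃ j i ≤ e₁ i' k' + e₂ k' j' + e₃ j' i' := by
  set e := L + (T - 3) % L with he
  set c := stepCost L z P e₁ e₂ e₃ with hc
  have heL := Nat.mod_lt (T - 3) hL
  -- Compare with `trianglePath`, which ends in `e` and costs less than `P`: a path that ends
  -- elsewhere misses a reward of `P` and cannot be optimal.
  have upper : ∀ i < L, ∀ k < z, ∀ j < z, u T = e ∧
      ∑ t ∈ range T, c (u t) (u (t + 1)) ≤ e₁ i k + e₂ k j + e₃ j i := by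
    intro i hi k hk j hj
    have h₁ := hmin (trianglePath L z i k j) (by simp [trianglePath])
      (trianglePath_lt hi hk hj hN)
    have h₂ := sum_endCost P e c (trianglePath L z i k j) T
    have h₃ := sum_endCost P e c u T
    rw [sum_stepCost_trianglePath hi hk hj (by omega)] at h₂
    have h₄ : trianglePath L z i k j T = e := by
      rw [trianglePath, if_neg (by omega), if_neg (by omega), if_neg (by omega)]
    have h₅ : trianglePath L z i k j 0 = 0 := by simp [trianglePath]
    rw [h₄, h₅, if_pos rfl, if_neg (by omega)] at h₂
    rw [hu₀, if_neg (by omega : ¬ 0 = e)] at h₃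
    have h₆ := hP i hi k hk j hj
    split_ifs at h₃ with h
    · exact ⟨h, by omega⟩
    · omega
  have huT := (upper 0 hL 0 hz 0 hz).1
  -- One step of cost `P` would outweigh a whole triangle, so the path follows the edges of the
  -- gadget.
  have hstep : ∀ t < T, c (u t) (u (t + 1)) < P := by
    intro t ht
    have h₁ := single_le_sum (f := fun t => c (u t) (u (t + 1))) (fun _ _ => Nat.zero_le _)
      (mem_range.2 ht)
    exact (h₁.trans (upper 0 hL 0 hz 0 hz).2).trans_lt (hP 0 hL 0 hz 0 hz)
  -- The first time off the line; it exists because the path ends on the ring.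
  obtain ⟨τ, hτ, hτmin⟩ : ∃ τ, L ≤ u τ ∧ ∀ t < τ, u t < L := by
    have h : ∃ τ, L ≤ u τ := ⟨T, by omega⟩
    exact ⟨Nat.find h, Nat.find_spec h, fun t ht => not_le.1 (Nat.find_min h ht)⟩
  have hτT : τ ≤ T := by
    by_contra h
    have := hτmin T (by omega)
    omega
  have hline : ∀ t < τ, u t = t := by
    intro t
    induction t with
    | zero => exact fun _ => hu₀
    | succ t ih =>
      intro ht
      have h₁ := hstep t (by omega)
      have h₂ := hτmin t (by omega)
      have h₃ := hτmin (t + 1) ht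
      rw [hc, stepCost, if_pos h₂, if_pos h₃] at h₁
      split_ifs at h₁ with h
      · rw [h, ih (by omega)]
      · omega
  obtain ⟨i, rfl⟩ : ∃ i, τ = i + 1 := by
    cases τ with
    | zero => omega
    | succ i => exact ⟨i, rfl⟩
  have hi : u i = i := hline i (by omega)
  have hiL : i < L := hi ▸ hτmin i (by omega)
  have s₁ := hstep i (by omega)
  obtain ⟨k, hk, huk⟩ : ∃ k < z, u (i + 1) = 2 * L + k := by
    rw [hc, stepCost, if_pos (by omega), if_neg (by omega)] at s₁
    split_ifs at s₁ with h h'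
    · omega
    · exact ⟨u (i + 1) - 2 * L, by omega, by omega⟩
    · omega
  -- The path cannot stop in a layer, since its end `e` lies on the ring.
  have hlt₁ : i + 1 < T := by
    refine lt_of_le_of_ne hτT fun h => ?_
    rw [h] at huk
    omega
  have s₂ := hstep (i + 1) hlt₁
  obtain ⟨j, hj, huj⟩ : ∃ j < z, u (i + 1 + 1) = 2 * L + z + j := by
    rw [hc, stepCost, if_neg (by omega), if_neg (by omega), if_pos (by omega)] at s₂
    split_ifs at s₂ with h h'
    · omega
    · exact ⟨u (i + 1 + 1) - (2 * L + z), by omega, by omega⟩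
    · omega
  have hlt₂ : i + 1 + 1 < T := by
    refine lt_of_le_of_ne hlt₁ fun h => ?_
    rw [h] at huj
    omega
  have s₃ := hstep (i + 1 + 1) hlt₂
  obtain ⟨x, hx, hux⟩ : ∃ x < L, u (i + 1 + 1 + 1) = L + x := by
    rw [hc, stepCost, if_neg (by omega), if_neg (by omega), if_neg (by omega),
      if_pos (by omega)] at s₃
    split_ifs at s₃ with h h'
    · omega
    · exact ⟨u (i + 1 + 1 + 1) - L, by omega, by omega⟩
    · omega
  have hring : ∀ d, i + 3 + d ≤ T → u (i + 3 + d) = L + (x + d) % L := by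
    intro d
    induction d with
    | zero =>
      intro _
      rw [Nat.add_zero x, Nat.mod_eq_of_lt hx]
      exact hux
    | succ d ih =>
      intro hd
      have h₁ := hstep (i + 3 + d) (by omega)
      have h₂ := Nat.mod_lt (x + d) hL
      rw [ih (by omega), hc, stepCost, if_neg (by omega), if_pos (by omega)] at h₁
      split_ifs at h₁ with h
      · rw [← Nat.add_assoc, h, Nat.add_sub_cancel_left, Nat.mod_add_mod, Nat.add_assoc]
      · omega
  -- The ring was entered at position `x` at time `i + 3`, and the end is the position reached from
  -- `i` by the same number of steps. So `x ≡ i` modulo `L`, and both are below `L`.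
  have hxi : x = i := by
    have h₁ := hring (T - (i + 3)) (by omega)
    rw [show i + 3 + (T - (i + 3)) = T by omega, huT] at h₁
    have h₂ : i + (T - (i + 3)) ≡ x + (T - (i + 3)) [MOD L] := by
      have : (T - 3) % L = (x + (T - (i + 3))) % L := by omega
      rw [show T - 3 = i + (T - (i + 3)) by omega] at this
      exact this
    have h₃ := Nat.ModEq.add_right_cancel' _ h₂
    rw [Nat.ModEq, Nat.mod_eq_of_lt hiL, Nat.mod_eq_of_lt hx] at h₃
    exact h₃.symm
  subst hxi
  refine ⟨x, hlt₁, x, hx, k, hk, j, hj, hi, huk, huj, fun i' hi' k' hk' j' hj' => ?_⟩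
  refine le_trans ?_ (upper i' hi' k' hk' j' hj').2
  -- These three steps already cost as much as the triangle.
  have hsub : ({x, x + 1, x + 1 + 1} : Finset ℕ) ⊆ range T := by
    intro t ht
    simp only [mem_insert, mem_singleton] at ht
    rw [mem_range]
    omega
  refine le_trans (le_of_eq ?_) (sum_le_sum_of_subset hsub)
  rw [sum_insert (by simp; omega), sum_insert (by simp), sum_singleton, hi, huk, huj, hux, hc]
  have c₁ : stepCost L z P e₁ e₂ e₃ x (2 * L + k) = e₁ x k := by
    rw [stepCost, if_pos (by omega), if_neg (by omega), if_neg (by omega), if_pos (by omega),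
      Nat.add_sub_cancel_left]
  have c₂ : stepCost L z P e₁ e₂ e₃ (2 * L + k) (2 * L + z + j) = e₂ k j := by
    rw [stepCost, if_neg (by omega), if_neg (by omega), if_pos (by omega), if_neg (by omega),
      if_pos (by omega), Nat.add_sub_cancel_left, Nat.add_sub_cancel_left]
  have c₃ : stepCost L z P e₁ e₂ e₃ (2 * L + z + j) (L + x) = e₃ j x := by
    rw [stepCost, if_neg (by omega), if_neg (by omega), if_neg (by omega), if_pos (by omega),
      if_neg (by omega), if_pos (by omega), Nat.add_sub_cancel_left, Nat.add_sub_cancel_left]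
  rw [c₁, c₂, c₃, Nat.add_assoc]

end Viterbi

/-! ### Distance estimates with recorded first steps. -/

namespace APSP

open WordRAM

/-- `D` holds upper bounds for the distances, row by row, with `V` for infinity; the bounds are
attained by walks whose first step is recorded in `nx`. -/
structure Instance.Estimate (x : Instance) (V : ℕ) (D nx : ℕ → ℕ) : Prop where
  le : ∀ i j : Fin x.n, D (i * x.n + j) ≤ V
  diag : ∀ i : Fin x.n, D (i * x.n + i) = 0
  walk : ∀ i j : Fin x.n, i ≠ j → D (i * x.n + j) < V → ∃ b : Fin x.n,
    nx (i * x.n + j) = b ∧ x.graph.Adj i b ∧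
      ∃ p : x.graph.Walk b j, x.weight i b + x.walkWeight p ≤ D (i * x.n + j)
  none : ∀ i j : Fin x.n, i ≠ j → D (i * x.n + j) = V → nx (i * x.n + j) = x.n

/-- The estimates are right as far as walks of at most `l` edges are concerned. -/
def Instance.ExactUpTo (x : Instance) (D : ℕ → ℕ) (l : ℕ) : Prop :=
  ∀ (i j : Fin x.n) (p : x.graph.Walk i j), p.length ≤ l → D (i * x.n + j) ≤ x.walkWeight p

theorem Instance.walkWeight_cons (x : Instance) {u v w : Fin x.n} (h : x.graph.Adj u v)
    (p : x.graph.Walk v w) :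
    x.walkWeight (SimpleGraph.Walk.cons h p) = x.weight u v + x.walkWeight p := by
  simp [walkWeight]

theorem Instance.walkWeight_append (x : Instance) {u v w : Fin x.n} (p : x.graph.Walk u v)
    (q : x.graph.Walk v w) : x.walkWeight (p.append q) = x.walkWeight p + x.walkWeight q := by
  simp [walkWeight]

theorem index_inj {n i j i' j' : ℕ} (hj : j < n) (hj' : j' < n) :
    i * n + j = i' * n + j' ↔ i = i' ∧ j = j' := by
  constructor
  · intro h
    have h₁ : (i * n + j) / n = (i' * n + j') / n := by rw [h]
    have h₂ : (i * n + j) % n = (i' * n + j') % n := by rw [h]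
    rw [Nat.mul_comm i, Nat.mul_comm i', Nat.mul_add_div (by omega), Nat.mul_add_div (by omega),
      Nat.div_eq_of_lt hj, Nat.div_eq_of_lt hj'] at h₁
    rw [Nat.mul_comm i, Nat.mul_comm i', Nat.mul_add_mod, Nat.mul_add_mod,
      Nat.mod_eq_of_lt hj, Nat.mod_eq_of_lt hj'] at h₂
    exact ⟨h₁, h₂⟩
  · rintro ⟨rfl, rfl⟩
    rfl

theorem Instance.Estimate.exists_walk {x : Instance} {V : ℕ} {D nx : ℕ → ℕ}
    (h : x.Estimate V D nx) (i j : Fin x.n) (hV : D (i * x.n + j) < V) :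
    ∃ p : x.graph.Walk i j, x.walkWeight p ≤ D (i * x.n + j) := by
  by_cases hij : i = j
  · subst hij
    exact ⟨.nil, by simp [walkWeight]⟩
  · obtain ⟨b, -, hb, p, hp⟩ := h.walk i j hij hV
    exact ⟨.cons hb p, by rwa [x.walkWeight_cons]⟩

/-- Walks from `i` to `k` and from `k` to `j` are concatenated, so the first step is the one
recorded for `(i, k)`. It exists because `i ≠ k`: as `D ≤ E`, nothing can be gained through `i`
itself. Both parts are finite since their sum lies below `D ≤ V`. -/
theorem Instance.Estimate.relax {x : Instance} {V : ℕ} {D nx E nx' : ℕ → ℕ}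
    (h : x.Estimate V D nx) (h' : x.Estimate V E nx')
    (hDE : ∀ i j : Fin x.n, D (i * x.n + j) ≤ E (i * x.n + j)) (i j k : Fin x.n)
    (hlt : E (i * x.n + k) + E (k * x.n + j) < D (i * x.n + j)) :
    x.Estimate V (Function.update D (i * x.n + j) (E (i * x.n + k) + E (k * x.n + j)))
      (Function.update nx (i * x.n + j) (nx' (i * x.n + k))) := by
  have hV := h.le i j
  have hik : i ≠ k := by
    rintro rfl
    have := hDE i j
    omega
  have hij : i ≠ j := by
    rintro rfl
    have := h.diag i
    omega
  have key : ∀ i' j' : Fin x.n, (i' : ℕ) * x.n + j' = i * x.n + j ↔ i' = i ∧ j' = j := by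
    intro i' j'
    rw [index_inj j'.2 j.2, Fin.ext_iff, Fin.ext_iff]
  refine ⟨fun i' j' => ?_, fun i' => ?_, fun i' j' hne hlt' => ?_, fun i' j' hne heq => ?_⟩
  · rw [Function.update_apply]
    split_ifs with e
    · omega
    · exact h.le i' j'
  · rw [Function.update_apply, if_neg, h.diag i']
    rw [key]
    rintro ⟨rfl, rfl⟩
    exact hij rfl
  · rw [Function.update_apply] at hlt' ⊢
    rw [Function.update_apply]
    split_ifs at hlt' ⊢ with e
    · obtain ⟨rfl, rfl⟩ := (key i' j').1 e
      obtain ⟨b, hb, hb', p, hp⟩ := h'.walk i' k hik (by omega)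
      obtain ⟨q, hq⟩ := h'.exists_walk k j' (by omega)
      refine ⟨b, hb, hb', p.append q, ?_⟩
      rw [x.walkWeight_append]
      omega
    · exact h.walk i' j' hne hlt'
  · rw [Function.update_apply] at heq ⊢
    split_ifs at heq ⊢ with e
    · omega
    · exact h.none i' j' hne heq

theorem Instance.exists_split (x : Instance) {u v : Fin x.n} (p : x.graph.Walk u v) (l : ℕ) :
    ∃ (k : Fin x.n) (q : x.graph.Walk u k) (r : x.graph.Walk k v), q.length ≤ l ∧
      r.length ≤ p.length - l ∧ x.walkWeight p = x.walkWeight q + x.walkWeight r := by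
  induction p generalizing l with
  | nil => exact ⟨_, .nil, .nil, by simp, by simp, by simp [walkWeight]⟩
  | cons h p ih =>
    cases l with
    | zero => exact ⟨_, .nil, .cons h p, by simp, by simp, by simp [walkWeight]⟩
    | succ l =>
      obtain ⟨k, q, r, hq, hr, hw⟩ := ih l
      refine ⟨k, .cons h q, r, by simpa using hq, by simpa using hr, ?_⟩
      rw [x.walkWeight_cons, x.walkWeight_cons, hw, Nat.add_assoc]

/-- A walk of at most `2 * l` edges is cut after `l` edges. -/
theorem Instance.ExactUpTo.double {x : Instance} {E D : ℕ → ℕ} {l : ℕ} (h : x.ExactUpTo E l)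
    (hD : ∀ i j k : Fin x.n, D (i * x.n + j) ≤ E (i * x.n + k) + E (k * x.n + j)) :
    x.ExactUpTo D (2 * l) := by
  intro i j p hp
  obtain ⟨k, q, r, hq, hr, hw⟩ := x.exists_split p l
  have h₁ := h i k q hq
  have h₂ := h k j r (by omega)
  have := hD i j k
  omega

/-- Removing cycles only deletes darts, and weights are nonnegative. -/
theorem Instance.exists_path (x : Instance) {u v : Fin x.n} (q : x.graph.Walk u v) :
    ∃ p : x.graph.Walk u v, p.length < x.n ∧ x.walkWeight p ≤ x.walkWeight q := by
  refine ⟨q.bypass, ?_, ?_⟩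
  · simpa using (q.bypass_isPath).length_lt
  · have := (q.darts_bypass_sublist_darts).map fun d => x.weight d.fst d.snd
    exact this.sum_le_sum (by simp)

theorem Instance.walkWeight_le (x : Instance) {W : ℕ} (hW : ∀ u v, x.weight u v ≤ W)
    {u v : Fin x.n} (p : x.graph.Walk u v) : x.walkWeight p ≤ p.length * W := by
  induction p with
  | nil => simp [walkWeight]
  | @cons u v _ h p ih =>
    rw [x.walkWeight_cons, SimpleGraph.Walk.length_cons, Nat.succ_mul]
    have := hW u v
    omega

/-- Estimates that are right for all walks solve the problem. -/
theorem Instance.Estimate.isSolution {x : Instance} {V W : ℕ} {D nx : ℕ → ℕ}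
    (h : x.Estimate V D nx) (h' : x.ExactUpTo D x.n) (hW : ∀ u v, x.weight u v ≤ W)
    (hV : ∀ l < x.n, 1 < x.n → l * W < V) :
    x.IsSolution fun u v => nx (u * x.n + v) := by
  have exact (u v : Fin x.n) (q : x.graph.Walk u v) : D (u * x.n + v) ≤ x.walkWeight q := by
    obtain ⟨p, hp, hpq⟩ := x.exists_path q
    exact (h' u v p hp.le).trans hpq
  have fin (u v : Fin x.n) (q : x.graph.Walk u v) (huv : u ≠ v) : D (u * x.n + v) < V := by
    have h1 : 1 < x.n := by
      by_contra hn
      exact huv (Fin.ext (by omega))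
    obtain ⟨p, hp, hpq⟩ := x.exists_path q
    exact ((exact u v p).trans (x.walkWeight_le hW p)).trans_lt (hV _ hp h1)
  -- Induction on the estimate: edge weights are positive and the estimates are exact, so the
  -- estimate drops strictly along each recorded step and the steps cannot run into a cycle.
  have follow : ∀ (d : ℕ) (u v : Fin x.n), D (u * x.n + v) = d → x.graph.Reachable u v →
      ∃ p : x.graph.Walk u v, x.walkWeight p ≤ d ∧
        ∀ e ∈ p.darts, nx ((e.fst : ℕ) * x.n + v) = e.snd := by
    intro d
    induction d using Nat.strong_induction_on with
    | _ d ih =>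
      intro u v hd hr
      by_cases huv : u = v
      · subst huv
        exact ⟨.nil, by simp [walkWeight], by simp⟩
      obtain ⟨q⟩ := hr
      obtain ⟨b, hb, hub, r, hr⟩ := h.walk u v huv (fin u v q huv)
      have h₁ := exact b v r
      have h₂ : x.weight u b ≠ 0 := hub
      obtain ⟨p, hp, hn⟩ := ih (D (b * x.n + v)) (by omega) b v rfl ⟨r⟩
      refine ⟨.cons hub p, ?_, ?_⟩
      · rw [x.walkWeight_cons]
        omega
      · intro e he
        rw [SimpleGraph.Walk.darts_cons, List.mem_cons] at he
        rcases he with rfl | he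
        · exact hb
        · exact hn e he
  intro u v
  refine ⟨fun hr => ?_, fun hr => ?_⟩
  · obtain ⟨p, hp, hn⟩ := follow _ u v rfl hr
    exact ⟨p, fun q => hp.trans (exact u v q), hn⟩
  · have huv : u ≠ v := by
      rintro rfl
      exact hr (SimpleGraph.Reachable.refl u)
    refine h.none u v huv (le_antisymm (h.le u v) (not_lt.1 fun hlt => ?_))
    obtain ⟨p, -⟩ := h.exists_walk u v hlt
    exact hr ⟨p⟩

/-- The estimates to start with. -/
theorem Instance.Estimate.initial {x : Instance} {V W : ℕ} {D nx : ℕ → ℕ}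
    (hW : ∀ u v, x.weight u v ≤ W) (hV : 1 < x.n → W < V)
    (hD : ∀ i j : Fin x.n, D (i * x.n + j) =
      if i = j then 0 else if x.weight i j = 0 then V else x.weight i j)
    (hnx : ∀ i j : Fin x.n, nx (i * x.n + j) = if x.weight i j = 0 then x.n else j) :
    x.Estimate V D nx ∧ x.ExactUpTo D 1 := by
  have hV' : ∀ i j : Fin x.n, i ≠ j → x.weight i j < V := by
    intro i j hij
    refine (hW i j).trans_lt (hV ?_)
    by_contra hn
    exact hij (Fin.ext (by omega))
  refine ⟨⟨fun i j => ?_, fun i => ?_, fun i j hij hlt => ?_, fun i j hij heq => ?_⟩, ?_⟩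
  · rw [hD]
    split_ifs with h₁ h₂
    · omega
    · exact le_rfl
    · exact (hV' i j h₁).le
  · rw [hD, if_pos rfl]
  · rw [hD, if_neg hij] at hlt ⊢
    rw [hnx]
    split_ifs at hlt ⊢ with h₂
    · omega
    · exact ⟨j, rfl, h₂, .nil, by simp [walkWeight]⟩
  · rw [hD, if_neg hij] at heq
    rw [hnx]
    split_ifs at heq ⊢ with h₂
    · rfl
    · exact absurd heq (hV' i j hij).ne
  · intro i j p hp
    cases p with
    | nil => rw [hD, if_pos rfl]; omega
    | @cons _ b _ hb p =>
      cases p with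
      | nil =>
        rw [hD, if_neg hb.ne, if_neg hb, x.walkWeight_cons]
        omega
      | cons _ p => simp at hp

end APSP

/-! ### Parameters, blocks and the cost matrix of a block. -/

namespace WordRAM

namespace Expr

/-- `x` if `a < b`, else `y`. -/
def ifLT (a b x y : Expr) : Expr := cond (sub b a) x y

/-- `x` if `a = b`, else `y`. -/
def ifEQ (a b x y : Expr) : Expr := cond (sub a b) y (cond (sub b a) y x)

@[simp] theorem eval_ifLT (s : State) (a b x y : Expr) :
    (ifLT a b x y).eval s = if a.eval s < b.eval s then x.eval s else y.eval s := by
  change (if b.eval s - a.eval s ≠ 0 then x.eval s else y.eval s) = _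
  split_ifs <;> first | rfl | omega

@[simp] theorem eval_ifEQ (s : State) (a b x y : Expr) :
    (ifEQ a b x y).eval s = if a.eval s = b.eval s then x.eval s else y.eval s := by
  change (if a.eval s - b.eval s ≠ 0 then y.eval s else
    if b.eval s - a.eval s ≠ 0 then y.eval s else x.eval s) = _
  split_ifs <;> first | rfl | omega

@[simp] theorem ok_ifLT (B : ℕ) (s : State) (a b x y : Expr) :
    (ifLT a b x y).Ok B s ↔ b.Ok B s ∧ a.Ok B s ∧ (a.eval s < b.eval s → x.Ok B s) ∧
      (b.eval s ≤ a.eval s → y.Ok B s) := by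
  simp only [ifLT, Ok, eval, Nat.sub_eq_zero_iff_le, and_assoc, ne_eq, not_le]

theorem ok_ifEQ {B : ℕ} {s : State} {a b x y : Expr} (ha : a.Ok B s) (hb : b.Ok B s)
    (hx : a.eval s = b.eval s → x.Ok B s) (hy : a.eval s ≠ b.eval s → y.Ok B s) :
    (ifEQ a b x y).Ok B s := by
  simp only [ifEQ, Ok, eval]
  exact ⟨⟨ha, hb⟩, fun h => hy (by omega), fun h => ⟨⟨hb, ha⟩, fun h' => hy (by omega),
    fun h' => hx (by omega)⟩⟩

/-- The position `a * n + b`, where `n` is the content of register `0`. -/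
def idx (a b : Expr) : Expr := add (mul a (var 0)) b

@[simp] theorem eval_idx (s : State) (a b : Expr) :
    (idx a b).eval s = a.eval s * s.reg 0 + b.eval s := rfl

theorem ok_idx {B : ℕ} {s : State} {a b : Expr} (ha : a.Ok B s) (hb : b.Ok B s)
    (hB : s.reg 0 * s.reg 0 ≤ B) (ha' : a.eval s < s.reg 0) (hb' : b.eval s < s.reg 0) :
    (idx a b).Ok B s := by
  have h : (a.eval s + 1) * s.reg 0 ≤ s.reg 0 * s.reg 0 := Nat.mul_le_mul_right _ ha'
  rw [Nat.add_mul, Nat.one_mul] at h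
  simp only [idx, Ok, eval]
  exact ⟨⟨ha, by omega, by omega⟩, hb, by omega⟩

end Expr

/-- An entry of an `n × n` matrix, or `V` outside of the matrix. -/
def paddedEntry (n V : ℕ) (E : ℕ → ℕ) (a b : ℕ) : ℕ :=
  if a < n then if b < n then E (a * n + b) else V else V

theorem paddedEntry_le {n V : ℕ} {E : ℕ → ℕ} (hE : ∀ a < n, ∀ b < n, E (a * n + b) ≤ V)
    (a b : ℕ) : paddedEntry n V E a b ≤ V := by
  unfold paddedEntry
  split_ifs with h h'
  exacts [hE a h b h', le_rfl, le_rfl]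

/-- The parameters of the reduction: `n` vertices, infinity `V`, and, for the instances of the
Viterbi path problem, `N` states, `T` steps, a line of `L` states and layers of `z` states. -/
structure Params where
  n : ℕ
  V : ℕ
  N : ℕ
  T : ℕ
  L : ℕ
  z : ℕ

namespace Params

/-- The number of intervals of length `z` that cover the vertices. -/
def layers (p : Params) : ℕ := p.n / p.z + 1

/-- The number of blocks. -/
def blocks (p : Params) : ℕ := (p.n / p.L + 1) * (p.layers * p.layers)

/-- The first vertex in the first coordinate of block `b`. -/
def fstBase (p : Params) (b : ℕ) : ℕ := b / (p.layers * p.layers) * p.L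

/-- The first vertex in the middle coordinate of block `b`. -/
def midBase (p : Params) (b : ℕ) : ℕ := b / p.layers % p.layers * p.z

/-- The first vertex in the last coordinate of block `b`. -/
def lstBase (p : Params) (b : ℕ) : ℕ := b % p.layers * p.z

/-- The parameters are sound and the words have room for the numbers that occur. -/
structure Fits (p : Params) (B : ℕ) : Prop where
  n_pos : 0 < p.n
  V_pos : 0 < p.V
  L_pos : 0 < p.L
  z_pos : 0 < p.z
  T_ge : p.L + 2 ≤ p.T
  N_ge : 2 * p.L + 2 * p.z ≤ p.N
  T_le : p.T ≤ p.N
  N_sq : p.N * p.N < B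
  n_sq : p.n * p.n < B
  n_add : p.n + p.N + 3 < B
  V_lt : 12 * p.V < B
  blocks_lt : p.blocks < B

/-- The registers hold the parameters. -/
structure Env (p : Params) (s : State) : Prop where
  n : s.reg 0 = p.n
  V : s.reg 1 = p.V
  N : s.reg 3 = p.N
  T : s.reg 4 = p.T
  L : s.reg 5 = p.L
  z : s.reg 6 = p.z
  P : s.reg 7 = 4 * p.V
  layers : s.reg 8 = p.layers
  blocks : s.reg 9 = p.blocks

theorem Env.congr {p : Params} {s s' : State} (h : p.Env s)
    (hs : ∀ r < 10, s'.reg r = s.reg r) : p.Env s' :=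
  ⟨(hs 0 (by omega)).trans h.n, (hs 1 (by omega)).trans h.V, (hs 3 (by omega)).trans h.N,
    (hs 4 (by omega)).trans h.T, (hs 5 (by omega)).trans h.L, (hs 6 (by omega)).trans h.z,
    (hs 7 (by omega)).trans h.P, (hs 8 (by omega)).trans h.layers,
    (hs 9 (by omega)).trans h.blocks⟩

/-- The costs of the Viterbi instance for the block based at `i₀, j₀, k₀`. -/
def blockCost (p : Params) (i₀ j₀ k₀ : ℕ) (E D : ℕ → ℕ) : ℕ → ℕ → ℕ :=
  Viterbi.endCost (4 * p.V) (p.L + (p.T - 3) % p.L) (Viterbi.stepCost p.L p.z (4 * p.V)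
    (fun i k => paddedEntry p.n p.V E (i₀ + i) (k₀ + k))
    (fun k j => paddedEntry p.n p.V E (k₀ + k) (j₀ + j))
    (fun j i => paddedEntry p.n p.V (fun y => p.V - D y) (i₀ + i) (j₀ + j)))

end Params

open WordRAM.Expr

/-- Evaluates `paddedEntry`. -/
def entryExpr (a b : Expr) (f : Expr → Expr) : Expr :=
  ifLT a (var 0) (ifLT b (var 0) (f (idx a b)) (var 1)) (var 1)

/-- Evaluates `Viterbi.stepCost` for the states in registers `19` and `20`. -/
def stepCostExpr : Expr :=
  ifLT (var 19) (var 5)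
    (ifLT (var 20) (var 5) (ifEQ (var 20) (add (var 19) (lit 1)) (lit 0) (var 7))
      (ifLT (var 20) (mul (lit 2) (var 5)) (var 7)
        (ifLT (var 20) (add (mul (lit 2) (var 5)) (var 6))
          (entryExpr (add (var 13) (var 19)) (add (var 15) (sub (var 20) (mul (lit 2) (var 5))))
            (arr 3)) (var 7))))
    (ifLT (var 19) (mul (lit 2) (var 5))
      (ifEQ (var 20) (add (var 5) (mod (add (sub (var 19) (var 5)) (lit 1)) (var 5)))
        (lit 0) (var 7))
      (ifLT (var 19) (add (mul (lit 2) (var 5)) (var 6))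
        (ifLT (var 20) (add (mul (lit 2) (var 5)) (var 6)) (var 7)
          (ifLT (var 20) (add (mul (lit 2) (var 5)) (mul (lit 2) (var 6)))
            (entryExpr (add (var 15) (sub (var 19) (mul (lit 2) (var 5))))
              (add (var 14) (sub (var 20) (add (mul (lit 2) (var 5)) (var 6)))) (arr 3))
            (var 7)))
        (ifLT (var 19) (add (mul (lit 2) (var 5)) (mul (lit 2) (var 6)))
          (ifLT (var 20) (var 5) (var 7)
            (ifLT (var 20) (mul (lit 2) (var 5))
              (entryExpr (add (var 13) (sub (var 20) (var 5)))
                (add (var 14) (sub (var 19) (add (mul (lit 2) (var 5)) (var 6))))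
                fun y => sub (var 1) (arr 2 y))
              (var 7)))
          (var 7))))

/-- Evaluates `Params.blockCost`. -/
def blockCostExpr : Expr :=
  sub (add (add stepCostExpr (var 7))
    (ifEQ (var 19) (add (var 5) (mod (sub (var 4) (lit 3)) (var 5))) (var 7) (lit 0)))
    (ifEQ (var 20) (add (var 5) (mod (sub (var 4) (lit 3)) (var 5))) (var 7) (lit 0))

theorem eval_entryExpr {p : Params} {s : State} (h : p.Env s) (a b : Expr) (f : Expr → Expr)
    (F : ℕ → ℕ) (hf : ∀ e : Expr, (f e).eval s = F (e.eval s)) :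
    (entryExpr a b f).eval s = paddedEntry p.n p.V F (a.eval s) (b.eval s) := by
  simp [entryExpr, paddedEntry, hf, h.n, h.V]

theorem ok_entryExpr {B : ℕ} {p : Params} {s : State} (h : p.Env s) (hB : p.Fits B)
    {a b : Expr} {f : Expr → Expr} (hf : ∀ e : Expr, e.Ok B s → (f e).Ok B s)
    (ha : a.Ok B s) (hb : b.Ok B s) : (entryExpr a b f).Ok B s := by
  simp only [entryExpr, ok_ifLT, Ok]
  refine ⟨by omega, ha, fun ha' => ⟨by omega, hb, fun hb' => hf _ ?_, fun _ => by omega⟩,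
    fun _ => by omega⟩
  exact ok_idx ha hb (by rw [h.n]; exact hB.n_sq.le) ha' hb'

theorem eval_blockCostExpr {p : Params} {s : State} (h : p.Env s) :
    blockCostExpr.eval s =
      p.blockCost (s.reg 13) (s.reg 14) (s.reg 15) (s.mem 3) (s.mem 2) (s.reg 19) (s.reg 20) := by
  have e₃ := fun a b => eval_entryExpr h a b (arr 3) (s.mem 3) fun _ => rfl
  have e₂ := fun a b => eval_entryExpr h a b (fun y => sub (var 1) (arr 2 y))
    (fun y => p.V - s.mem 2 y) fun e => by simp [h.V]
  simp only [blockCostExpr, stepCostExpr, eval, eval_ifLT, eval_ifEQ, e₂, e₃, h.L, h.z, h.P, h.T,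
    Params.blockCost, Viterbi.endCost, Viterbi.stepCost]

theorem paddedEntry_sub_le (n V : ℕ) (D : ℕ → ℕ) (a b : ℕ) :
    paddedEntry n V (fun y => V - D y) a b ≤ V :=
  paddedEntry_le (E := fun y => V - D y) (fun _ _ _ _ => Nat.sub_le _ _) a b

theorem stepCost_le {L z P : ℕ} {e₁ e₂ e₃ : ℕ → ℕ → ℕ} (h₁ : ∀ a b, e₁ a b ≤ P)
    (h₂ : ∀ a b, e₂ a b ≤ P) (h₃ : ∀ a b, e₃ a b ≤ P) (u v : ℕ) :
    Viterbi.stepCost L z P e₁ e₂ e₃ u v ≤ P := by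
  unfold Viterbi.stepCost
  split_ifs <;> first | exact h₁ _ _ | exact h₂ _ _ | exact h₃ _ _ | omega

theorem Params.blockCost_le {p : Params} {i₀ j₀ k₀ : ℕ} {E D : ℕ → ℕ}
    (hE : ∀ a < p.n, ∀ b < p.n, E (a * p.n + b) ≤ p.V) (u v : ℕ) :
    p.blockCost i₀ j₀ k₀ E D u v ≤ 12 * p.V := by
  have h := stepCost_le (L := p.L) (z := p.z) (P := 4 * p.V)
    (e₁ := fun i k => paddedEntry p.n p.V E (i₀ + i) (k₀ + k))
    (e₂ := fun k j => paddedEntry p.n p.V E (k₀ + k) (j₀ + j))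
    (e₃ := fun j i => paddedEntry p.n p.V (fun y => p.V - D y) (i₀ + i) (j₀ + j))
    (fun a b => (paddedEntry_le hE _ _).trans (by omega))
    (fun a b => (paddedEntry_le hE _ _).trans (by omega))
    (fun a b => (paddedEntry_sub_le _ _ _ _ _).trans (by omega)) u v
  unfold Params.blockCost Viterbi.endCost
  split_ifs <;> omega

/-- Array positions stay below `n * n`, sums of indices below `n + N + 3`, and costs are at most `12
* V`; `Fits` provides room for each of these. -/
theorem ok_blockCostExpr {B : ℕ} {p : Params} {s : State} (h : p.Env s) (hB : p.Fits B)
    (hE : ∀ a < p.n, ∀ b < p.n, s.mem 3 (a * p.n + b) ≤ p.V) (h₁₃ : s.reg 13 ≤ p.n)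
    (h₁₄ : s.reg 14 ≤ p.n) (h₁₅ : s.reg 15 ≤ p.n) (h₁₉ : s.reg 19 < p.N) (h₂₀ : s.reg 20 < p.N) :
    blockCostExpr.Ok B s := by
  have ⟨_, hV, hL, _, hTL, hN, _, _, _, hn, hV', _⟩ := hB
  have hmod := Nat.mod_lt (s.reg 19 - s.reg 5 + 1) (h.L ▸ hL)
  have hmod' := Nat.mod_lt (s.reg 4 - 3) (h.L ▸ hL)
  have eL := h.L
  have ez := h.z
  have eP := h.P
  have ok₁ : stepCostExpr.Ok B s := by
    have k₁ := fun {a b : Expr} => ok_entryExpr (a := a) (b := b) (f := arr 3) h hB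
      (fun e he => by simpa using he)
    have k₂ := fun {a b : Expr} => ok_entryExpr (a := a) (b := b)
      (f := fun y => sub (var 1) (arr 2 y)) h hB (fun e he => by simpa using he)
    simp only [stepCostExpr, ok_ifLT, Ok, eval]
    refine ⟨by omega, by omega, fun c₁ => ⟨by omega, by omega, fun c₂ => ?_, fun c₂ => ?_⟩,
      fun c₁ => ?_⟩
    · apply ok_ifEQ <;> simp only [Ok, eval] <;> omega
    · refine ⟨by omega, by omega, fun _ => by omega, fun _ => ⟨by omega, by omega, fun _ => ?_,
        fun _ => by omega⟩⟩
      apply k₁ <;> simp only [Ok, eval] <;> omega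
    · refine ⟨by omega, by omega, fun c₂ => ?_, fun c₂ => ⟨by omega, by omega, fun c₃ =>
        ⟨by omega, by omega, fun _ => by omega, fun _ => ⟨by omega, by omega, fun _ => ?_,
          fun _ => by omega⟩⟩, fun c₃ => ⟨by omega, by omega, fun c₄ => ⟨by omega, by omega,
            fun _ => by omega, fun _ => ⟨by omega, by omega, fun _ => ?_, fun _ => by omega⟩⟩,
            fun _ => by omega⟩⟩⟩
      · apply ok_ifEQ <;> simp only [Ok, eval] <;> omega
      · apply k₁ <;> simp only [Ok, eval] <;> omega
      · apply k₂ <;> simp only [Ok, eval] <;> omega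
  have ok₂ : ∀ r, r < 40 → (ifEQ (var r) (add (var 5) (mod (sub (var 4) (lit 3)) (var 5)))
      (var 7) (lit 0)).Ok B s := by
    intro r hr
    apply ok_ifEQ <;> simp only [Ok, eval] <;> omega
  have le₁ : stepCostExpr.eval s ≤ 4 * p.V := by
    have e₃ := fun a b => eval_entryExpr h a b (arr 3) (s.mem 3) fun _ => rfl
    have e₂ := fun a b => eval_entryExpr h a b (fun y => sub (var 1) (arr 2 y))
      (fun y => p.V - s.mem 2 y) fun e => by simp [h.V]
    have := stepCost_le (L := p.L) (z := p.z) (P := 4 * p.V)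
      (e₁ := fun i k => paddedEntry p.n p.V (s.mem 3) (s.reg 13 + i) (s.reg 15 + k))
      (e₂ := fun k j => paddedEntry p.n p.V (s.mem 3) (s.reg 15 + k) (s.reg 14 + j))
      (e₃ := fun j i => paddedEntry p.n p.V (fun y => p.V - s.mem 2 y) (s.reg 13 + i)
        (s.reg 14 + j))
      (fun a b => (paddedEntry_le hE _ _).trans (by omega))
      (fun a b => (paddedEntry_le hE _ _).trans (by omega))
      (fun a b => (paddedEntry_sub_le _ _ _ _ _).trans (by omega))
      (s.reg 19) (s.reg 20)
    simpa only [stepCostExpr, eval, eval_ifLT, eval_ifEQ, e₂, e₃, h.L, h.z, h.P, h.T,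
      Viterbi.stepCost] using this
  simp only [blockCostExpr, Ok]
  refine ⟨⟨⟨ok₁, by omega, ?_⟩, ok₂ 19 (by omega), ?_⟩, ok₂ 20 (by omega)⟩
  · simp only [eval]
    omega
  · rw [eval_ifEQ]
    split_ifs <;> simp only [eval] <;> omega

/-- Writes one entry of the cost matrix. -/
def setupBody : Code :=
  .seq (.set 18 (sub (var 18) (lit 1))) <| .seq (.set 19 (div (var 18) (var 3))) <|
  .seq (.set 20 (mod (var 18) (var 3))) <| .seq (.put 10 (var 18) blockCostExpr) <|
  .put 11 (var 18) (var 16)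

/-- Arrays `10` and `11` are the values and stamps of array `0` of the simulated program. Cells
beyond the matrix keep their old stamps, so under a fresh stamp they count as `0`, as the padding of
`rowMajor` requires. -/
theorem runs_setup {B : ℕ} {p : Params} {s₀ : State} (h : p.Env s₀) (hB : p.Fits B)
    (hE : ∀ a < p.n, ∀ b < p.n, s₀.mem 3 (a * p.n + b) ≤ p.V) (h₁₃ : s₀.reg 13 ≤ p.n)
    (h₁₄ : s₀.reg 14 ≤ p.n) (h₁₅ : s₀.reg 15 ≤ p.n) (h₁₈ : s₀.reg 18 = p.N * p.N) :
    Runs B (.loop 18 setupBody.compile) s₀ (p.N * p.N * (setupBody.time + 1) + 1) fun s =>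
      (∀ r < 18, s.reg r = s₀.reg r) ∧ (∀ m, m ≠ 10 → m ≠ 11 → s.mem m = s₀.mem m) ∧
      ∀ y, if y < p.N * p.N then
        s.mem 10 y = p.blockCost (s₀.reg 13) (s₀.reg 14) (s₀.reg 15) (s₀.mem 3) (s₀.mem 2)
          (y / p.N) (y % p.N) ∧ s.mem 11 y = s₀.reg 16
        else s.mem 11 y = s₀.mem 11 y := by
  have hN : 0 < p.N := by
    have := hB.N_ge
    have := hB.L_pos
    omega
  have main := Runs.loop_countdown (r := 18) (by omega) (fun x s => x ≤ p.N * p.N ∧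
    (∀ r < 18, s.reg r = s₀.reg r) ∧ (∀ m, m ≠ 10 → m ≠ 11 → s.mem m = s₀.mem m) ∧
      ∀ y, if y < p.N * p.N then x ≤ y →
        s.mem 10 y = p.blockCost (s₀.reg 13) (s₀.reg 14) (s₀.reg 15) (s₀.mem 3) (s₀.mem 2)
          (y / p.N) (y % p.N) ∧ s.mem 11 y = s₀.reg 16
        else s.mem 11 y = s₀.mem 11 y) setupBody.time (c := setupBody.compile) (B := B) ?_ s₀ ?_
  · rw [h₁₈] at main
    refine main.mono le_rfl ?_
    rintro s ⟨-, -, hr, hm, hc⟩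
    refine ⟨hr, hm, fun y => ?_⟩
    have := hc y
    split_ifs at this ⊢ with h₄
    · exact this (Nat.zero_le _)
    · exact this
  · rintro x s hx ⟨hle, hr, hm, hc⟩
    have e₁₈ : s.reg 18 - 1 = x := by omega
    have hxN : x / p.N < p.N := (Nat.div_lt_iff_lt_mul hN).2 (by omega)
    have hxN' : x % p.N < p.N := Nat.mod_lt _ hN
    have env : p.Env (((s.setReg 18 x).setReg 19 (x / p.N)).setReg 20 (x % p.N)) :=
      (h.congr (s' := s) fun r hr' => hr r (by omega)).congr fun r hr' => by
        have h₁ : r ≠ 18 := by omega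
        have h₂ : r ≠ 19 := by omega
        have h₃ : r ≠ 20 := by omega
        simp [h₁, h₂, h₃]
    have eN : s.reg 3 = p.N := by rw [hr 3 (by omega), h.N]
    have ev := eval_blockCostExpr env
    have ok := ok_blockCostExpr env hB (by simpa [hm 3] using hE) (by simpa [hr 13] using h₁₃)
      (by simpa [hr 14] using h₁₄) (by simpa [hr 15] using h₁₅) (by simpa using hxN)
      (by simpa using hxN')
    refine (Code.runs setupBody s ?_).mono le_rfl ?_
    · have : 1 < B := by
        have := hB.n_add
        omega
      simp [setupBody, e₁₈, eN, ok, this]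
    · rintro _ rfl
      simp only [setupBody, Code.run, eval, e₁₈, setReg_reg, eN, ev, if_true, Nat.reduceEqDiff, if_false, setMem_reg]
      refine ⟨trivial, by omega, fun r hr' => ?_, fun m h₁ h₂ => ?_, fun y => ?_⟩
      · have h₁ : r ≠ 18 := by omega
        have h₂ : r ≠ 19 := by omega
        have h₃ : r ≠ 20 := by omega
        simp [h₁, h₂, h₃, hr r hr']
      · simp [h₁, h₂, hm m h₁ h₂]
      · have := hc y
        simp only [setMem_mem, setReg_mem, Nat.reduceEqDiff, if_true, if_false, hm 3 (by omega) (by omega),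
          hm 2 (by omega) (by omega), hr 13 (by omega), hr 14 (by omega), hr 15 (by omega),
          hr 16 (by omega), Function.update_apply]
        by_cases hy : y = x
        · subst hy
          rw [if_pos (by omega)]
          simp
        · split_ifs at this ⊢ with h₄
          · intro h₅
            exact this (by omega)
          · exact this
  · rw [h₁₈]
    refine ⟨le_rfl, fun _ _ => rfl, fun _ _ _ => rfl, fun y => ?_⟩
    split_ifs
    · omega
    · rfl

end WordRAM

/-! ### Improvable triples and the inspection of a path. -/

namespace WordRAM

open Finset

namespace Code

theorem run_seq (c d : Code) (s : State) : (c.seq d).run s = d.run (c.run s) := rfl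

theorem run_ite (e : Expr) (c d : Code) (s : State) :
    (Code.ite e c d).run s = if e.eval s ≠ 0 then c.run s else d.run s := rfl

theorem ok_seq {B : ℕ} {c d : Code} {s : State} :
    (c.seq d).Ok B s ↔ c.Ok B s ∧ d.Ok B (c.run s) := Iff.rfl

theorem ok_set {B r : ℕ} {e : Expr} {s : State} : (set r e).Ok B s ↔ r < 40 ∧ e.Ok B s := Iff.rfl

theorem ok_ite {B : ℕ} {e : Expr} {c d : Code} {s : State} : (Code.ite e c d).Ok B s ↔
    e.Ok B s ∧ (e.eval s ≠ 0 → c.Ok B s) ∧ (e.eval s = 0 → d.Ok B s) := Iff.rfl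

end Code

/-- The Viterbi instance with the parameters `p` and the costs `c`. -/
def Params.instance (p : Params) (hN : 0 < p.N) (c : ℕ → ℕ → ℕ) : Viterbi.Instance where
  n := p.N
  n_pos := hN
  σ := 1
  T := p.T
  A u v := c u v
  B _ _ := 0
  S _ := 0

theorem Params.cost_instance (p : Params) (hN : 0 < p.N) (c : ℕ → ℕ → ℕ)
    (u : Fin (p.T + 1) → Fin p.N) (w : ℕ → ℕ) (hw : ∀ t : Fin (p.T + 1), w t = u t) :
    (p.instance hN c).cost u = ∑ t ∈ range p.T, c (w t) (w (t + 1)) := by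
  rw [sum_range]
  refine sum_congr rfl fun t _ => ?_
  have h₁ := hw t.castSucc
  have h₂ := hw t.succ
  simp only [Fin.val_castSucc, Fin.val_succ] at h₁ h₂
  rw [h₁, h₂]
  rfl

/-- The estimate `D i j` can be lowered by `g` or more through `k`. -/
def Improvable (n : ℕ) (E D : ℕ → ℕ) (g i k j : ℕ) : Prop :=
  i < n ∧ k < n ∧ j < n ∧ E (i * n + k) + E (k * n + j) + g ≤ D (i * n + j)

/-- The Viterbi instance of a block finds an improvable triple of the block if there is one. -/
theorem Params.Fits.exists_improvable {p : Params} {B : ℕ} (h : p.Fits B) (hN : 0 < p.N)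
    {i₀ j₀ k₀ g : ℕ} {E D : ℕ → ℕ} (hg : 0 < g)
    (hE : ∀ a < p.n, ∀ b < p.n, E (a * p.n + b) ≤ p.V)
    (hD : ∀ a < p.n, ∀ b < p.n, D (a * p.n + b) ≤ p.V)
    {u : Fin (p.T + 1) → Fin p.N}
    (hu : (p.instance hN (p.blockCost i₀ j₀ k₀ E D)).IsSolution u)
    {w : ℕ → ℕ} (hw : ∀ t : Fin (p.T + 1), w t = u t) {i k j : ℕ} (hi : i < p.L) (hk : k < p.z)
    (hj : j < p.z) (himp : Improvable p.n E D g (i₀ + i) (k₀ + k) (j₀ + j)) :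
    ∃ t < p.T - 1, Improvable p.n E D g (i₀ + w t) (k₀ + (w (t + 1) - 2 * p.L))
      (j₀ + (w (t + 2) - (2 * p.L + p.z))) := by
  have hV := h.V_pos
  obtain ⟨t, ht, i', hi', k', hk', j', hj', w₁, w₂, w₃, hle⟩ := Viterbi.exists_min_triangle
    (e₁ := fun i k => paddedEntry p.n p.V E (i₀ + i) (k₀ + k))
    (e₂ := fun k j => paddedEntry p.n p.V E (k₀ + k) (j₀ + j))
    (e₃ := fun j i => paddedEntry p.n p.V (fun y => p.V - D y) (i₀ + i) (j₀ + j))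
    (P := 4 * p.V) h.L_pos h.z_pos h.T_ge h.N_ge (u := w)
    (fun i _ k _ j _ => by
      have h₁ := paddedEntry_le hE (i₀ + i) (k₀ + k)
      have h₂ := paddedEntry_le hE (k₀ + k) (j₀ + j)
      have h₃ := paddedEntry_sub_le p.n p.V D (i₀ + i) (j₀ + j)
      omega)
    ((hw 0).trans (congrArg Fin.val hu.1))
    (fun v hv₀ hv => by
      have h₁ := hu.2 (fun t => ⟨v t, hv t⟩) (Fin.ext hv₀)
      have h₂ := p.cost_instance hN (p.blockCost i₀ j₀ k₀ E D) u w hw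
      have h₃ := p.cost_instance hN (p.blockCost i₀ j₀ k₀ E D) (fun t => ⟨v t, hv t⟩) v
        fun t => rfl
      exact h₂.symm.trans_le (h₁.trans_eq h₃))
  -- The given triple weighs at most `V - g`, so the lightest one does too. It contains no padded
  -- entry, which alone would weigh `V`, and hence it is a genuine triple that is improvable by `g`.
  have hle := hle i hi k hk j hj
  obtain ⟨g₁, g₂, g₃, g₄⟩ := himp
  have d₁ := hD _ g₁ _ g₃
  simp only [paddedEntry, g₁, g₂, g₃, if_true] at hle
  refine ⟨t, by omega, ?_⟩
  rw [w₁, w₂, w₃, Nat.add_sub_cancel_left, Nat.add_sub_cancel_left]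
  split_ifs at hle with c₁ c₂ c₃
  · have d₂ := hD _ c₁ _ c₃
    exact ⟨c₁, c₂, c₃, by omega⟩
  all_goals omega

/-- A bound for the number of improvements by `g` that are possible before `D` reaches `M`. -/
def potential (n g : ℕ) (M : ℕ → ℕ → ℕ) (D : ℕ → ℕ) : ℕ :=
  ∑ i ∈ range n, ∑ j ∈ range n, (D (i * n + j) - M i j) / g

/-- Adding `g` to a numerator adds one to its quotient by `g`, and no other summand grows. -/
theorem potential_update {n g i j v : ℕ} {M : ℕ → ℕ → ℕ} {D : ℕ → ℕ} (hg : 0 < g) (hi : i < n)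
    (hj : j < n) (hM : M i j ≤ v) (hv : v + g ≤ D (i * n + j)) :
    potential n g M (Function.update D (i * n + j) v) + 1 ≤ potential n g M D := by
  have le : ∀ i' j', (Function.update D (i * n + j) v (i' * n + j') - M i' j') / g ≤
      (D (i' * n + j') - M i' j') / g := by
    intro i' j'
    refine Nat.div_le_div_right (Nat.sub_le_sub_right ?_ _)
    rw [Function.update_apply]
    split_ifs with e
    · rw [e]
      omega
    · exact le_rfl
  refine sum_lt_sum (fun i' _ => sum_le_sum fun j' _ => le i' j') ⟨i, mem_range.2 hi, ?_⟩
  refine sum_lt_sum (fun j' _ => le i j') ⟨j, mem_range.2 hj, ?_⟩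
  rw [Function.update_self]
  calc (v - M i j) / g < (v - M i j) / g + 1 := Nat.lt_succ_self _
    _ = (v - M i j + g) / g := (Nat.add_div_right _ hg).symm
    _ ≤ (D (i * n + j) - M i j) / g := Nat.div_le_div_right (by omega)

/-- The hypothesis is what the preceding phase leaves behind, its threshold being at most `2 * g +
1`. Each entry then allows at most two improvements by `g`. -/
theorem potential_le {n g : ℕ} {M : ℕ → ℕ → ℕ} {D : ℕ → ℕ} (hg : 0 < g)
    (h : ∀ i < n, ∀ j < n, D (i * n + j) ≤ M i j + 2 * g) : potential n g M D ≤ 2 * (n * n) := by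
  have : potential n g M D ≤ ∑ i ∈ range n, ∑ j ∈ range n, 2 := by
    refine sum_le_sum fun i hi => sum_le_sum fun j hj => ?_
    have := h i (mem_range.1 hi) j (mem_range.1 hj)
    exact Nat.div_le_of_le_mul (by omega)
  simp only [sum_const, card_range, smul_eq_mul] at this
  linarith

/-- The working state of one phase, in which estimates are lowered by `g` or more at a time. -/
structure Work (x : APSP.Instance) (p : Params) (E nE : ℕ → ℕ) (g : ℕ) (s : State) : Prop where
  env : p.Env s
  mem_E : s.mem 3 = E
  mem_nE : s.mem 4 = nE
  reg_g : s.reg 11 = g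
  stamps : s.StampsLE
  estimate : x.Estimate p.V (s.mem 2) (s.mem 1)
  le : ∀ i < p.n, ∀ j < p.n, s.mem 2 (i * p.n + j) ≤ E (i * p.n + j)

/-- The fixed data of a phase are sound. -/
structure Phase (x : APSP.Instance) (p : Params) (E nE : ℕ → ℕ) (g : ℕ) (M : ℕ → ℕ → ℕ) (B : ℕ) :
    Prop where
  fits : p.Fits B
  n_eq : p.n = x.n
  estimate : x.Estimate p.V E nE
  g_pos : 0 < g
  g_le : g ≤ p.V
  min_le : ∀ i < p.n, ∀ j < p.n, ∀ k < p.n, M i j ≤ E (i * p.n + k) + E (k * p.n + j)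

theorem Estimate.entry_le {x : APSP.Instance} {p : Params} {V : ℕ} {E nE : ℕ → ℕ}
    (h : x.Estimate V E nE) (hn : p.n = x.n) : ∀ a < p.n, ∀ b < p.n, E (a * p.n + b) ≤ V := by
  intro a ha b hb
  rw [hn] at ha hb ⊢
  exact h.le ⟨a, ha⟩ ⟨b, hb⟩

theorem Estimate.relax_of_improvable {x : APSP.Instance} {p : Params} {V g : ℕ}
    {E nE D nx : ℕ → ℕ} (h : x.Estimate V D nx) (h' : x.Estimate V E nE) (hn : p.n = x.n)
    (hg : 0 < g) (hDE : ∀ i < p.n, ∀ j < p.n, D (i * p.n + j) ≤ E (i * p.n + j)) {i k j : ℕ}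
    (hi : Improvable p.n E D g i k j) :
    x.Estimate V (Function.update D (i * p.n + j) (E (i * p.n + k) + E (k * p.n + j)))
      (Function.update nx (i * p.n + j) (nE (i * p.n + k))) := by
  rw [hn] at hi hDE ⊢
  obtain ⟨h₁, h₂, h₃, h₄⟩ := hi
  exact h.relax h' (fun i j => hDE i i.2 j j.2) ⟨i, h₁⟩ ⟨j, h₃⟩ ⟨k, h₂⟩ (by simp only; omega)

open WordRAM.Expr

/-- Evaluates a cell of the stamped array `3`. -/
def outputExpr (a : Expr) : Expr := ifEQ (arr 17 a) (var 16) (arr 16 a) (lit 0)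

theorem eval_outputExpr (s : State) (a : Expr) :
    (outputExpr a).eval s = s.stampedMem 3 (a.eval s) := by
  rw [outputExpr, eval_ifEQ]
  rfl

theorem ok_outputExpr {B : ℕ} {s : State} {a : Expr} (hB : 0 < B) (ha : a.Ok B s) :
    (outputExpr a).Ok B s := by
  apply ok_ifEQ <;> simp [ha, hB]

/-- Decides whether the triple in the registers `19`, `20`, `21` is improvable. -/
def improvableExpr : Expr :=
  ifLT (var 19) (var 0) (ifLT (var 20) (var 0) (ifLT (var 21) (var 0)
    (ifLT (arr 2 (idx (var 19) (var 21)))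
      (add (add (arr 3 (idx (var 19) (var 20))) (arr 3 (idx (var 20) (var 21)))) (var 11))
      (lit 0) (lit 1)) (lit 0)) (lit 0)) (lit 0)

theorem eval_improvableExpr (s : State) : improvableExpr.eval s ≠ 0 ↔
    Improvable (s.reg 0) (s.mem 3) (s.mem 2) (s.reg 11) (s.reg 19) (s.reg 20) (s.reg 21) := by
  simp only [improvableExpr, eval_ifLT, Improvable]
  split_ifs <;> simp_all [eval]

theorem ok_improvableExpr {B : ℕ} {s : State} (h1 : 1 < B) (hn : s.reg 0 * s.reg 0 ≤ B)
    (h : ∀ a < s.reg 0, ∀ k < s.reg 0, ∀ b < s.reg 0,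
      s.mem 3 (a * s.reg 0 + k) + s.mem 3 (k * s.reg 0 + b) + s.reg 11 < B) :
    improvableExpr.Ok B s := by
  have h0 : 0 < B := by omega
  have l : ∀ r < 40, (var r).Ok B s := fun r hr => hr
  simp only [improvableExpr, ok_ifLT, Ok, eval, eval_idx]
  refine ⟨by omega, by omega, fun c₁ => ⟨by omega, by omega, fun c₂ => ⟨by omega, by omega,
    fun c₃ => ⟨⟨⟨ok_idx (l _ (by omega)) (l _ (by omega)) hn c₁ c₂,
      ok_idx (l _ (by omega)) (l _ (by omega)) hn c₂ c₃, ?_⟩, by omega, ?_⟩,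
      ok_idx (l _ (by omega)) (l _ (by omega)) hn c₁ c₃, fun _ => h0, fun _ => h1⟩,
      fun _ => h0⟩, fun _ => h0⟩, fun _ => h0⟩
  · have := h _ c₁ _ c₂ _ c₃
    omega
  · exact h _ c₁ _ c₂ _ c₃

/-- Lowers the estimate for the triple in the registers `19`, `20`, `21`. -/
def relaxCode : Code :=
  .seq (.put 2 (idx (var 19) (var 21))
    (add (arr 3 (idx (var 19) (var 20))) (arr 3 (idx (var 20) (var 21))))) <|
  .seq (.put 1 (idx (var 19) (var 21)) (arr 4 (idx (var 19) (var 20)))) <|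
  .set 17 (lit 1)

/-- Inspects three consecutive states of the path. -/
def scanBody : Code :=
  .seq (.set 18 (sub (var 18) (lit 1))) <|
  .seq (.set 19 (add (var 13) (outputExpr (var 18)))) <|
  .seq (.set 20 (add (var 15) (sub (outputExpr (add (var 18) (lit 1))) (mul (lit 2) (var 5))))) <|
  .seq (.set 21 (add (var 14) (sub (outputExpr (add (var 18) (lit 2)))
    (add (mul (lit 2) (var 5)) (var 6))))) <|
  .ite improvableExpr relaxCode .skip

/-- The three states need not lie on the line and in the two layers, so the decoded numbers may be
meaningless. They are tested for improvability before use; the estimates thus remain sound whatever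
the path is, and its optimality matters only for missing no improvement. -/
theorem runs_scanBody {B : ℕ} {x : APSP.Instance} {p : Params} {E nE : ℕ → ℕ} {g : ℕ}
    {M : ℕ → ℕ → ℕ} (hp : Phase x p E nE g M B) {s : State} (hs : Work x p E nE g s)
    {w : ℕ → ℕ} (hw : ∀ t ≤ p.T, s.stampedMem 3 t = w t) (hwN : ∀ t ≤ p.T, w t < p.N)
    (h₁₃ : s.reg 13 ≤ p.n) (h₁₄ : s.reg 14 ≤ p.n) (h₁₅ : s.reg 15 ≤ p.n) {t : ℕ}
    (ht : t < p.T - 1) (h₁₈ : s.reg 18 = t + 1) {i k j : ℕ} (hi : i = s.reg 13 + w t)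
    (hk : k = s.reg 15 + (w (t + 1) - 2 * p.L))
    (hj : j = s.reg 14 + (w (t + 2) - (2 * p.L + p.z))) :
    Runs B scanBody.compile s scanBody.time fun s' => s'.reg 18 = t ∧
      (∀ r < 17, s'.reg r = s.reg r) ∧ (∀ m, m ≠ 1 → m ≠ 2 → s'.mem m = s.mem m) ∧
      ((¬ Improvable p.n E (s.mem 2) g i k j ∧ s'.mem 1 = s.mem 1 ∧ s'.mem 2 = s.mem 2 ∧
          s'.reg 17 = s.reg 17) ∨
        (Improvable p.n E (s.mem 2) g i k j ∧ s'.reg 17 = 1 ∧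
          s'.mem 1 = Function.update (s.mem 1) (i * p.n + j) (nE (i * p.n + k)) ∧
          s'.mem 2 = Function.update (s.mem 2) (i * p.n + j)
            (E (i * p.n + k) + E (k * p.n + j)))) := by
  have ⟨_, hV, hL, _, hTL, hN, hTN, _, hnn, hn, hV', _⟩ := hp.fits
  have e₁₈ : s.reg 18 - 1 = t := by omega
  have eE := hs.mem_E
  have enE := hs.mem_nE
  have eg := hs.reg_g
  have en := hs.env.n
  have eL := hs.env.L
  have ez := hs.env.z
  have o₀ := hw t (by omega)
  have o₁ := hw (t + 1) (by omega)
  have o₂ := hw (t + 2) (by omega)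
  have l₀ := hwN t (by omega)
  have l₁ := hwN (t + 1) (by omega)
  have l₂ := hwN (t + 2) (by omega)
  have hEV := Estimate.entry_le (p := p) hp.estimate hp.n_eq
  have hgV := hp.g_le
  set s₁ := (((s.setReg 18 t).setReg 19 i).setReg 20 k).setReg 21 j with hs₁
  have run₁ : (Code.run (.set 21 (add (var 14) (sub (outputExpr (add (var 18) (lit 2)))
      (add (mul (lit 2) (var 5)) (var 6))))) (Code.run (.set 20 (add (var 15)
      (sub (outputExpr (add (var 18) (lit 1))) (mul (lit 2) (var 5)))))
      (Code.run (.set 19 (add (var 13) (outputExpr (var 18)))) (Code.run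
      (.set 18 (sub (var 18) (lit 1))) s)))) = s₁ := by
    simp only [Code.run, eval, eval_outputExpr, setReg_reg, State.stampedMem, setReg_mem,
      Nat.reduceEqDiff, if_true, if_false, e₁₈] at o₀ o₁ o₂ ⊢
    simp only [o₀, o₁, o₂, hs₁, hi, hk, hj, eL, ez]
  have hB0 : 0 < B := by omega
  have imp : improvableExpr.eval s₁ ≠ 0 ↔ Improvable p.n E (s.mem 2) g i k j := by
    rw [eval_improvableExpr]
    simp [hs₁, eE, eg, en]
  have hok : improvableExpr.Ok B s₁ := by
    apply ok_improvableExpr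
    · omega
    · simp only [hs₁, setReg_reg, if_false, OfNat.zero_ne_ofNat, en]
      exact hnn.le
    · simp only [hs₁, setReg_reg, Nat.reduceEqDiff, if_false, OfNat.zero_ne_ofNat, en, setReg_mem,
        eE, eg]
      intro a ha k hk b hb
      have := hEV a ha k hk
      have := hEV k hk b hb
      omega
  have hrel : Improvable p.n E (s.mem 2) g i k j → relaxCode.Ok B s₁ := by
    rintro ⟨c₁, c₂, c₃, c₄⟩
    have := hEV i c₁ k c₂
    have := hEV k c₂ j c₃
    have l : ∀ r < 40, ∀ s, (var r).Ok B s := fun r hr _ => hr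
    have r₀ : s₁.reg 0 = p.n := by simp [hs₁, en]
    have k₁ : ∀ s', s'.reg = s₁.reg → (idx (var 19) (var 21)).Ok B s' := fun s' e => by
      refine ok_idx (l _ (by omega) _) (l _ (by omega) _) ?_ ?_ ?_ <;>
        simp [eval, e, hs₁, en, hnn.le, c₁, c₃]
    have k₂ : ∀ s', s'.reg = s₁.reg → (idx (var 19) (var 20)).Ok B s' := fun s' e => by
      refine ok_idx (l _ (by omega) _) (l _ (by omega) _) ?_ ?_ ?_ <;>
        simp [eval, e, hs₁, en, hnn.le, c₁, c₂]
    have k₃ : ∀ s', s'.reg = s₁.reg → (idx (var 20) (var 21)).Ok B s' := fun s' e => by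
      refine ok_idx (l _ (by omega) _) (l _ (by omega) _) ?_ ?_ ?_ <;>
        simp [eval, e, hs₁, en, hnn.le, c₂, c₃]
    simp only [relaxCode, Code.Ok, Ok, Code.run]
    refine ⟨⟨k₁ _ rfl, k₂ _ rfl, k₃ _ rfl, ?_⟩, ⟨k₁ _ rfl, k₂ _ rfl⟩, by omega, by omega⟩
    simp only [eval, eval_idx, r₀]
    simp only [hs₁, setReg_reg, setReg_mem, Nat.reduceEqDiff, if_true, if_false, eE]
    omega
  refine (Code.runs scanBody s ?_).mono le_rfl ?_
  · rw [scanBody, Code.ok_seq, Code.ok_seq, Code.ok_seq, Code.ok_seq, Code.ok_ite, run₁,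
      Code.ok_set, Code.ok_set, Code.ok_set, Code.ok_set]
    refine ⟨⟨by omega, by simp; omega⟩, ⟨by omega, by simp, ?_, ?_⟩,
      ⟨by omega, ⟨by simp, ⟨?_, ?_⟩, ?_⟩⟩, ⟨by omega, ⟨by simp, ⟨?_, ?_⟩, ?_⟩⟩,
      hok, fun h => hrel (imp.1 h), fun _ => hB0⟩
    · exact ok_outputExpr hB0 (by simp)
    · simp only [Code.run, eval, eval_outputExpr, setReg_reg, State.stampedMem, setReg_mem,
        Nat.reduceEqDiff, if_true, if_false, e₁₈] at o₀ ⊢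
      rw [o₀]
      omega
    · refine ok_outputExpr hB0 ?_
      simp [e₁₈]
      omega
    · simp [eL]
      omega
    · simp only [Code.run, eval, eval_outputExpr, setReg_reg, State.stampedMem, setReg_mem,
        Nat.reduceEqDiff, if_true, if_false, e₁₈] at o₁ ⊢
      rw [o₁]
      omega
    · refine ok_outputExpr hB0 ?_
      simp [e₁₈]
      omega
    · simp [eL, ez]
      omega
    · simp only [Code.run, eval, eval_outputExpr, setReg_reg, State.stampedMem, setReg_mem,
        Nat.reduceEqDiff, if_true, if_false, e₁₈] at o₂ ⊢
      rw [o₂]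
      omega
  · rintro _ rfl
    rw [scanBody, Code.run_seq, Code.run_seq, Code.run_seq, Code.run_seq, run₁]
    have rr : ∀ r < 17, s₁.reg r = s.reg r := by
      intro r hr
      have h₁ : r ≠ 18 := by omega
      have h₂ : r ≠ 19 := by omega
      have h₃ : r ≠ 20 := by omega
      have h₄ : r ≠ 21 := by omega
      simp [hs₁, h₁, h₂, h₃, h₄]
    by_cases him : Improvable p.n E (s.mem 2) g i k j
    · rw [Code.run_ite, if_pos (imp.2 him)]
      have r₀ : s₁.reg 0 = p.n := by simp [hs₁, en]
      have r₁ : s₁.reg 19 = i := by simp [hs₁]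
      have r₂ : s₁.reg 20 = k := by simp [hs₁]
      have r₃ : s₁.reg 21 = j := by simp [hs₁]
      have r₄ : s₁.reg 18 = t := by simp [hs₁]
      have mm : s₁.mem = s.mem := rfl
      simp only [relaxCode, Code.run, eval, eval_idx, setMem_reg, r₀, r₁, r₂, r₃, mm, eE, setReg_reg,
        setReg_mem, setMem_mem]
      refine ⟨by simp [r₄], fun r hr => ?_, fun m h₁ h₂ => by simp [h₁, h₂], .inr ⟨him, ?_⟩⟩
      · have : r ≠ 17 := by omega
        simp [this, rr r hr]
      · simp [enE]
    · rw [Code.run_ite, if_neg fun h => him (imp.1 h)]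
      exact ⟨by simp [hs₁], rr, fun _ _ _ => rfl, .inl ⟨him, rfl, rfl, by simp [hs₁]⟩⟩

end WordRAM

namespace WordRAM

open Finset WordRAM.Expr

/-- Until the first relaxation the estimates are those at the start. A scan that leaves the flag in
register `17` at `0` has therefore tested every triple of consecutive states against them, while any
relaxation lowers the potential. -/
theorem runs_scan {B : ℕ} {x : APSP.Instance} {p : Params} {E nE : ℕ → ℕ} {g : ℕ}
    {M : ℕ → ℕ → ℕ} (hp : Phase x p E nE g M B) {s₀ : State} (hs : Work x p E nE g s₀)
    {w : ℕ → ℕ} (hw : ∀ t ≤ p.T, s₀.stampedMem 3 t = w t) (hwN : ∀ t ≤ p.T, w t < p.N)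
    {i₀ j₀ k₀ : ℕ} (h₁₃ : s₀.reg 13 = i₀) (h₁₄ : s₀.reg 14 = j₀) (h₁₅ : s₀.reg 15 = k₀)
    (hi₀ : i₀ ≤ p.n) (hj₀ : j₀ ≤ p.n) (hk₀ : k₀ ≤ p.n)
    (h₁₇ : s₀.reg 17 = 0) (h₁₈ : s₀.reg 18 = p.T - 1) :
    Runs B (.loop 18 scanBody.compile) s₀ ((p.T - 1) * (scanBody.time + 1) + 1) fun s =>
      (∀ r < 17, s.reg r = s₀.reg r) ∧ Work x p E nE g s ∧
      ((s.reg 17 = 0 ∧ s.mem 2 = s₀.mem 2 ∧ ∀ t < p.T - 1,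
          ¬ Improvable p.n E (s₀.mem 2) g (i₀ + w t) (k₀ + (w (t + 1) - 2 * p.L))
            (j₀ + (w (t + 2) - (2 * p.L + p.z)))) ∨
        (s.reg 17 ≠ 0 ∧ potential p.n g M (s.mem 2) + 1 ≤ potential p.n g M (s₀.mem 2) ∧
          ∀ y, s.mem 2 y ≤ s₀.mem 2 y)) := by
  have main := Runs.loop_countdown (B := B) (r := 18) (c := scanBody.compile) (by omega)
    (fun y s => y ≤ p.T - 1 ∧ (∀ r < 17, s.reg r = s₀.reg r) ∧
      (∀ m, m ≠ 1 → m ≠ 2 → s.mem m = s₀.mem m) ∧ Work x p E nE g s ∧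
      ((s.reg 17 = 0 ∧ s.mem 2 = s₀.mem 2 ∧ ∀ t < p.T - 1, y ≤ t →
          ¬ Improvable p.n E (s₀.mem 2) g (i₀ + w t) (k₀ + (w (t + 1) - 2 * p.L))
            (j₀ + (w (t + 2) - (2 * p.L + p.z)))) ∨
        (s.reg 17 ≠ 0 ∧ potential p.n g M (s.mem 2) + 1 ≤ potential p.n g M (s₀.mem 2) ∧
          ∀ y, s.mem 2 y ≤ s₀.mem 2 y))) scanBody.time ?_ s₀ ?_
  · rw [h₁₈] at main
    refine main.mono le_rfl ?_
    rintro s ⟨-, -, hr, -, hW, h⟩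
    exact ⟨hr, hW, h.imp_left fun h => ⟨h.1, h.2.1, fun t ht => h.2.2 t ht (Nat.zero_le t)⟩⟩
  · rintro t s ht ⟨hle, hr, hm, hW, h⟩
    have hst : ∀ y, s.stampedMem 3 y = s₀.stampedMem 3 y := by
      intro y
      simp only [State.stampedMem]
      rw [hm _ (by omega) (by omega), hm _ (by omega) (by omega), hr 16 (by omega)]
    have e₁₃ := (hr 13 (by omega)).trans h₁₃
    have e₁₄ := (hr 14 (by omega)).trans h₁₄
    have e₁₅ := (hr 15 (by omega)).trans h₁₅
    refine (runs_scanBody hp hW (w := w) (fun t ht => (hst t).trans (hw t ht)) hwN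
      (by omega) (by omega) (by omega) (t := t) (by omega) ht rfl rfl rfl).mono le_rfl ?_
    rintro s' ⟨r₁₈, hr', hm', hc⟩
    rw [e₁₃, e₁₄, e₁₅] at hc
    have env : p.Env s' := hW.env.congr fun r h => hr' r (by omega)
    have stamps : s'.StampsLE := by
      intro m y
      rw [hm' _ (by omega) (by omega), hr' 16 (by omega)]
      exact hW.stamps m y
    refine ⟨r₁₈, by omega, fun r h => (hr' r h).trans (hr r h),
      fun m h₁ h₂ => (hm' m h₁ h₂).trans (hm m h₁ h₂), ?_⟩
    rcases hc with ⟨hn, m₁, m₂, r₁₇⟩ | ⟨hi, r₁₇, m₁, m₂⟩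
    · refine ⟨⟨env, (hm' 3 (by omega) (by omega)).trans hW.mem_E,
        (hm' 4 (by omega) (by omega)).trans hW.mem_nE, (hr' 11 (by omega)).trans hW.reg_g,
        stamps, ?_, ?_⟩, ?_⟩
      · rw [m₁, m₂]
        exact hW.estimate
      · rw [m₂]
        exact hW.le
      · rw [m₂, r₁₇]
        refine h.imp_left fun h => ⟨h.1, h.2.1, fun t' ht' hle' => ?_⟩
        rcases Nat.eq_or_lt_of_le hle' with rfl | hlt
        · rw [← h.2.1]
          exact hn
        · exact h.2.2 t' ht' hlt
    · have hle₂ : ∀ y, s'.mem 2 y ≤ s.mem 2 y := by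
        intro y
        rw [m₂, Function.update_apply]
        split_ifs with e
        · have := hi.2.2.2
          rw [e]
          omega
        · exact le_rfl
      have hpot : potential p.n g M (s'.mem 2) + 1 ≤ potential p.n g M (s.mem 2) := by
        rw [m₂]
        exact potential_update hp.g_pos hi.1 hi.2.2.1
          (hp.min_le _ hi.1 _ hi.2.2.1 _ hi.2.1) hi.2.2.2
      refine ⟨⟨env, (hm' 3 (by omega) (by omega)).trans hW.mem_E,
        (hm' 4 (by omega) (by omega)).trans hW.mem_nE, (hr' 11 (by omega)).trans hW.reg_g,
        stamps, ?_, fun i hi j hj => (hle₂ _).trans (hW.le i hi j hj)⟩,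
        .inr ⟨by omega, ?_, fun y => (hle₂ y).trans ?_⟩⟩
      · rw [m₁, m₂]
        exact Estimate.relax_of_improvable hW.estimate hp.estimate hp.n_eq hp.g_pos hW.le hi
      · rcases h with h | h
        · rwa [← h.2.1]
        · omega
      · rcases h with h | h
        · rw [h.2.1]
        · exact h.2.2 y
  · rw [h₁₈]
    exact ⟨le_rfl, fun _ _ => rfl, fun _ _ _ => rfl, hs,
      .inl ⟨h₁₇, rfl, fun t h₁ h₂ => absurd h₂ (by omega)⟩⟩

/-! ### Calling the Viterbi program on one block. -/

/-- Runs the program `P` for the Viterbi path problem on the instance prepared in the stamped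
array `0`. -/
def viterbiCall (P : Program) : Program :=
  .seq (clearRegs (P.regBound + 3)) <| .seq (.op .and 40 3 3) <| .seq (.op .and 41 4 4) <|
  .seq (.const 42 1) P.stamped

/-- The program `P` solves the Viterbi instances with the parameters `p` within `τ` steps. -/
def Params.Solves (p : Params) (hN : 0 < p.N) (P : Program) (B₀ τ : ℕ) : Prop :=
  ∀ c : ℕ → ℕ → ℕ, (∀ u v, c u v ≤ 12 * p.V) → ∃ s t,
    Exec B₀ P (Viterbi.problem.input (p.instance hN c)) s t ∧ t ≤ τ ∧
      Viterbi.problem.Correct (p.instance hN c) s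

/-- Registers `40`, `41`, `42` are the inputs `n`, `T`, `σ` of the simulated program. Adding `3` to
its register bound makes sure that they are covered even if it does not mention them. The arrays
other than `0` need no clearing, since they already read as `0`. -/
theorem runs_viterbiCall {B B₀ τ : ℕ} {p : Params} {hN : 0 < p.N} {P : Program}
    (hP : p.Solves hN P B₀ τ) (hB : p.Fits B) (hB₀ : B₀ ≤ B) {s : State} (env : p.Env s)
    {c : ℕ → ℕ → ℕ} (hc : ∀ u v, c u v ≤ 12 * p.V) (hs : s.StampsLE)
    (h₀ : ∀ y, s.stampedMem 0 y = if y < p.N * p.N then c (y / p.N) (y % p.N) else 0)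
    (h₁ : ∀ m y, 0 < m → s.stampedMem m y = 0) :
    Runs B (viterbiCall P) s (P.regBound + 7 + 4 * τ) fun s' =>
      OuterEq s s' ∧ s'.StampsLE ∧ ∃ u, (p.instance hN c).IsSolution u ∧
        ∀ t : Fin (p.T + 1), s'.stampedMem 3 t = u t := by
  intro σ hσ hσB
  obtain ⟨s', t, ex, hτ, u, hu, hu'⟩ := hP c hc
  have hnB := hB.n_add
  obtain ⟨σ₁, e₁, z₁, r₁, m₁⟩ := exec_clearRegs (B := B) (by omega) σ (P.regBound + 3)
  have hB₁ := e₁.bounded hσB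
  set σ₂ := σ₁.setReg 40 (BinOp.and.eval (σ₁.reg 3) (σ₁.reg 3)) with hσ₂
  set σ₃ := σ₂.setReg 41 (BinOp.and.eval (σ₂.reg 4) (σ₂.reg 4)) with hσ₃
  have e₂ : Exec B (.op .and 40 3 3) σ₁ σ₂ 1 := .op (by simpa [BinOp.eval] using hB₁.1 3)
  have hB₂ := e₂.bounded hB₁
  have e₃ : Exec B (.op .and 41 4 4) σ₂ σ₃ 1 := .op (by simpa [BinOp.eval] using hB₂.1 4)
  have hB₃ := e₃.bounded hB₂
  have e₄ : Exec B (.const 42 1) σ₃ (σ₃.setReg 42 1) 1 := .const (by omega)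
  have hB₄ := e₄.bounded hB₃
  have q₃ : σ₁.reg 3 = p.N := by rw [r₁ 3 (by omega), hσ.1 3 (by omega), env.N]
  have q₄ : σ₁.reg 4 = p.T := by rw [r₁ 4 (by omega), hσ.1 4 (by omega), env.T]
  generalize hσ₄ : σ₃.setReg 42 1 = σ₄ at e₄ hB₄
  have m₄ : σ₄.mem = s.mem := by rw [← hσ₄, ← hσ.2, ← m₁]; rfl
  have r₄ : ∀ r < 40, σ₄.reg r = s.reg r := by
    intro r hr
    have c₁ : r ≠ 40 := by omega
    have c₂ : r ≠ 41 := by omega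
    have c₃ : r ≠ 42 := by omega
    rw [← hσ₄, ← hσ.1 r hr, ← r₁ r hr]
    simp [hσ₂, hσ₃, c₁, c₂, c₃]
  have rep : Represents (P.regBound + 3) (Viterbi.problem.input (p.instance hN c)) σ₄ := by
    refine ⟨fun r hr => ?_, fun m y => ?_, fun m y => ?_⟩
    · rw [← hσ₄]
      simp only [hσ₂, hσ₃, setReg_reg, BinOp.eval, q₃, q₄, Nat.and_self, Viterbi.problem, Params.instance]
      by_cases c₀ : r = 0
      · subst c₀; simp
      by_cases c₁ : r = 1
      · subst c₁; simp
      by_cases c₂ : r = 2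
      · subst c₂; simp
      rw [if_neg (by omega), if_neg (by omega), if_neg (by omega), if_neg c₀, if_neg c₁,
        if_neg c₂]
      exact z₁ r hr
    · have : σ₄.stampedMem m y = s.stampedMem m y := by
        simp only [State.stampedMem, m₄, r₄ 16 (by omega)]
      rw [this]
      simp only [Viterbi.problem, Params.instance]
      by_cases c₀ : m = 0
      · subst c₀
        rw [h₀, if_pos rfl, rowMajor]
        have hlt : y / p.N < p.N ∧ y % p.N < p.N ↔ y < p.N * p.N := by
          rw [Nat.div_lt_iff_lt_mul hN]
          exact ⟨fun h => h.1, fun h => ⟨h, Nat.mod_lt _ hN⟩⟩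
        split_ifs with c₁ c₂ c₂
        · rfl
        · exact absurd (hlt.2 c₁) c₂
        · exact absurd (hlt.1 c₂) c₁
        · rfl
      · rw [h₁ m y (by omega), if_neg c₀]
        split_ifs
        · simp [rowMajor]
        · simp
        · rfl
    · rw [m₄, r₄ 16 (by omega)]
      exact hs m y
  obtain ⟨σ₅, t₅, e₅, l₅, rep₅, o₅⟩ := ex.stamped (R := P.regBound + 3) hB₀ σ₄ (by omega) hB₄ rep
  have osσ : OuterEq s σ₅ :=
    (⟨fun r hr => r₄ r (by omega), fun m _ => by rw [m₄]⟩ : OuterEq s σ₄).trans o₅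
  refine ⟨σ₅, σ₅, _, .seq e₁ (.seq e₂ (.seq e₃ (.seq e₄ e₅))), by omega, ⟨fun _ _ => rfl, rfl⟩,
    osσ, rep₅.stamps, u, hu, fun t => ?_⟩
  rw [rep₅.mem]
  exact hu' t

/-- Decodes the block number and prepares the loop that writes the costs. -/
def blockHead : Code :=
  .seq (.set 20 (sub (var 12) (lit 1))) <|
  .seq (.set 13 (mul (div (var 20) (mul (var 8) (var 8))) (var 5))) <|
  .seq (.set 15 (mul (mod (div (var 20) (var 8)) (var 8)) (var 6))) <|
  .seq (.set 14 (mul (mod (var 20) (var 8)) (var 6))) <|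
  .seq (.set 16 (add (var 16) (lit 1))) <|
  .seq (.set 17 (lit 0)) <| .set 18 (mul (var 3) (var 3))

/-- Prepares the inspection of the path. -/
def scanHead : Code := .set 18 (sub (var 4) (lit 1))

/-- Proceeds to the next block unless an estimate was improved. -/
def blockTail : Code := .set 12 (ifEQ (var 17) (lit 0) (sub (var 12) (lit 1)) (var 12))

/-- Looks for improvable triples in one block. -/
def blockProgram (P : Program) : Program :=
  .seq blockHead.compile <| .seq (.loop 18 setupBody.compile) <| .seq (viterbiCall P) <|
  .seq scanHead.compile <| .seq (.loop 18 scanBody.compile) blockTail.compile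

/-- A bound for the running time of `blockProgram`. -/
def blockTime (p : Params) (P : Program) (τ : ℕ) : ℕ :=
  blockHead.time + ((p.N * p.N * (setupBody.time + 1) + 1) + ((P.regBound + 7 + 4 * τ) +
    (scanHead.time + (((p.T - 1) * (scanBody.time + 1) + 1) + blockTail.time))))

theorem Params.fstBase_le {p : Params} {b : ℕ} (hb : b < p.blocks) : p.fstBase b ≤ p.n := by
  have : b / (p.layers * p.layers) < p.n / p.L + 1 :=
    Nat.div_lt_of_lt_mul (by rwa [Nat.mul_comm])
  exact (Nat.mul_le_mul_right _ (Nat.lt_succ_iff.1 this)).trans (Nat.div_mul_le_self _ _)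

theorem Params.mod_layers_mul_le (p : Params) (a : ℕ) : a % p.layers * p.z ≤ p.n :=
  (Nat.mul_le_mul_right _ (Nat.lt_succ_iff.1 (Nat.mod_lt a (Nat.succ_pos _)))).trans
    (Nat.div_mul_le_self _ _)

/-- The triple belongs to the block `b`. -/
def Params.InBlock (p : Params) (b i k j : ℕ) : Prop :=
  (p.fstBase b ≤ i ∧ i < p.fstBase b + p.L) ∧ (p.midBase b ≤ k ∧ k < p.midBase b + p.z) ∧
    (p.lstBase b ≤ j ∧ j < p.lstBase b + p.z)

/-- The number of the block has the mixed-radix digits `i / L`, `k / z`, `j / z`. -/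
theorem Params.exists_inBlock {p : Params} (hL : 0 < p.L) (hz : 0 < p.z) {i k j : ℕ}
    (hi : i < p.n) (hk : k < p.n) (hj : j < p.n) : ∃ b < p.blocks, p.InBlock b i k j := by
  have hl : ∀ a < p.n, a / p.z < p.layers := fun a ha =>
    Nat.lt_succ_iff.2 (Nat.div_le_div_right ha.le)
  have hl' : ∀ a < p.n, a / p.L < p.n / p.L + 1 := fun a ha =>
    Nat.lt_succ_iff.2 (Nat.div_le_div_right ha.le)
  have h₁ := hl k hk
  have h₂ := hl j hj
  have h₀ : 0 < p.layers := Nat.succ_pos _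
  have split : ∀ a l, 0 < l → a / l * l ≤ a ∧ a < a / l * l + l := fun a l hl =>
    ⟨Nat.div_mul_le_self _ _, Nat.lt_div_mul_add hl⟩
  set ly := p.layers with hly
  have hb₁ : (i / p.L * ly + k / p.z) * ly + j / p.z =
      i / p.L * (ly * ly) + (k / p.z * ly + j / p.z) := by ring
  have hb₂ : k / p.z * ly + j / p.z < ly * ly := by
    have := Nat.mul_le_mul_right ly (Nat.succ_le_of_lt h₁)
    rw [Nat.succ_mul] at this
    omega
  have q₁ : ((i / p.L * ly + k / p.z) * ly + j / p.z) / ly = i / p.L * ly + k / p.z := by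
    rw [Nat.mul_comm, Nat.mul_add_div h₀, Nat.div_eq_of_lt h₂, Nat.add_zero]
  refine ⟨(i / p.L * ly + k / p.z) * ly + j / p.z, ?_, ?_, ?_, ?_⟩
  · rw [hb₁, Params.blocks, ← hly]
    have := Nat.mul_le_mul_right (ly * ly) (Nat.succ_le_of_lt (hl' i hi))
    rw [Nat.succ_mul] at this
    omega
  · rw [Params.fstBase, ← hly, hb₁, Nat.mul_comm (i / p.L), Nat.mul_add_div (by positivity),
      Nat.div_eq_of_lt hb₂, Nat.add_zero]
    exact split i p.L hL
  · rw [Params.midBase, ← hly, q₁, Nat.mul_comm (i / p.L), Nat.mul_add_mod, Nat.mod_eq_of_lt h₁]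
    exact split k p.z hz
  · rw [Params.lstBase, ← hly, Nat.mul_comm _ ly, Nat.mul_add_mod, Nat.mod_eq_of_lt h₂]
    exact split j p.z hz

/-- Incrementing the stamp first invalidates everything that earlier calls left behind. If the scan
finds nothing, `exists_improvable` shows that the block is exhausted; otherwise the estimates have
changed and the same block is examined again. -/
theorem runs_blockProgram {B B₀ τ : ℕ} {x : APSP.Instance} {p : Params} {E nE : ℕ → ℕ} {g : ℕ}
    {M : ℕ → ℕ → ℕ} {hN : 0 < p.N} {P : Program} (hp : Phase x p E nE g M B)
    (hP : p.Solves hN P B₀ τ) (hB₀ : B₀ ≤ B) {s : State} (hs : Work x p E nE g s) {b : ℕ}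
    (h₁₂ : s.reg 12 = b + 1) (hb : b < p.blocks) (h₁₆ : s.reg 16 + 1 < B) :
    Runs B (blockProgram P) s (blockTime p P τ) fun s' => Work x p E nE g s' ∧
      (∀ r < 12, s'.reg r = s.reg r) ∧ s'.reg 16 = s.reg 16 + 1 ∧ (∀ y, s'.mem 2 y ≤ s.mem 2 y) ∧
      ((s'.reg 12 = b + 1 ∧ potential p.n g M (s'.mem 2) + 1 ≤ potential p.n g M (s.mem 2)) ∨
        (s'.reg 12 = b ∧ s'.mem 2 = s.mem 2 ∧ ∀ i k j, p.InBlock b i k j →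
          ¬ Improvable p.n E (s.mem 2) g i k j)) := by
  have fits := hp.fits
  have env := hs.env
  have hEV := Estimate.entry_le (p := p) hp.estimate hp.n_eq
  have hDV := Estimate.entry_le (p := p) hs.estimate hp.n_eq
  have b₁₃ := p.fstBase_le hb
  have b₁₅ : p.midBase b ≤ p.n := p.mod_layers_mul_le _
  have b₁₄ : p.lstBase b ≤ p.n := p.mod_layers_mul_le _
  have hnB := fits.n_add
  have hlB : p.layers * p.layers < B :=
    (Nat.le_mul_of_pos_left _ (Nat.succ_pos _)).trans_lt fits.blocks_lt
  have e₁₂ : s.reg 12 - 1 = b := by omega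
  -- decoding
  apply Runs.seq
  refine (Code.runs blockHead s ?_).mono le_rfl ?_
  · simp only [blockHead, Code.Ok, Ok, Code.run, eval, setReg_reg, Nat.reduceEqDiff, if_true,
      if_false, env.layers, env.L, env.z, env.N, e₁₂]
    change p.fstBase b ≤ p.n at b₁₃
    rw [Params.fstBase] at b₁₃
    rw [Params.midBase] at b₁₅
    rw [Params.lstBase] at b₁₄
    have := fits.N_sq
    refine ⟨⟨by omega, by omega, by omega⟩, ⟨by omega, ⟨by omega, ⟨by omega, by omega, hlB⟩⟩,
      by omega, by omega⟩, ⟨by omega, ⟨⟨by omega, by omega⟩, by omega⟩, by omega, by omega⟩,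
      ⟨by omega, ⟨by omega, by omega⟩, by omega, by omega⟩, ⟨by omega, by omega, by omega, h₁₆⟩,
      ⟨by omega, by omega⟩, by omega, by omega, by omega, this⟩
  intro s₁ hs₁
  have a₁₃ : s₁.reg 13 = p.fstBase b := by
    simp [hs₁, blockHead, env.layers, env.L, e₁₂, Params.fstBase]
  have a₁₄ : s₁.reg 14 = p.lstBase b := by
    simp [hs₁, blockHead, env.layers, env.z, e₁₂, Params.lstBase]
  have a₁₅ : s₁.reg 15 = p.midBase b := by
    simp [hs₁, blockHead, env.layers, env.z, e₁₂, Params.midBase]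
  have a₁₆ : s₁.reg 16 = s.reg 16 + 1 := by simp [hs₁, blockHead]
  have a₁₇ : s₁.reg 17 = 0 := by simp [hs₁, blockHead]
  have a₁₈ : s₁.reg 18 = p.N * p.N := by simp [hs₁, blockHead, env.N]
  have ar : ∀ r < 13, s₁.reg r = s.reg r := by
    intro r hr
    have c₁ : r ≠ 13 := by omega
    have c₂ : r ≠ 14 := by omega
    have c₃ : r ≠ 15 := by omega
    have c₄ : r ≠ 16 := by omega
    have c₅ : r ≠ 17 := by omega
    have c₆ : r ≠ 18 := by omega
    have c₇ : r ≠ 20 := by omega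
    simp [hs₁, blockHead, c₁, c₂, c₃, c₄, c₅, c₆, c₇]
  have am : s₁.mem = s.mem := by simp [hs₁, blockHead]
  clear hs₁
  -- writing the costs
  have env₁ : p.Env s₁ := env.congr fun r hr => ar r (by omega)
  apply Runs.seq
  refine (runs_setup env₁ fits (by rw [am, hs.mem_E]; exact hEV) (by omega) (by omega) (by omega)
    a₁₈).mono le_rfl ?_
  rintro s₂ ⟨br, bm, bc⟩
  rw [a₁₃, a₁₄, a₁₅, a₁₆, am, hs.mem_E] at bc
  have env₂ : p.Env s₂ := env₁.congr fun r hr => br r (by omega)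
  have b₁₆ : s₂.reg 16 = s.reg 16 + 1 := (br 16 (by omega)).trans a₁₆
  have old : ∀ m y, s.mem (11 + 2 * m) y < s.reg 16 + 1 := fun m y => Nat.lt_succ_iff.2 (hs.stamps m y)
  have stamps₂ : s₂.StampsLE := by
    intro m y
    rw [b₁₆]
    by_cases hm : m = 0
    · subst hm
      have h₁ := bc y
      have h₂ := old 0 y
      simp only [Nat.mul_zero, Nat.add_zero] at h₂ ⊢
      split_ifs at h₁ <;> omega
    · rw [bm _ (by omega) (by omega), am]
      exact (old m y).le
  have zero₂ : ∀ m y, 0 < m → s₂.stampedMem m y = 0 := by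
    intro m y hm
    have := old m y
    rw [State.stampedMem, bm _ (by omega) (by omega), am, b₁₆, if_neg (by omega)]
  have cost₂ : ∀ y, s₂.stampedMem 0 y = if y < p.N * p.N then
      p.blockCost (p.fstBase b) (p.lstBase b) (p.midBase b) E (s.mem 2) (y / p.N) (y % p.N)
      else 0 := by
    intro y
    have h₁ := bc y
    have h₂ := old 0 y
    simp only [State.stampedMem, Nat.mul_zero, Nat.add_zero, b₁₆] at h₂ ⊢
    split_ifs at h₁ ⊢ <;> omega
  -- the call
  apply Runs.seq
  refine (runs_viterbiCall hP fits hB₀ env₂ (fun u v => Params.blockCost_le hEV u v) stamps₂ cost₂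
    zero₂).mono le_rfl ?_
  rintro s₃ ⟨o₃, stamps₃, u, hu, hout⟩
  -- the inspection
  apply Runs.seq
  refine (Code.runs scanHead s₃ ⟨by omega, by simp, by simp; omega⟩).mono le_rfl ?_
  intro s₄ hs₄
  have dr : ∀ r < 39, r ≠ 18 → s₄.reg r = s₂.reg r := by
    intro r hr h
    rw [← o₃.reg r hr, hs₄]
    simp [scanHead, h]
  have dm : s₄.mem = s₃.mem := by rw [hs₄]; rfl
  have d₁₈ : s₄.reg 18 = p.T - 1 := by
    rw [hs₄]
    simp [scanHead, o₃.reg 4, env₂.T]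
  have cm : ∀ m < 10, s₄.mem m = s.mem m := by
    intro m hm
    rw [dm, o₃.mem m hm, bm m (by omega) (by omega), am]
  have cr : ∀ r < 13, s₄.reg r = s.reg r := by
    intro r hr
    rw [dr r (by omega) (by omega), br r (by omega), ar r hr]
  have out₄ : ∀ t : Fin (p.T + 1), s₄.stampedMem 3 t = u t := by
    intro t
    rw [← hout t]
    simp only [State.stampedMem, dm, dr 16 (by omega) (by omega), o₃.reg 16 (by omega)]
  have work₄ : Work x p E nE g s₄ := by
    refine ⟨env.congr fun r hr => cr r (by omega), (cm 3 (by omega)).trans hs.mem_E,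
      (cm 4 (by omega)).trans hs.mem_nE, (cr 11 (by omega)).trans hs.reg_g, fun m y => ?_, ?_, ?_⟩
    · rw [dm, dr 16 (by omega) (by omega), ← o₃.reg 16 (by omega)]
      exact stamps₃ m y
    · rw [cm 1 (by omega), cm 2 (by omega)]
      exact hs.estimate
    · rw [cm 2 (by omega)]
      exact hs.le
  clear hs₄
  have d₁₃ : s₄.reg 13 = p.fstBase b := by
    rw [dr 13 (by omega) (by omega), br 13 (by omega), a₁₃]
  have d₁₄ : s₄.reg 14 = p.lstBase b := by
    rw [dr 14 (by omega) (by omega), br 14 (by omega), a₁₄]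
  have d₁₅ : s₄.reg 15 = p.midBase b := by
    rw [dr 15 (by omega) (by omega), br 15 (by omega), a₁₅]
  have d₁₆ : s₄.reg 16 = s.reg 16 + 1 := by rw [dr 16 (by omega) (by omega), b₁₆]
  have d₁₇ : s₄.reg 17 = 0 := by rw [dr 17 (by omega) (by omega), br 17 (by omega), a₁₇]
  apply Runs.seq
  refine (runs_scan hp work₄ (w := s₄.stampedMem 3) (fun _ _ => rfl)
    (fun t ht => by rw [show s₄.stampedMem 3 t = _ from out₄ ⟨t, by omega⟩]; exact (u _).2)
    d₁₃ d₁₄ d₁₅ (by omega) (by omega) (by omega) d₁₇ d₁₈).mono le_rfl ?_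
  rintro s₅ ⟨fr, work₅, hc⟩
  have f₁₂ : s₅.reg 12 = b + 1 := by rw [fr 12 (by omega), cr 12 (by omega), h₁₂]
  have m₄₂ := cm 2 (by omega)
  rw [m₄₂] at hc
  refine (Code.runs blockTail s₅ ?_).mono le_rfl ?_
  · refine ⟨by omega, ?_⟩
    apply ok_ifEQ <;> simp <;> omega
  rintro s₆ hs₆
  have r₆ : ∀ r, r ≠ 12 → s₆.reg r = s₅.reg r := by
    intro r hr
    rw [hs₆]
    simp [blockTail, hr]
  have m₆ : s₆.mem = s₅.mem := by rw [hs₆]; rfl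
  have v₆ : s₆.reg 12 = if s₅.reg 17 = 0 then b else b + 1 := by
    rw [hs₆]
    simp [blockTail, f₁₂]
  refine ⟨⟨work₅.env.congr fun r hr => r₆ r (by omega), m₆ ▸ work₅.mem_E, m₆ ▸ work₅.mem_nE,
    (r₆ 11 (by omega)).trans work₅.reg_g, ?_, m₆ ▸ work₅.estimate, m₆ ▸ work₅.le⟩, ?_, ?_, ?_, ?_⟩
  · intro m y
    rw [m₆, r₆ 16 (by omega)]
    exact work₅.stamps m y
  · intro r hr
    rw [r₆ r (by omega), fr r (by omega), cr r (by omega)]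
  · rw [r₆ 16 (by omega), fr 16 (by omega), d₁₆]
  · intro y
    rw [m₆]
    rcases hc with hc | hc
    · rw [hc.2.1]
    · exact hc.2.2 y
  · rw [m₆, v₆]
    rcases hc with ⟨h₁, h₂, h₃⟩ | ⟨h₁, h₂, h₃⟩
    · refine .inr ⟨if_pos h₁, h₂, fun i k j hblk him => ?_⟩
      obtain ⟨t, ht, hti⟩ := fits.exists_improvable hN hp.g_pos hEV hDV hu out₄
        (i := i - p.fstBase b) (k := k - p.midBase b) (j := j - p.lstBase b)
        (by have := hblk.1; omega) (by have := hblk.2.1; omega) (by have := hblk.2.2; omega)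
        (by
          rw [Nat.add_sub_cancel' hblk.1.1, Nat.add_sub_cancel' hblk.2.1.1,
            Nat.add_sub_cancel' hblk.2.2.1]
          exact him)
      exact h₃ t ht hti
    · exact .inl ⟨if_neg h₁, h₂⟩

end WordRAM

/-! ### Phases of decreasing threshold and rounds of min-plus squaring. -/

namespace WordRAM

open Finset WordRAM.Expr

/-- The fixed data of a round, in which the estimates `E` are combined, are sound: `M` is the
min-plus square of `E`. -/
structure Round (x : APSP.Instance) (p : Params) (E nE : ℕ → ℕ) (M : ℕ → ℕ → ℕ) (B : ℕ) :
    Prop where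
  fits : p.Fits B
  n_eq : p.n = x.n
  estimate : x.Estimate p.V E nE
  min_le : ∀ i < p.n, ∀ j < p.n, ∀ k < p.n, M i j ≤ E (i * p.n + k) + E (k * p.n + j)
  min_eq : ∀ i < p.n, ∀ j < p.n, ∃ k < p.n, M i j = E (i * p.n + k) + E (k * p.n + j)

theorem Round.phase {x : APSP.Instance} {p : Params} {E nE : ℕ → ℕ} {M : ℕ → ℕ → ℕ} {B g : ℕ}
    (h : Round x p E nE M B) (hg : 0 < g) (hg' : g ≤ p.V) : Phase x p E nE g M B :=
  ⟨h.fits, h.n_eq, h.estimate, hg, hg', h.min_le⟩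

/-- A bound for the number of blocks inspected in one phase. -/
def Params.steps (p : Params) : ℕ := p.blocks + 2 * (p.n * p.n)

theorem Improvable.mono {n g i k j : ℕ} {E D D' : ℕ → ℕ} (h : Improvable n E D' g i k j)
    (hD : ∀ y, D' y ≤ D y) : Improvable n E D g i k j :=
  ⟨h.1, h.2.1, h.2.2.1, h.2.2.2.trans (hD _)⟩

/-- Each turn exhausts a block or lowers the potential, so the number of open blocks plus the
potential decreases. This sum bounds the time and, as every turn uses one stamp, the growth of the
stamp. Exhausted blocks remain so because estimates only decrease. -/
theorem runs_phase {B B₀ τ : ℕ} {x : APSP.Instance} {p : Params} {E nE : ℕ → ℕ} {g : ℕ}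
    {M : ℕ → ℕ → ℕ} {hN : 0 < p.N} {P : Program} (hp : Phase x p E nE g M B)
    (hP : p.Solves hN P B₀ τ) (hB₀ : B₀ ≤ B) {s : State} (hs : Work x p E nE g s)
    (h₁₂ : s.reg 12 = p.blocks) (h₁₆ : s.reg 16 + p.steps < B)
    (hM : ∀ i < p.n, ∀ j < p.n, s.mem 2 (i * p.n + j) ≤ M i j + 2 * g) :
    Runs B (.loop 12 (blockProgram P)) s (p.steps * (blockTime p P τ + 1) + 1) fun s' =>
      Work x p E nE g s' ∧ (∀ r < 12, s'.reg r = s.reg r) ∧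
      s'.reg 16 ≤ s.reg 16 + p.steps ∧ ∀ i k j, ¬ Improvable p.n E (s'.mem 2) g i k j := by
  set μ : State → ℕ := fun s => s.reg 12 + potential p.n g M (s.mem 2) with hμ
  have hμs : μ s ≤ p.steps := by
    have := potential_le hp.g_pos hM
    simp only [hμ, Params.steps]
    omega
  have main := Runs.loop_of_measure (B := B) (r := 12) (c := blockProgram P) (by omega)
    (fun s' => Work x p E nE g s' ∧ (∀ r < 12, s'.reg r = s.reg r) ∧
      s'.reg 16 + μ s' ≤ s.reg 16 + p.steps ∧ s'.reg 12 ≤ p.blocks ∧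
      ∀ b, s'.reg 12 ≤ b → b < p.blocks → ∀ i k j, p.InBlock b i k j →
        ¬ Improvable p.n E (s'.mem 2) g i k j) μ (blockTime p P τ) ?_ s ?_
  · refine main.mono ?_ ?_
    · have := Nat.mul_le_mul_right (blockTime p P τ + 1) hμs
      omega
    · rintro s' ⟨⟨hW, hr, he, -, hb⟩, h0⟩
      refine ⟨hW, hr, by omega, fun i k j hi => ?_⟩
      obtain ⟨b, hb₁, hb₂⟩ := Params.exists_inBlock hp.fits.L_pos hp.fits.z_pos hi.1 hi.2.1
        hi.2.2.1
      exact hb b (by omega) hb₁ i k j hb₂ hi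
  · rintro s₁ ⟨hW, hr, he, hle, hb⟩ hne
    obtain ⟨b, hb₁⟩ := Nat.exists_eq_succ_of_ne_zero hne
    have hb₂ : s₁.reg 12 = b + 1 := hb₁
    refine (runs_blockProgram hp hP hB₀ hW hb₂ (by omega) ?_).mono le_rfl ?_
    · simp only [hμ] at he
      omega
    · rintro s₂ ⟨hW₂, hr₂, h₂₁₆, hD, hc⟩
      have hlt : μ s₂ < μ s₁ := by
        simp only [hμ]
        rcases hc with hc | hc
        · omega
        · rw [hc.2.1]
          omega
      refine ⟨⟨hW₂, fun r h => (hr₂ r h).trans (hr r h), by omega, ?_, ?_⟩, hlt⟩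
      · rcases hc with hc | hc <;> omega
      · intro b' hb' hb'' i k j hblk him
        have him' := him.mono hD
        by_cases h : s₁.reg 12 ≤ b'
        · exact hb b' h hb'' i k j hblk him'
        · rcases hc with hc | hc
          · omega
          · have : b' = b := by omega
            subst this
            exact hc.2.2 i k j hblk him'
  · refine ⟨hs, fun _ _ => rfl, by omega, h₁₂.le, fun b h₁ h₂ => ?_⟩
    omega

/-- Starts a phase. -/
def phaseHead : Code := .set 12 (var 9)

/-- Ends a phase. -/
def phaseTail : Code := .set 11 (div (var 11) (lit 2))

/-- One phase: all improvements by `g` or more are made. Then `g` is halved. -/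
def phaseProgram (P : Program) : Program :=
  .seq phaseHead.compile (.seq (.loop 12 (blockProgram P)) phaseTail.compile)

/-- A bound for the running time of `phaseProgram`. -/
def phaseTime (p : Params) (P : Program) (τ : ℕ) : ℕ :=
  phaseHead.time + ((p.steps * (blockTime p P τ + 1) + 1) + phaseTail.time)

theorem size_half_lt {g : ℕ} (hg : g ≠ 0) : Nat.size (g / 2) < Nat.size g := by
  obtain ⟨l, hl⟩ : ∃ l, Nat.size g = l + 1 :=
    Nat.exists_eq_succ_of_ne_zero (fun h => hg (Nat.size_eq_zero.1 h))
  have : g < 2 ^ (l + 1) := hl ▸ Nat.lt_size_self g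
  rw [hl, Nat.lt_succ_iff, Nat.size_le]
  rw [pow_succ] at this
  omega

/-- A phase with threshold `g` ends with `D ≤ M + (g - 1) ≤ M + 2 * (g / 2)`, which is the condition
for starting the next one. It holds for `g = V` since `D ≤ V`, and once `g` has become `0` it says
`D ≤ M`. -/
theorem runs_phases {B B₀ τ : ℕ} {x : APSP.Instance} {p : Params} {E nE : ℕ → ℕ}
    {M : ℕ → ℕ → ℕ} {hN : 0 < p.N} {P : Program} (hp : Round x p E nE M B)
    (hP : p.Solves hN P B₀ τ) (hB₀ : B₀ ≤ B) {s : State} (hs : Work x p E nE p.V s)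
    (h₁₆ : s.reg 16 + Nat.size p.V * p.steps < B) :
    Runs B (.loop 11 (phaseProgram P)) s (Nat.size p.V * (phaseTime p P τ + 1) + 1) fun s' =>
      p.Env s' ∧ s'.StampsLE ∧ x.Estimate p.V (s'.mem 2) (s'.mem 1) ∧
      (∀ r < 11, s'.reg r = s.reg r) ∧ s'.reg 16 ≤ s.reg 16 + Nat.size p.V * p.steps ∧
      ∀ i < p.n, ∀ j < p.n, ∀ k < p.n,
        s'.mem 2 (i * p.n + j) ≤ E (i * p.n + k) + E (k * p.n + j) := by
  have main := Runs.loop_of_measure (B := B) (r := 11) (c := phaseProgram P) (by omega)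
    (fun s' => Work x p E nE (s'.reg 11) s' ∧ (∀ r < 11, s'.reg r = s.reg r) ∧ s'.reg 11 ≤ p.V ∧
      (∀ i < p.n, ∀ j < p.n, s'.mem 2 (i * p.n + j) ≤ M i j + 2 * s'.reg 11) ∧
      s'.reg 16 + Nat.size (s'.reg 11) * p.steps ≤ s.reg 16 + Nat.size p.V * p.steps)
    (fun s' => Nat.size (s'.reg 11)) (phaseTime p P τ) ?_ s ?_
  · rw [hs.reg_g] at main
    refine main.mono le_rfl ?_
    rintro s' ⟨⟨hW, hr, -, hM, he⟩, h0⟩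
    refine ⟨hW.env, hW.stamps, hW.estimate, hr, by omega, fun i hi j hj k hk => ?_⟩
    have h₁ := hM i hi j hj
    have h₂ := hp.min_le i hi j hj k hk
    omega
  · rintro s₁ ⟨hW, hr, hgV, hM, he⟩ hne
    have hsz := size_half_lt hne
    have hmul : (Nat.size (s₁.reg 11 / 2) + 1) * p.steps ≤ Nat.size (s₁.reg 11) * p.steps :=
      Nat.mul_le_mul_right _ hsz
    rw [Nat.succ_mul] at hmul
    have hph := hp.phase (Nat.pos_of_ne_zero hne) hgV
    apply Runs.seq
    refine (Code.runs phaseHead s₁ ⟨by omega, by simp⟩).mono le_rfl ?_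
    intro s₂ hs₂
    have r₂ : ∀ r, r ≠ 12 → s₂.reg r = s₁.reg r := by
      intro r h
      simp [hs₂, phaseHead, h]
    have m₂ : s₂.mem = s₁.mem := by rw [hs₂]; rfl
    have b₂ : s₂.reg 12 = p.blocks := by simp [hs₂, phaseHead, hW.env.blocks]
    clear hs₂
    apply Runs.seq
    refine (runs_phase hph hP hB₀ (s := s₂) ⟨hW.env.congr fun r h => r₂ r (by omega),
      m₂ ▸ hW.mem_E, m₂ ▸ hW.mem_nE, r₂ 11 (by omega), ?_, m₂ ▸ hW.estimate, m₂ ▸ hW.le⟩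
      b₂ ?_ (by rw [m₂]; exact hM)).mono le_rfl ?_
    · intro m y
      rw [m₂, r₂ 16 (by omega)]
      exact hW.stamps m y
    · rw [r₂ 16 (by omega)]
      omega
    rintro s₃ ⟨hW₃, hr₃, he₃, hn₃⟩
    refine (Code.runs phaseTail s₃ ⟨by omega, ?_⟩).mono le_rfl ?_
    · have := hp.fits.V_pos
      have := hp.fits.V_lt
      simp
      omega
    intro s₄ hs₄
    have r₄ : ∀ r, r ≠ 11 → s₄.reg r = s₃.reg r := by
      intro r h
      simp [hs₄, phaseTail, h]
    have m₄ : s₄.mem = s₃.mem := by rw [hs₄]; rfl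
    have g₄ : s₄.reg 11 = s₁.reg 11 / 2 := by simp [hs₄, phaseTail, hW₃.reg_g]
    have e₄ : s₄.reg 16 = s₃.reg 16 := r₄ 16 (by omega)
    have e₂ : s₂.reg 16 = s₁.reg 16 := r₂ 16 (by omega)
    clear hs₄
    refine ⟨⟨⟨hW₃.env.congr fun r h => r₄ r (by omega), m₄ ▸ hW₃.mem_E, m₄ ▸ hW₃.mem_nE, rfl,
      ?_, m₄ ▸ hW₃.estimate, m₄ ▸ hW₃.le⟩, ?_, ?_, ?_, ?_⟩, ?_⟩
    · intro m y
      rw [m₄, e₄]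
      exact hW₃.stamps m y
    · intro r h
      rw [r₄ r (by omega), hr₃ r (by omega), r₂ r (by omega), hr r h]
    · omega
    · intro i hi j hj
      obtain ⟨k, hk, hMk⟩ := hp.min_eq i hi j hj
      have := hn₃ i k j
      simp only [Improvable, hi, hk, hj, true_and, ← hMk] at this
      rw [m₄]
      omega
    · rw [g₄]
      omega
    · rw [g₄]
      exact hsz
  · rw [hs.reg_g]
    refine ⟨hs, fun _ _ => rfl, le_rfl, fun i hi j hj => ?_, le_rfl⟩
    exact (Estimate.entry_le hs.estimate hp.n_eq i hi j hj).trans (by omega)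

/-- Prepares the loop that copies the estimates. -/
def copyHead : Code := .set 18 (mul (var 0) (var 0))

/-- Copies one entry of the estimates. -/
def copyBody : Code :=
  .seq (.set 18 (sub (var 18) (lit 1))) <|
  .seq (.put 3 (var 18) (arr 2 (var 18))) (.put 4 (var 18) (arr 1 (var 18)))

theorem runs_copy {B : ℕ} {p : Params} {s₀ : State} (hB : p.Fits B)
    (h₁₈ : s₀.reg 18 = p.n * p.n) :
    Runs B (.loop 18 copyBody.compile) s₀ (p.n * p.n * (copyBody.time + 1) + 1) fun s =>
      (∀ r, r ≠ 18 → s.reg r = s₀.reg r) ∧ (∀ m, m ≠ 3 → m ≠ 4 → s.mem m = s₀.mem m) ∧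
      ∀ y < p.n * p.n, s.mem 3 y = s₀.mem 2 y ∧ s.mem 4 y = s₀.mem 1 y := by
  have main := Runs.loop_countdown (B := B) (r := 18) (c := copyBody.compile) (by omega)
    (fun x s => (∀ r, r ≠ 18 → s.reg r = s₀.reg r) ∧
      (∀ m, m ≠ 3 → m ≠ 4 → s.mem m = s₀.mem m) ∧
      ∀ y < p.n * p.n, x ≤ y → s.mem 3 y = s₀.mem 2 y ∧ s.mem 4 y = s₀.mem 1 y)
    copyBody.time ?_ s₀ ?_
  · rw [h₁₈] at main
    exact main.mono le_rfl fun s h => ⟨h.2.1, h.2.2.1, fun y hy => h.2.2.2 y hy (Nat.zero_le _)⟩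
  · rintro x s hx ⟨hr, hm, hc⟩
    have e₁₈ : s.reg 18 - 1 = x := by omega
    have hnB := hB.n_add
    refine (Code.runs copyBody s ?_).mono le_rfl ?_
    · simp [copyBody]
      omega
    · rintro _ rfl
      simp only [copyBody, Code.run, eval, e₁₈, setReg_reg, setMem_reg, setReg_mem, setMem_mem,
        if_true, if_false, Nat.reduceEqDiff]
      refine ⟨trivial, fun r h => by simp [h, hr r h], fun m h₁ h₂ => ?_, fun y hy hxy => ?_⟩
      · simp [h₁, h₂, hm m h₁ h₂]
      · have := hc y hy
        rw [hm 1 (by omega) (by omega), hm 2 (by omega) (by omega)]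
        simp only [Function.update_apply]
        split_ifs with h
        · subst h
          exact ⟨rfl, rfl⟩
        · exact this (by omega)
  · exact ⟨fun _ _ => rfl, fun _ _ _ => rfl, fun y h₁ h₂ => by omega⟩

/-- Starts the first phase of a round. -/
def roundMid : Code := .set 11 (var 1)

/-- Ends a round. -/
def roundTail : Code := .set 10 (div (var 10) (lit 2))

/-- One round: the estimates are replaced by their min-plus square. -/
def roundProgram (P : Program) : Program :=
  .seq copyHead.compile <| .seq (.loop 18 copyBody.compile) <| .seq roundMid.compile <|
  .seq (.loop 11 (phaseProgram P)) roundTail.compile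

/-- A bound for the running time of `roundProgram`. -/
def roundTime (p : Params) (P : Program) (τ : ℕ) : ℕ :=
  copyHead.time + ((p.n * p.n * (copyBody.time + 1) + 1) + (roundMid.time +
    ((Nat.size p.V * (phaseTime p P τ + 1) + 1) + roundTail.time)))

theorem index_lt {n i j : ℕ} (hi : i < n) (hj : j < n) : i * n + j < n * n := by
  have := Nat.mul_le_mul_right n (Nat.succ_le_of_lt hi)
  rw [Nat.succ_mul] at this
  omega

theorem Estimate.congr {x : APSP.Instance} {V : ℕ} {D nx D' nx' : ℕ → ℕ}
    (h : x.Estimate V D nx) (hD : ∀ y < x.n * x.n, D' y = D y ∧ nx' y = nx y) :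
    x.Estimate V D' nx' := by
  have h₁ : ∀ i j : Fin x.n, D' (i * x.n + j) = D (i * x.n + j) := fun i j =>
    (hD _ (index_lt i.2 j.2)).1
  have h₂ : ∀ i j : Fin x.n, nx' (i * x.n + j) = nx (i * x.n + j) := fun i j =>
    (hD _ (index_lt i.2 j.2)).2
  refine ⟨fun i j => ?_, fun i => ?_, fun i j => ?_, fun i j => ?_⟩
  · rw [h₁]
    exact h.le i j
  · rw [h₁]
    exact h.diag i
  · rw [h₁, h₂]
    exact h.walk i j
  · rw [h₁, h₂]
    exact h.none i j

theorem exists_minPlus {n : ℕ} (hn : 0 < n) (E : ℕ → ℕ) : ∃ M : ℕ → ℕ → ℕ,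
    (∀ i < n, ∀ j < n, ∀ k < n, M i j ≤ E (i * n + k) + E (k * n + j)) ∧
    ∀ i < n, ∀ j < n, ∃ k < n, M i j = E (i * n + k) + E (k * n + j) := by
  have : ∀ i j, ∃ k ∈ range n, ∀ k' ∈ range n,
      E (i * n + k) + E (k * n + j) ≤ E (i * n + k') + E (k' * n + j) := fun i j =>
    exists_min_image (range n) _ ⟨0, mem_range.2 hn⟩
  choose k hk hk' using this
  exact ⟨fun i j => E (i * n + k i j) + E (k i j * n + j),
    fun i _ j _ k' h => hk' i j k' (mem_range.2 h),
    fun i _ j _ => ⟨k i j, mem_range.1 (hk i j), rfl⟩⟩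

/-- The state between two rounds: the estimates are exact for walks of at most `l` edges. -/
structure Between (x : APSP.Instance) (p : Params) (l : ℕ) (s : State) : Prop where
  env : p.Env s
  stamps : s.StampsLE
  estimate : x.Estimate p.V (s.mem 2) (s.mem 1)
  exact : x.ExactUpTo (s.mem 2) l

/-- The copy `E` stays fixed while the phases lower `D` to its min-plus square; by
`ExactUpTo.double` this doubles the range of exactness. -/
theorem runs_round {B B₀ τ l : ℕ} {x : APSP.Instance} {p : Params} {hN : 0 < p.N} {P : Program}
    (hp : p.Fits B) (hn : p.n = x.n) (hP : p.Solves hN P B₀ τ) (hB₀ : B₀ ≤ B) {s : State}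
    (hs : Between x p l s) (h₁₆ : s.reg 16 + Nat.size p.V * p.steps < B) :
    Runs B (roundProgram P) s (roundTime p P τ) fun s' =>
      Between x p (2 * l) s' ∧ s'.reg 10 = s.reg 10 / 2 ∧
      s'.reg 16 ≤ s.reg 16 + Nat.size p.V * p.steps := by
  have hnB := hp.n_add
  apply Runs.seq
  refine (Code.runs copyHead s ⟨by omega, by simp, by simp, ?_⟩).mono le_rfl ?_
  · simpa [hs.env.n] using hp.n_sq
  intro s₁ hs₁
  have r₁ : ∀ r, r ≠ 18 → s₁.reg r = s.reg r := by
    intro r h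
    simp [hs₁, copyHead, h]
  have m₁ : s₁.mem = s.mem := by rw [hs₁]; rfl
  have c₁ : s₁.reg 18 = p.n * p.n := by simp [hs₁, copyHead, hs.env.n]
  clear hs₁
  apply Runs.seq
  refine (runs_copy hp c₁).mono le_rfl ?_
  rintro s₂ ⟨r₂, m₂, hc₂⟩
  apply Runs.seq
  refine (Code.runs roundMid s₂ ⟨by omega, by simp⟩).mono le_rfl ?_
  intro s₃ hs₃
  have r₃ : ∀ r, r ≠ 11 → r ≠ 18 → s₃.reg r = s.reg r := by
    intro r h h'
    rw [← r₁ r h', ← r₂ r h']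
    simp [hs₃, roundMid, h]
  have m₃ : s₃.mem = s₂.mem := by rw [hs₃]; rfl
  have g₃ : s₃.reg 11 = p.V := by
    rw [← hs.env.V, ← r₁ 1 (by omega), ← r₂ 1 (by omega)]
    simp [hs₃, roundMid]
  clear hs₃
  have m₃' : ∀ m, m ≠ 3 → m ≠ 4 → s₃.mem m = s.mem m := by
    intro m h h'
    rw [m₃, m₂ m h h', m₁]
  rw [m₁, ← m₃] at hc₂
  obtain ⟨M, hM, hM'⟩ := exists_minPlus hp.n_pos (s₃.mem 3)
  have est : x.Estimate p.V (s₃.mem 3) (s₃.mem 4) := by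
    refine Estimate.congr hs.estimate fun y hy => ?_
    rw [← hn] at hy
    exact hc₂ y hy
  have env₃ : p.Env s₃ := hs.env.congr fun r h => r₃ r (by omega) (by omega)
  have e₃ : s₃.reg 16 = s.reg 16 := r₃ 16 (by omega) (by omega)
  apply Runs.seq
  refine (runs_phases (M := M) ⟨hp, hn, est, hM, hM'⟩ hP hB₀ (s := s₃) ⟨env₃, rfl, rfl, g₃, ?_,
    ?_, ?_⟩ (by omega)).mono le_rfl ?_
  · intro m y
    rw [e₃, m₃' _ (by omega) (by omega)]
    exact hs.stamps m y
  · rw [m₃' 1 (by omega) (by omega), m₃' 2 (by omega) (by omega)]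
    exact hs.estimate
  · intro i hi j hj
    rw [m₃' 2 (by omega) (by omega), (hc₂ _ (index_lt hi hj)).1]
  rintro s₄ ⟨env₄, st₄, est₄, r₄, e₄, hle₄⟩
  refine (Code.runs roundTail s₄ ⟨by omega, ?_⟩).mono le_rfl ?_
  · simp
    omega
  intro s₅ hs₅
  have r₅ : ∀ r, r ≠ 10 → s₅.reg r = s₄.reg r := by
    intro r h
    simp [hs₅, roundTail, h]
  have m₅ : s₅.mem = s₄.mem := by rw [hs₅]; rfl
  refine ⟨⟨env₄.congr fun r h => r₅ r (by omega), ?_, m₅ ▸ est₄, ?_⟩, ?_, ?_⟩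
  · intro m y
    rw [m₅, r₅ 16 (by omega)]
    exact st₄ m y
  · rw [m₅]
    refine APSP.Instance.ExactUpTo.double (E := s₃.mem 3) ?_ ?_
    · intro i j q hq
      rw [(hc₂ _ (by rw [hn]; exact index_lt i.2 j.2)).1]
      exact hs.exact i j q hq
    · intro i j k
      have := hle₄ i (by rw [hn]; exact i.2) j (by rw [hn]; exact j.2) k (by rw [hn]; exact k.2)
      rwa [hn] at this
  · rw [← r₃ 10 (by omega) (by omega), ← r₄ 10 (by omega)]
    simp [hs₅, roundTail]
  · rw [r₅ 16 (by omega)]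
    omega

theorem runs_rounds {B B₀ τ : ℕ} {x : APSP.Instance} {p : Params} {hN : 0 < p.N} {P : Program}
    (hp : p.Fits B) (hn : p.n = x.n) (hP : p.Solves hN P B₀ τ) (hB₀ : B₀ ≤ B) {s : State}
    (hs : Between x p 1 s) (h₁₀ : s.reg 10 = p.n)
    (h₁₆ : s.reg 16 + Nat.size p.n * (Nat.size p.V * p.steps) < B) :
    Runs B (.loop 10 (roundProgram P)) s (Nat.size p.n * (roundTime p P τ + 1) + 1) fun s' =>
      x.Estimate p.V (s'.mem 2) (s'.mem 1) ∧ x.ExactUpTo (s'.mem 2) x.n := by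
  have main := Runs.loop_of_measure (B := B) (r := 10) (c := roundProgram P) (by omega)
    (fun s' => ∃ l, Between x p l s' ∧ x.n < l * (s'.reg 10 + 1) ∧
      s'.reg 16 + Nat.size (s'.reg 10) * (Nat.size p.V * p.steps) < B)
    (fun s' => Nat.size (s'.reg 10)) (roundTime p P τ) ?_ s ?_
  · rw [h₁₀] at main
    refine main.mono le_rfl ?_
    rintro s' ⟨⟨l, hb, hl, -⟩, h0⟩
    refine ⟨hb.estimate, fun i j q hq => hb.exact i j q ?_⟩
    rw [h0] at hl
    omega
  · rintro s₁ ⟨l, hb, hl, he⟩ hne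
    have hsz := size_half_lt hne
    have hmul : (Nat.size (s₁.reg 10 / 2) + 1) * (Nat.size p.V * p.steps) ≤
        Nat.size (s₁.reg 10) * (Nat.size p.V * p.steps) := Nat.mul_le_mul_right _ hsz
    rw [Nat.succ_mul] at hmul
    refine (runs_round hp hn hP hB₀ hb (by omega)).mono le_rfl ?_
    rintro s₂ ⟨hb₂, h₂, he₂⟩
    rw [h₂]
    refine ⟨⟨2 * l, hb₂, hl.trans_le ?_, by omega⟩, hsz⟩
    rw [Nat.mul_comm 2 l, Nat.mul_assoc]
    exact Nat.mul_le_mul_left _ (by omega)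
  · rw [h₁₀]
    exact ⟨1, hs, by omega, h₁₆⟩

end WordRAM

/-! ### The complete reduction. -/

namespace WordRAM

open Finset WordRAM.Expr

/-- The power `e ^ k`. -/
def Expr.powExpr (e : Expr) : ℕ → Expr
  | 0 => lit 1
  | k + 1 => mul (powExpr e k) e

theorem eval_powExpr (s : State) (e : Expr) (k : ℕ) :
    (e.powExpr k).eval s = e.eval s ^ k := by
  induction k with
  | zero => rfl
  | succ k ih => rw [pow_succ, ← ih]; rfl

theorem ok_powExpr {B : ℕ} {s : State} {e : Expr} (h1 : 1 < B) (he : e.Ok B s)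
    (hpos : 0 < e.eval s) {k : ℕ} (hk : e.eval s ^ k < B) : (e.powExpr k).Ok B s := by
  induction k with
  | zero => exact h1
  | succ k ih =>
    refine ⟨ih ((Nat.pow_le_pow_right hpos (Nat.le_succ k)).trans_lt hk), he, ?_⟩
    rwa [eval_powExpr, ← pow_succ]

/-- Prepares the search for a root of `n`. -/
def rootHead : Code := .seq (.set 2 (lit 1)) (.set 18 (sub (var 0) (lit 1)))

/-- Tries the next candidate for the root. -/
def rootBody (k : ℕ) : Code :=
  .seq (.set 2 (add (var 2) (lit 1))) (.set 18 (sub (var 0) (powExpr (var 2) k)))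

/-- The candidates are tried in turn, with the truncated difference `n - j ^ k` as the loop
condition. No candidate exceeds `m`, so all powers fit into words. -/
theorem runs_root {B n k m : ℕ} {s₀ : State} (h₀ : s₀.reg 0 = n) (hm : 0 < m) (hn : n ≤ m ^ k)
    (hmin : ∀ j, 0 < j → j < m → j ^ k < n) (hB : m ^ k < B) (hB' : m + 1 < B)
    (h₂ : s₀.reg 2 = 1) (h₁₈ : s₀.reg 18 = n - 1) :
    Runs B (.loop 18 (rootBody k).compile) s₀ (m * ((rootBody k).time + 1) + 1) fun s =>
      s.reg 2 = m ∧ (∀ r, r ≠ 2 → r ≠ 18 → s.reg r = s₀.reg r) ∧ s.mem = s₀.mem := by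
  have main := Runs.loop_of_measure (B := B) (r := 18) (c := (rootBody k).compile) (by omega)
    (fun s => (0 < s.reg 2 ∧ s.reg 2 ≤ m ∧ s.reg 18 = n - s.reg 2 ^ k) ∧
      (∀ r, r ≠ 2 → r ≠ 18 → s.reg r = s₀.reg r) ∧ s.mem = s₀.mem)
    (fun s => m - s.reg 2) (rootBody k).time ?_ s₀ ?_
  · refine main.mono ?_ ?_
    · have := Nat.mul_le_mul_right ((rootBody k).time + 1) (Nat.sub_le m (s₀.reg 2))
      omega
    · rintro s ⟨⟨⟨h₁, h₂, h₃⟩, hr, hmem⟩, h0⟩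
      refine ⟨le_antisymm h₂ (not_lt.1 fun hlt => ?_), hr, hmem⟩
      have := hmin _ h₁ hlt
      omega
  · rintro s ⟨⟨h₁, h₂, h₃⟩, hr, hmem⟩ hne
    have hlt : s.reg 2 < m := by
      refine lt_of_le_of_ne h₂ fun h => ?_
      rw [h] at h₃
      omega
    have hp : (s.reg 2 + 1) ^ k < B := (Nat.pow_le_pow_left hlt k).trans_lt hB
    have e₀ : s.reg 0 = n := by rw [hr 0 (by omega) (by omega), h₀]
    refine (Code.runs (rootBody k) s ?_).mono le_rfl ?_
    · refine ⟨⟨by omega, by simp, by simp; omega, by simp; omega⟩, by omega, by simp,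
        ok_powExpr (by omega) (by simp) (by simp) ?_⟩
      simpa using hp
    · rintro _ rfl
      simp only [rootBody, Code.run, eval, eval_powExpr, setReg_reg, setReg_mem, Nat.reduceEqDiff,
        if_true, if_false, OfNat.zero_ne_ofNat, e₀]
      refine ⟨⟨⟨by omega, by omega, trivial⟩, fun r h h' => ?_, hmem⟩, by omega⟩
      simp [h, h', hr r h h']
  · refine ⟨⟨by omega, by omega, ?_⟩, fun _ _ _ => rfl, rfl⟩
    rw [h₁₈, h₂, one_pow]

/-- Computes the parameters from the root in register `2`. -/
def paramsCode (q a : ℕ) : Code :=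
  .seq (.set 2 (mul (lit 4) (var 2))) <| .seq (.set 3 (powExpr (var 2) q)) <|
  .seq (.set 4 (powExpr (var 2) a)) <| .seq (.set 5 (div (var 4) (lit 4))) <|
  .seq (.set 6 (div (var 3) (lit 4))) <| .seq (.set 7 (mul (lit 4) (var 1))) <|
  .seq (.set 8 (add (div (var 0) (var 6)) (lit 1))) <|
  .seq (.set 9 (mul (add (div (var 0) (var 5)) (lit 1)) (mul (var 8) (var 8)))) <|
  .seq (.set 18 (mul (var 0) (var 0))) <| .set 10 (var 0)

/-- The parameters of the reduction for weights up to `n ^ c`. -/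
def reductionParams (n c q a m : ℕ) : Params where
  n := n
  V := n ^ (c + 1)
  N := (4 * m) ^ q
  T := (4 * m) ^ a
  L := (4 * m) ^ a / 4
  z := (4 * m) ^ q / 4

theorem runs_paramsCode {B n c q a m : ℕ} {s : State} (hB : (reductionParams n c q a m).Fits B)
    (hm : 0 < m) (hmB : 4 * m < B) (h₀ : s.reg 0 = n) (h₁ : s.reg 1 = n ^ (c + 1))
    (h₂ : s.reg 2 = m) :
    Runs B (paramsCode q a).compile s (paramsCode q a).time fun s' =>
      (reductionParams n c q a m).Env s' ∧ s'.reg 18 = n * n ∧ s'.reg 10 = n ∧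
      (∀ r, 10 < r → r ≠ 18 → s'.reg r = s.reg r) ∧ s'.mem = s.mem := by
  have ⟨hn, hV, hL, hz, hTL, hN, hTN, hNN, hnn, hnB, hVB, hbB⟩ := hB
  have hNB : (4 * m) ^ q < B := by
    have : (reductionParams n c q a m).N = (4 * m) ^ q := rfl
    omega
  have hTB : (4 * m) ^ a < B := by
    have : (reductionParams n c q a m).N = (4 * m) ^ q := rfl
    have : (reductionParams n c q a m).T = (4 * m) ^ a := rfl
    omega
  have hVB' : 4 * n ^ (c + 1) < B := by
    have : (reductionParams n c q a m).V = n ^ (c + 1) := rfl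
    omega
  have hnB' : n + 1 < B := by
    have : (reductionParams n c q a m).n = n := rfl
    omega
  have hbB' : (n / ((4 * m) ^ a / 4) + 1) * ((n / ((4 * m) ^ q / 4) + 1) *
      (n / ((4 * m) ^ q / 4) + 1)) < B := hbB
  have hnn' : n * n < B := hnn
  have d₁ := Nat.div_le_self n ((4 * m) ^ a / 4)
  have d₂ := Nat.div_le_self n ((4 * m) ^ q / 4)
  have hl : (n / ((4 * m) ^ q / 4) + 1) * (n / ((4 * m) ^ q / 4) + 1) < B :=
    (Nat.le_mul_of_pos_left _ (Nat.succ_pos _)).trans_lt hbB'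
  have run : (paramsCode q a).run s = ((((((((((s.setReg 2 (4 * m)).setReg 3 ((4 * m) ^ q)).setReg 4
      ((4 * m) ^ a)).setReg 5 ((4 * m) ^ a / 4)).setReg 6 ((4 * m) ^ q / 4)).setReg 7
      (4 * n ^ (c + 1))).setReg 8 (n / ((4 * m) ^ q / 4) + 1)).setReg 9
      ((n / ((4 * m) ^ a / 4) + 1) * ((n / ((4 * m) ^ q / 4) + 1) *
        (n / ((4 * m) ^ q / 4) + 1)))).setReg 18 (n * n)).setReg 10 n) := by
    simp only [paramsCode, Code.run, eval, eval_powExpr, setReg_reg, Nat.reduceEqDiff, if_true,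
      if_false, OfNat.zero_ne_ofNat, OfNat.one_ne_ofNat, h₀, h₁, h₂]
  refine (Code.runs (paramsCode q a) s ?_).mono le_rfl ?_
  · have hpow : ∀ (s : State) e, s.reg 2 = 4 * m → (4 * m) ^ e < B →
        (powExpr (var 2) e).Ok B s := fun s e h h' =>
      ok_powExpr (by omega) (by simp) (by simp [h, hm]) (by simpa [h] using h')
    simp only [paramsCode, Code.Ok, Ok, Code.run, eval, eval_powExpr, setReg_reg, Nat.reduceEqDiff,
      if_true, if_false, OfNat.zero_ne_ofNat, OfNat.one_ne_ofNat, h₀, h₁, h₂]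
    refine ⟨⟨by omega, by omega, by omega, hmB⟩, ⟨by omega, hpow _ _ (by simp) hNB⟩,
      ⟨by omega, hpow _ _ (by simp) hTB⟩, ⟨by omega, by omega, by omega⟩,
      ⟨by omega, by omega, by omega⟩, ⟨by omega, by omega, by omega, hVB'⟩,
      ⟨by omega, ⟨by omega, by omega⟩, by omega, by omega⟩,
      ⟨by omega, ⟨⟨by omega, by omega⟩, by omega, by omega⟩, ⟨by omega, by omega, hl⟩, hbB'⟩,
      ⟨by omega, by omega, by omega, hnn'⟩, by omega, by omega⟩
  · rintro _ rfl
    rw [run]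
    refine ⟨⟨?_, ?_, ?_, ?_, ?_, ?_, ?_, ?_, ?_⟩, ?_, ?_, ?_, rfl⟩
    · simp [h₀, reductionParams]
    · simp [h₁, reductionParams]
    · simp [reductionParams]
    · simp [reductionParams]
    · simp [reductionParams]
    · simp [reductionParams]
    · simp [reductionParams]
    · simp [reductionParams, Params.layers]
    · simp [reductionParams, Params.layers, Params.blocks]
    · simp
    · simp
    · intro r hr hr'
      have c₂ : r ≠ 2 := by omega
      have c₃ : r ≠ 3 := by omega
      have c₄ : r ≠ 4 := by omega
      have c₅ : r ≠ 5 := by omega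
      have c₆ : r ≠ 6 := by omega
      have c₇ : r ≠ 7 := by omega
      have c₈ : r ≠ 8 := by omega
      have c₉ : r ≠ 9 := by omega
      have c₁₀ : r ≠ 10 := by omega
      simp [c₂, c₃, c₄, c₅, c₆, c₇, c₈, c₉, c₁₀, hr']

/-- Initializes one entry of the estimates. -/
def initBody : Code :=
  .seq (.set 18 (sub (var 18) (lit 1))) <| .seq (.set 19 (div (var 18) (var 0))) <|
  .seq (.set 20 (mod (var 18) (var 0))) <|
  .seq (.put 2 (var 18) (ifEQ (var 19) (var 20) (lit 0)
    (ifEQ (arr 0 (var 18)) (lit 0) (var 1) (arr 0 (var 18))))) <|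
  .put 1 (var 18) (ifEQ (arr 0 (var 18)) (lit 0) (var 0) (var 20))

theorem runs_init {B : ℕ} {p : Params} {s₀ : State} (env : p.Env s₀) (hB : p.Fits B)
    (h₁₈ : s₀.reg 18 = p.n * p.n) :
    Runs B (.loop 18 initBody.compile) s₀ (p.n * p.n * (initBody.time + 1) + 1) fun s =>
      (∀ r < 18, s.reg r = s₀.reg r) ∧ (∀ m, m ≠ 1 → m ≠ 2 → s.mem m = s₀.mem m) ∧
      ∀ y < p.n * p.n,
        s.mem 2 y = (if y / p.n = y % p.n then 0 else if s₀.mem 0 y = 0 then p.V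
          else s₀.mem 0 y) ∧
        s.mem 1 y = if s₀.mem 0 y = 0 then p.n else y % p.n := by
  have main := Runs.loop_countdown (B := B) (r := 18) (c := initBody.compile) (by omega)
    (fun x s => (∀ r < 18, s.reg r = s₀.reg r) ∧
      (∀ m, m ≠ 1 → m ≠ 2 → s.mem m = s₀.mem m) ∧
      ∀ y < p.n * p.n, x ≤ y →
        s.mem 2 y = (if y / p.n = y % p.n then 0 else if s₀.mem 0 y = 0 then p.V
          else s₀.mem 0 y) ∧
        s.mem 1 y = if s₀.mem 0 y = 0 then p.n else y % p.n)
    initBody.time ?_ s₀ ?_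
  · rw [h₁₈] at main
    exact main.mono le_rfl fun s h => ⟨h.2.1, h.2.2.1, fun y hy => h.2.2.2 y hy (Nat.zero_le _)⟩
  · rintro x s hx ⟨hr, hm, hc⟩
    have e₁₈ : s.reg 18 - 1 = x := by omega
    have hnB := hB.n_add
    have en : s.reg 0 = p.n := (hr 0 (by omega)).trans env.n
    have eV : s.reg 1 = p.V := (hr 1 (by omega)).trans env.V
    have e₀ : s.mem 0 = s₀.mem 0 := hm 0 (by omega) (by omega)
    refine (Code.runs initBody s ?_).mono le_rfl ?_
    · refine ⟨⟨by omega, by simp, by simp; omega⟩, ⟨by omega, by simp⟩, ⟨by omega, by simp⟩,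
        ⟨by simp, ?_⟩, by simp, ?_⟩
      · apply ok_ifEQ
        · simp
        · simp
        · intro _
          simp
          omega
        · intro _
          apply ok_ifEQ <;> simp
          omega
      · apply ok_ifEQ <;> simp
        omega
    · rintro _ rfl
      simp only [initBody, Code.run, eval, eval_ifEQ, e₁₈, setReg_reg, setMem_reg, setReg_mem,
        setMem_mem, if_true, if_false, Nat.reduceEqDiff, OfNat.zero_ne_ofNat, OfNat.one_ne_ofNat,
        en, eV, e₀]
      refine ⟨trivial, fun r h => ?_, fun m h₁ h₂ => ?_, fun y hy hxy => ?_⟩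
      · have h₁ : r ≠ 18 := by omega
        have h₂ : r ≠ 19 := by omega
        have h₃ : r ≠ 20 := by omega
        simp [h₁, h₂, h₃, hr r h]
      · simp [h₁, h₂, hm m h₁ h₂]
      · have := hc y hy
        simp only [Function.update_apply]
        by_cases h : y = x
        · subst h
          simp
        · rw [if_neg h, if_neg h]
          exact this (by omega)
  · exact ⟨fun _ _ => rfl, fun _ _ _ => rfl, fun y h₁ h₂ => by omega⟩

theorem rowMajor_index {n : ℕ} (M : Fin n → Fin n → ℕ) (i j : Fin n) :
    rowMajor M (i * n + j) = M i j := by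
  have hn : 0 < n := i.pos
  have h₁ : ((i : ℕ) * n + j) / n = i := by
    rw [Nat.mul_comm, Nat.mul_add_div hn, Nat.div_eq_of_lt j.2, Nat.add_zero]
  have h₂ : ((i : ℕ) * n + j) % n = j := by
    rw [Nat.mul_comm, Nat.mul_add_mod, Nat.mod_eq_of_lt j.2]
  simp [rowMajor, h₁, h₂]

/-- Computes the value that stands for infinity. -/
def infCode (c : ℕ) : Code := .set 1 (powExpr (var 0) (c + 1))

/-- Solves the all-pairs shortest paths problem, for weights up to `n ^ c`, with the help of the
program `P` for the Viterbi path problem. -/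
def reduction (P : Program) (c k q a : ℕ) : Program :=
  .seq (infCode c).compile <| .seq rootHead.compile <| .seq (.loop 18 (rootBody k).compile) <|
  .seq (paramsCode q a).compile <| .seq (.loop 18 initBody.compile) (.loop 10 (roundProgram P))

/-- A bound for the running time of `reduction`. -/
def reductionTime (p : Params) (P : Program) (c k q a m τ : ℕ) : ℕ :=
  (infCode c).time + (rootHead.time + ((m * ((rootBody k).time + 1) + 1) +
    ((paramsCode q a).time + ((p.n * p.n * (initBody.time + 1) + 1) +
      (Nat.size p.n * (roundTime p P τ + 1) + 1)))))

theorem runs_reduction {B B₀ τ c k q a m : ℕ} {x : APSP.Instance}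
    (hW : ∀ u v, x.weight u v ≤ x.n ^ c)
    (hp : (reductionParams x.n c q a m).Fits B) {hN : 0 < (reductionParams x.n c q a m).N}
    {P : Program} (hP : (reductionParams x.n c q a m).Solves hN P B₀ τ) (hB₀ : B₀ ≤ B)
    (hm : 0 < m) (hmk : x.n ≤ m ^ k) (hmin : ∀ j, 0 < j → j < m → j ^ k < x.n) (hk : m ^ k < B)
    (hmB : 4 * m < B)
    (hB : Nat.size x.n * (Nat.size (x.n ^ (c + 1)) * (reductionParams x.n c q a m).steps) < B) :
    Runs B (reduction P c k q a) (APSP.problem.input x)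
      (reductionTime (reductionParams x.n c q a m) P c k q a m τ) (APSP.problem.Correct x) := by
  have hn := x.n_pos
  have hnB : x.n + 3 < B := by
    have h₁ := hp.n_add
    have h₂ : (reductionParams x.n c q a m).n = x.n := rfl
    omega
  have hVB : x.n ^ (c + 1) < B := by
    have h₁ := hp.V_lt
    have h₂ : (reductionParams x.n c q a m).V = x.n ^ (c + 1) := rfl
    omega
  set s₀ := APSP.problem.input x with hs₀
  have r₀ : s₀.reg 0 = x.n := rfl
  have z₀ : ∀ r, r ≠ 0 → s₀.reg r = 0 := fun r h => by simp [hs₀, APSP.problem, h]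
  apply Runs.seq
  refine (Code.runs (infCode c) s₀ ⟨by omega, ok_powExpr (by omega) (by simp) (by simpa [r₀] using hn)
    (by simpa [r₀] using hVB)⟩).mono le_rfl ?_
  intro s₁ hs₁
  apply Runs.seq
  refine (Code.runs rootHead s₁ ⟨⟨by omega, by simp; omega⟩, by omega, by simp, by simp; omega⟩).mono
    le_rfl ?_
  intro s₂ hs₂
  have r₂ : ∀ r, r ≠ 1 → r ≠ 2 → r ≠ 18 → s₂.reg r = s₀.reg r := by
    intro r h₁ h₂ h₃
    simp [hs₂, hs₁, rootHead, infCode, h₁, h₂, h₃]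
  have v₂ : s₂.reg 1 = x.n ^ (c + 1) := by
    simp [hs₂, hs₁, rootHead, infCode, eval_powExpr, r₀]
  have o₂ : s₂.reg 2 = 1 := by simp [hs₂, rootHead]
  have t₂ : s₂.reg 18 = x.n - 1 := by simp [hs₂, hs₁, rootHead, infCode, r₀]
  have m₂ : s₂.mem = s₀.mem := by rw [hs₂, hs₁]; rfl
  clear hs₂ hs₁
  apply Runs.seq
  refine (runs_root ((r₂ 0 (by omega) (by omega) (by omega)).trans r₀) hm hmk hmin hk (by omega) o₂
    t₂).mono le_rfl ?_
  rintro s₃ ⟨o₃, r₃, m₃⟩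
  apply Runs.seq
  refine (runs_paramsCode hp hm hmB (by rw [r₃ 0 (by omega) (by omega), r₂ 0 (by omega) (by omega)
    (by omega), r₀]) (by rw [r₃ 1 (by omega) (by omega), v₂]) o₃).mono le_rfl ?_
  rintro s₄ ⟨env₄, t₄, y₄, r₄, m₄⟩
  apply Runs.seq
  refine (runs_init env₄ hp t₄).mono le_rfl ?_
  rintro s₅ ⟨r₅, m₅, c₅⟩
  have mem₄ : s₄.mem = s₀.mem := by rw [m₄, m₃, m₂]
  have e₅ : s₅.reg 16 = 0 := by
    rw [r₅ 16 (by omega), r₄ 16 (by omega) (by omega), r₃ 16 (by omega) (by omega),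
      r₂ 16 (by omega) (by omega) (by omega), z₀ 16 (by omega)]
  -- For `n = 1` the two powers coincide, but then there is no pair of distinct vertices.
  have hVW : 1 < x.n → x.n ^ c < x.n ^ (c + 1) := fun h => Nat.pow_lt_pow_right h (Nat.lt_succ_self c)
  have w₀ : s₄.mem 0 = rowMajor x.weight := by rw [mem₄]; rfl
  have div_idx : ∀ i j : Fin x.n, ((i : ℕ) * x.n + j) / x.n = i := fun i j => by
    rw [Nat.mul_comm, Nat.mul_add_div hn, Nat.div_eq_of_lt j.2, Nat.add_zero]
  have mod_idx : ∀ i j : Fin x.n, ((i : ℕ) * x.n + j) % x.n = j := fun i j => by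
    rw [Nat.mul_comm, Nat.mul_add_mod, Nat.mod_eq_of_lt j.2]
  have est := APSP.Instance.Estimate.initial (x := x) (V := x.n ^ (c + 1)) (D := s₅.mem 2)
    (nx := s₅.mem 1) hW hVW
    (fun i j => by
      have := (c₅ _ (index_lt i.2 j.2)).1
      change s₅.mem 2 (i * x.n + j) = if ((i : ℕ) * x.n + j) / x.n = (i * x.n + j) % x.n then 0
        else if s₄.mem 0 (i * x.n + j) = 0 then x.n ^ (c + 1) else s₄.mem 0 (i * x.n + j) at this
      rw [this, w₀, rowMajor_index, div_idx, mod_idx]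
      simp only [Fin.ext_iff])
    (fun i j => by
      have := (c₅ _ (index_lt i.2 j.2)).2
      change s₅.mem 1 (i * x.n + j) = if s₄.mem 0 (i * x.n + j) = 0 then x.n
        else (i * x.n + j) % x.n at this
      rw [this, w₀, rowMajor_index, mod_idx])
  refine (runs_rounds hp rfl hP hB₀ (s := s₅) ⟨env₄.congr fun r h => r₅ r (by omega), ?_, est.1,
    est.2⟩ ((r₅ 10 (by omega)).trans y₄) (by rw [e₅, Nat.zero_add]; exact hB)).mono le_rfl ?_
  · intro m y
    rw [m₅ _ (by omega) (by omega), mem₄, e₅]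
    simp [hs₀, APSP.problem]
  · rintro s₆ ⟨est₆, ex₆⟩
    -- Infinity is `n ^ (c + 1)`, which exceeds the weight of every walk with fewer than `n` edges.
    refine est₆.isSolution ex₆ hW fun l hl _ => ?_
    change l * x.n ^ c < x.n ^ (c + 1)
    rw [pow_succ, Nat.mul_comm]
    exact Nat.mul_lt_mul_of_pos_left hl (pow_pos hn c)

theorem Runs.exec {B t : ℕ} {c : Program} {s : State} {Q : State → Prop} (h : Runs B c s t Q)
    (hs : s.Bounded B) (hQ : ∀ s σ, Sim s σ → Q s → Q σ) :
    ∃ s' t', Exec B c s s' t' ∧ t' ≤ t ∧ Q s' := by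
  obtain ⟨s', σ', t', e, l, m, q⟩ := h s ⟨fun _ _ => rfl, rfl⟩ hs
  exact ⟨σ', t', e, l, hQ _ _ m q⟩

end WordRAM

/-! ### Size of the parameters and cost of one block. -/

namespace WordRAM

open Filter Asymptotics

/-- The least positive `m` with `n ≤ m ^ k`, for `k ≠ 0`. -/
noncomputable def ceilRoot (k n : ℕ) : ℕ := sInf {m | 0 < m ∧ n ≤ m ^ k}

section ceilRoot

variable {k n : ℕ}

theorem ceilRoot_spec (hk : k ≠ 0) (hn : 0 < n) :
    0 < ceilRoot k n ∧ n ≤ ceilRoot k n ^ k :=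
  Nat.sInf_mem (s := {m | 0 < m ∧ n ≤ m ^ k}) ⟨n, hn, Nat.le_self_pow hk n⟩

theorem ceilRoot_min {j : ℕ} (hj : 0 < j) (h : j < ceilRoot k n) : j ^ k < n :=
  not_le.1 fun h' => Nat.notMem_of_lt_sInf h ⟨hj, h'⟩

theorem ceilRoot_le (hk : k ≠ 0) (hn : 0 < n) : ceilRoot k n ≤ n :=
  Nat.sInf_le ⟨hn, Nat.le_self_pow hk n⟩

theorem rpow_le_ceilRoot (hk : k ≠ 0) (hn : 0 < n) : (n : ℝ) ^ (1 / k : ℝ) ≤ ceilRoot k n := by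
  have h : (n : ℝ) ≤ (ceilRoot k n : ℝ) ^ k := by exact_mod_cast (ceilRoot_spec hk hn).2
  calc (n : ℝ) ^ (1 / k : ℝ) ≤ ((ceilRoot k n : ℝ) ^ k) ^ (1 / k : ℝ) :=
        Real.rpow_le_rpow (by positivity) h (by positivity)
    _ = ceilRoot k n := by
        rw [one_div]
        exact Real.pow_rpow_inv_natCast (by positivity) hk

theorem ceilRoot_le_rpow (hk : k ≠ 0) (hn : 0 < n) :
    (ceilRoot k n : ℝ) ≤ 2 * (n : ℝ) ^ (1 / k : ℝ) := by
  have hy : 1 ≤ (n : ℝ) ^ (1 / k : ℝ) :=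
    Real.one_le_rpow (by exact_mod_cast hn) (by positivity)
  obtain ⟨m, hm⟩ := Nat.exists_eq_succ_of_ne_zero (ceilRoot_spec hk hn).1.ne'
  rw [hm]
  rcases Nat.eq_zero_or_pos m with rfl | h
  · simp only [Nat.succ_eq_add_one, zero_add, Nat.cast_one]
    linarith
  · have h₁ : m ^ k < n := ceilRoot_min h (by omega)
    have h₂ : (m : ℝ) ≤ (n : ℝ) ^ (1 / k : ℝ) := by
      calc (m : ℝ) = ((m : ℝ) ^ k) ^ (1 / k : ℝ) := by
            rw [one_div]
            exact (Real.pow_rpow_inv_natCast (by positivity) hk).symm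
        _ ≤ (n : ℝ) ^ (1 / k : ℝ) :=
            Real.rpow_le_rpow (by positivity) (by exact_mod_cast h₁.le) (by positivity)
    push_cast
    linarith

end ceilRoot

/-- The parameters for the exponent `a / q`. -/
noncomputable def params (c q a n : ℕ) : Params :=
  reductionParams n c q a (ceilRoot (6 * q) n)

/-- The factor `4` in the base gives `T = 4 * L` and `N = 4 * z` exactly. Then `L + 2 ≤ T` follows
from `0 < L`, and `2 * L + 2 * z ≤ N` from `T ≤ N`. The remaining bounds are crude polynomials in `n
+ 2`. -/
theorem params_fits {c q a n K : ℕ} (ha : 0 < a) (haq : a ≤ q) (hn : 0 < n)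
    (hK : 4 * q + c + 5 ≤ K) : (params c q a n).Fits ((n + 2) ^ K) := by
  have hq : 6 * q ≠ 0 := by omega
  have hm := (ceilRoot_spec hq hn).1
  have hmn := ceilRoot_le hq hn
  unfold params
  set m := ceilRoot (6 * q) n
  set b := n + 2 with hb
  have hb1 : 1 < b := by omega
  have lt : ∀ {e : ℕ}, e < K → b ^ e < b ^ K := fun h => Nat.pow_lt_pow_right hb1 h
  have hTN : (4 * m) ^ a ≤ (4 * m) ^ q := Nat.pow_le_pow_right (by omega) haq
  have h4 : ∀ e, 0 < e → ∃ l, 0 < l ∧ (4 * m) ^ e = 4 * l := by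
    intro e he
    obtain ⟨e, rfl⟩ := Nat.exists_eq_succ_of_ne_zero he.ne'
    exact ⟨(4 * m) ^ e * m, by positivity, by rw [pow_succ]; ring⟩
  obtain ⟨l₁, hl₁, e₁⟩ := h4 a ha
  obtain ⟨l₂, hl₂, e₂⟩ := h4 q (by omega)
  have hNb : (4 * m) ^ q ≤ b ^ (2 * q) := by
    rw [pow_mul]
    refine Nat.pow_le_pow_left ?_ _
    rw [hb]
    nlinarith
  have hl : n / ((4 * m) ^ q / 4) + 1 ≤ b := by
    have := Nat.div_le_self n ((4 * m) ^ q / 4)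
    omega
  have hl' : n / ((4 * m) ^ a / 4) + 1 ≤ b := by
    have := Nat.div_le_self n ((4 * m) ^ a / 4)
    omega
  refine ⟨hn, pow_pos hn _, ?_, ?_, ?_, ?_, hTN, ?_, ?_, ?_, ?_, ?_⟩
  · change 0 < (4 * m) ^ a / 4
    omega
  · change 0 < (4 * m) ^ q / 4
    omega
  · change (4 * m) ^ a / 4 + 2 ≤ (4 * m) ^ a
    omega
  · change 2 * ((4 * m) ^ a / 4) + 2 * ((4 * m) ^ q / 4) ≤ (4 * m) ^ q
    omega
  · refine (Nat.mul_le_mul hNb hNb).trans_lt ?_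
    rw [← pow_add]
    exact lt (by omega)
  · calc n * n ≤ b * b := Nat.mul_le_mul (by omega) (by omega)
      _ = b ^ 2 := (sq b).symm
      _ < b ^ K := lt (by omega)
  · calc n + (4 * m) ^ q + 3 ≤ b ^ (2 * q) + b ^ (2 * q) + b ^ (2 * q) := by
          have : b ≤ b ^ (2 * q) := Nat.le_self_pow (by omega) b
          omega
      _ ≤ b ^ (2 * q) * b := by
          have : 3 ≤ b := by omega
          nlinarith [Nat.zero_le (b ^ (2 * q))]
      _ = b ^ (2 * q + 1) := (pow_succ _ _).symm
      _ < b ^ K := lt (by omega)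
  · calc 12 * n ^ (c + 1) ≤ b ^ 3 * b ^ (c + 1) := by
          refine Nat.mul_le_mul ?_ (Nat.pow_le_pow_left (by omega) _)
          calc 12 ≤ 3 ^ 3 := by norm_num
            _ ≤ b ^ 3 := Nat.pow_le_pow_left (by omega) 3
      _ = b ^ (3 + (c + 1)) := (pow_add _ _ _).symm
      _ < b ^ K := lt (by omega)
  · calc (n / ((4 * m) ^ a / 4) + 1) * ((n / ((4 * m) ^ q / 4) + 1) *
          (n / ((4 * m) ^ q / 4) + 1)) ≤ b * (b * b) :=
          Nat.mul_le_mul hl' (Nat.mul_le_mul hl hl)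
      _ = b ^ 3 := by ring
      _ < b ^ K := lt (by omega)

/-- The left side bounds the number of calls, hence the final stamp, which has to fit into a word.
-/
theorem params_budget {c q a n K : ℕ} (hn : 0 < n) (hK : c + 7 ≤ K) :
    Nat.size n * (Nat.size (n ^ (c + 1)) * (params c q a n).steps) < (n + 2) ^ K := by
  set b := n + 2 with hb
  have size_le : ∀ y, Nat.size y ≤ y := fun y => Nat.size_le.2 Nat.lt_two_pow_self
  have hl : ∀ l, n / l + 1 ≤ b := fun l => by
    have := Nat.div_le_self n l
    omega
  have hblocks : (params c q a n).blocks ≤ b * (b * b) :=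
    Nat.mul_le_mul (hl _) (Nat.mul_le_mul (hl _) (hl _))
  have hsteps : (params c q a n).steps ≤ b ^ 4 := by
    have h₁ : (params c q a n).steps = (params c q a n).blocks + 2 * (n * n) := rfl
    have h₂ : n * n ≤ b * b := Nat.mul_le_mul (by omega) (by omega)
    have h₃ : b * (b * b) * 3 ≤ b * (b * b) * b := Nat.mul_le_mul_left _ (by omega)
    have h₄ : 1 * (b * b) ≤ b * (b * b) := Nat.mul_le_mul_right _ (by omega)
    have h₅ : b ^ 4 = b * (b * b) * b := by ring
    omega
  calc Nat.size n * (Nat.size (n ^ (c + 1)) * (params c q a n).steps)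
      ≤ b * (b ^ (c + 1) * b ^ 4) :=
        Nat.mul_le_mul ((size_le n).trans (by omega)) (Nat.mul_le_mul
          ((size_le _).trans (Nat.pow_le_pow_left (by omega) _)) hsteps)
    _ = b ^ (c + 6) := by ring
    _ < b ^ K := Nat.pow_lt_pow_right (by omega) (by omega)

/-- The filter on `ℕ` that concerns all positive numbers. -/
def positiveNat : Filter ℕ := 𝓟 (Set.Ici 1)

/-- Along a principal filter `IsBigO` means one constant for all `n ≥ 1`, which is the uniformity
that `SolvableInTime` asks for. -/
theorem isBigO_of_le {f g : ℕ → ℝ} (c : ℝ) (h : ∀ n, 0 < n → 0 ≤ f n ∧ f n ≤ c * g n)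
    (hg : ∀ n, 0 < n → 0 ≤ g n) : f =O[positiveNat] g := by
  refine isBigO_principal.2 ⟨c, fun n hn => ?_⟩
  rw [Real.norm_of_nonneg (h n hn).1, Real.norm_of_nonneg (hg n hn)]
  exact (h n hn).2

/-- The base of the powers that the number of states and the length of the path are. -/
noncomputable def base (q n : ℕ) : ℝ := 4 * ceilRoot (6 * q) n

section asymptotics

variable {q a c n : ℕ} {ε : ℝ}

theorem le_base (hq : 0 < q) (hn : 0 < n) : (n : ℝ) ^ (1 / (6 * q : ℕ) : ℝ) ≤ base q n := by
  have h₁ := rpow_le_ceilRoot (k := 6 * q) (by omega) hn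
  have h₂ : (0 : ℝ) ≤ ceilRoot (6 * q) n := by positivity
  rw [base]
  linarith

theorem base_le (hq : 0 < q) (hn : 0 < n) : base q n ≤ 8 * (n : ℝ) ^ (1 / (6 * q : ℕ) : ℝ) := by
  have h₁ := ceilRoot_le_rpow (k := 6 * q) (by omega) hn
  rw [base]
  linarith

theorem one_le_base (hq : 0 < q) (hn : 0 < n) : 1 ≤ base q n :=
  (Real.one_le_rpow (by exact_mod_cast hn) (by positivity)).trans (le_base hq hn)

theorem rpow_root_pow (e : ℕ) :
    ((n : ℝ) ^ (1 / (6 * q : ℕ) : ℝ)) ^ e = (n : ℝ) ^ (e / (6 * q : ℕ) : ℝ) := by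
  rw [← Real.rpow_natCast, ← Real.rpow_mul (by positivity)]
  congr 1
  ring

theorem base_pow_le (hq : 0 < q) (hn : 0 < n) {e : ℕ} (he : e ≤ 6 * q) :
    base q n ^ e ≤ 8 ^ e * n := by
  have h1 : (1 : ℝ) ≤ n := by exact_mod_cast hn
  calc base q n ^ e ≤ (8 * (n : ℝ) ^ (1 / (6 * q : ℕ) : ℝ)) ^ e :=
        pow_le_pow_left₀ (zero_le_one.trans (one_le_base hq hn)) (base_le hq hn) e
    _ = 8 ^ e * (n : ℝ) ^ (e / (6 * q : ℕ) : ℝ) := by rw [mul_pow, rpow_root_pow]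
    _ ≤ 8 ^ e * (n : ℝ) ^ (1 : ℝ) := by
        refine mul_le_mul_of_nonneg_left (Real.rpow_le_rpow_of_exponent_le h1 ?_) (by positivity)
        rw [div_le_one (by positivity)]
        exact_mod_cast he
    _ = 8 ^ e * n := by rw [Real.rpow_one]

/-- Since `base q n ^ e = O(n)` for `e ≤ 6 * q`, the extra interval is absorbed into the constant.
-/
theorem div_add_one_le (hq : 0 < q) (hn : 0 < n) {e : ℕ} (he₀ : 0 < e) (he : e ≤ 6 * q) :
    ((n / ((4 * ceilRoot (6 * q) n) ^ e / 4) + 1 : ℕ) : ℝ) ≤ (4 + 8 ^ e) * n / base q n ^ e := by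
  have hb := one_le_base hq hn
  have hpos : 0 < base q n ^ e := pow_pos (by linarith) e
  obtain ⟨e, rfl⟩ := Nat.exists_eq_succ_of_ne_zero he₀.ne'
  set m := ceilRoot (6 * q) n with hm
  have hm0 : 0 < m := (ceilRoot_spec (by omega) hn).1
  have h4 : (4 * m) ^ (e + 1) / 4 = (4 * m) ^ e * m := by
    rw [pow_succ, show (4 * m) ^ e * (4 * m) = 4 * ((4 * m) ^ e * m) by ring]
    exact Nat.mul_div_cancel_left _ (by norm_num)
  have hbe : base q n ^ (e + 1) = 4 * (((4 * m) ^ e * m : ℕ) : ℝ) := by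
    rw [base, ← hm]
    push_cast
    ring
  have hl0 : (0 : ℝ) < ((4 * m) ^ e * m : ℕ) := by
    have : 0 < (4 * m) ^ e * m := by positivity
    exact_mod_cast this
  rw [Nat.succ_eq_add_one, h4]
  have h₁ : ((n / ((4 * m) ^ e * m) : ℕ) : ℝ) ≤ 4 * n / base q n ^ (e + 1) := by
    rw [hbe, mul_div_mul_left _ _ (by norm_num)]
    exact Nat.cast_div_le
  have h₂ : 1 ≤ 8 ^ (e + 1) * n / base q n ^ (e + 1) := by
    rw [le_div_iff₀ hpos, one_mul]
    exact base_pow_le hq hn he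
  rw [add_mul, add_div]
  push_cast at h₁ ⊢
  linarith

theorem blocks_isBigO (hq : 0 < q) (ha : 0 < a) (haq : a ≤ q) :
    (fun n => ((params c q a n).blocks : ℝ)) =O[positiveNat]
      fun n => (n : ℝ) ^ 3 / base q n ^ (a + 2 * q) := by
  refine isBigO_of_le ((4 + 8 ^ a) * ((4 + 8 ^ q) * (4 + 8 ^ q))) (fun n hn => ⟨by positivity, ?_⟩)
    fun n hn => ?_
  · have h₁ := div_add_one_le hq hn ha (by omega)
    have h₂ := div_add_one_le hq hn hq (by omega)
    have hb := one_le_base hq hn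
    have hpos : 0 < base q n := by linarith
    calc ((params c q a n).blocks : ℝ)
        = ((n / ((4 * ceilRoot (6 * q) n) ^ a / 4) + 1 : ℕ) : ℝ) *
          (((n / ((4 * ceilRoot (6 * q) n) ^ q / 4) + 1 : ℕ) : ℝ) *
          ((n / ((4 * ceilRoot (6 * q) n) ^ q / 4) + 1 : ℕ) : ℝ)) := by
          rw [← Nat.cast_mul, ← Nat.cast_mul]
          rfl
      _ ≤ ((4 + 8 ^ a) * n / base q n ^ a) * (((4 + 8 ^ q) * n / base q n ^ q) *
          ((4 + 8 ^ q) * n / base q n ^ q)) := by gcongr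
      _ = _ := by
          rw [pow_add, two_mul, pow_add]
          field_simp
  · have := one_le_base hq hn
    positivity

theorem isBigO_one (hε : 0 ≤ ε) : (fun _ => (1 : ℝ)) =O[positiveNat] fun n : ℕ => (n : ℝ) ^ ε :=
  isBigO_of_le 1 (fun n hn => ⟨zero_le_one, by
    rw [one_mul]
    exact Real.one_le_rpow (by exact_mod_cast hn) hε⟩) fun n _ => by positivity

theorem isBigO_rpow {ε δ : ℝ} (h : ε ≤ δ) :
    (fun n : ℕ => (n : ℝ) ^ ε) =O[positiveNat] fun n : ℕ => (n : ℝ) ^ δ :=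
  isBigO_of_le 1 (fun n hn => ⟨by positivity, by
    rw [one_mul]
    exact Real.rpow_le_rpow_of_exponent_le (by exact_mod_cast hn) h⟩) fun n _ => by positivity

theorem isBigO_base (hq : 0 < q) {δ : ℝ} (hδ : 0 ≤ δ) :
    (fun _ => (1 : ℝ)) =O[positiveNat] fun n => base q n ^ δ :=
  isBigO_of_le 1 (fun n hn => ⟨zero_le_one, by
    rw [one_mul]
    exact Real.one_le_rpow (one_le_base hq hn) hδ⟩) fun n hn => by
      have := one_le_base hq hn
      positivity

/-- The time bound for the Viterbi instances. -/
noncomputable def callTime (C ε : ℝ) (c q a n : ℕ) : ℕ :=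
  ⌊|C| * (((params c q a n).T : ℝ) * ((params c q a n).N : ℝ) ^ 2) ^ (1 - ε)⌋₊

theorem cast_T : ((params c q a n).T : ℝ) = base q n ^ a := by
  rw [base]
  exact_mod_cast rfl

theorem cast_N : ((params c q a n).N : ℝ) = base q n ^ q := by
  rw [base]
  exact_mod_cast rfl

theorem callTime_isBigO (C : ℝ) (hq : 0 < q) (ha : 0 < a) (hε : 0 ≤ ε) :
    (fun n => (callTime C ε c q a n : ℝ)) =O[positiveNat]
      fun n => base q n ^ ((a + 2 * q : ℕ) - ε : ℝ) := by
  refine isBigO_of_le |C| (fun n hn => ⟨by positivity, ?_⟩) fun n hn => ?_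
  · have hb := one_le_base hq hn
    refine (Nat.floor_le (by positivity)).trans (mul_le_mul_of_nonneg_left ?_ (abs_nonneg C))
    rw [cast_T, cast_N, ← pow_mul, ← pow_add, Nat.mul_comm q 2, ← Real.rpow_natCast,
      ← Real.rpow_mul (by linarith)]
    refine Real.rpow_le_rpow_of_exponent_le hb ?_
    have : (1 : ℝ) ≤ (a + 2 * q : ℕ) := by exact_mod_cast (by omega : 1 ≤ a + 2 * q)
    nlinarith
  · have := one_le_base hq hn
    positivity

/-- Writing the `N²` costs and scanning the `T` steps do not exceed the bound for the call, because
`ε ≤ 1` while `a` and `2 * q` are at least `1`. -/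
theorem blockTime_isBigO (C : ℝ) (P : Program) (hq : 0 < q) (ha : 0 < a) (hε : 0 ≤ ε)
    (hε₁ : ε ≤ 1) :
    (fun n => (blockTime (params c q a n) P (callTime C ε c q a n) : ℝ)) =O[positiveNat]
      fun n => base q n ^ ((a + 2 * q : ℕ) - ε : ℝ) := by
  have ha1 : (1 : ℝ) ≤ a := by exact_mod_cast ha
  have hδ : (0 : ℝ) ≤ (a + 2 * q : ℕ) - ε := by
    push_cast
    have : (0 : ℝ) ≤ q := by positivity
    linarith
  have hc := callTime_isBigO (c := c) C hq ha hε
  have h1 := isBigO_base hq hδ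
  have hk : ∀ y : ℝ, (fun _ : ℕ => y) =O[positiveNat]
      fun n => base q n ^ ((a + 2 * q : ℕ) - ε : ℝ) := fun y => by
    simpa using h1.const_mul_left y
  have hpow : ∀ e : ℕ, e + 1 ≤ a + 2 * q → (fun n => base q n ^ e) =O[positiveNat]
      fun n => base q n ^ ((a + 2 * q : ℕ) - ε : ℝ) := by
    intro e he
    refine isBigO_of_le 1 (fun n hn => ?_) fun n hn => ?_
    · have hb := one_le_base hq hn
      refine ⟨by positivity, ?_⟩
      rw [one_mul, ← Real.rpow_natCast]
      refine Real.rpow_le_rpow_of_exponent_le hb ?_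
      have : (e : ℝ) + 1 ≤ (a + 2 * q : ℕ) := by exact_mod_cast he
      linarith
    · have := one_le_base hq hn
      positivity
  have hNN : (fun n => ((params c q a n).N : ℝ) * (params c q a n).N) =O[positiveNat]
      fun n => base q n ^ ((a + 2 * q : ℕ) - ε : ℝ) := by
    simp_rw [cast_N, ← pow_add]
    exact hpow _ (by omega)
  have hT : (fun n => (((params c q a n).T - 1 : ℕ) : ℝ)) =O[positiveNat]
      fun n => base q n ^ ((a + 2 * q : ℕ) - ε : ℝ) := by
    refine IsBigO.trans (isBigO_of_le 1 (fun n _ => ⟨by positivity, ?_⟩) fun n hn => ?_)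
      (hpow a (by omega))
    · rw [one_mul, ← cast_T (c := c)]
      exact_mod_cast Nat.sub_le _ _
    · have := one_le_base hq hn
      positivity
  have e : (fun n => (blockTime (params c q a n) P (callTime C ε c q a n) : ℝ)) = fun n =>
      (blockHead.time : ℝ) + ((((setupBody.time : ℝ) + 1) * (((params c q a n).N : ℝ) *
      (params c q a n).N) + 1) + (((P.regBound : ℝ) + 7 + 4 * (callTime C ε c q a n)) +
      ((scanHead.time : ℝ) + ((((scanBody.time : ℝ) + 1) * (((params c q a n).T - 1 : ℕ) : ℝ) + 1) +
        (blockTail.time : ℝ))))) := by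
    funext n
    rw [blockTime]
    push_cast
    ring
  rw [e]
  exact (hk _).add (((hNN.const_mul_left _).add (hk _)).add (((hk _).add (hc.const_mul_left _)).add
    ((hk _).add (((hT.const_mul_left _).add (hk _)).add (hk _)))))

end asymptotics

end WordRAM

/-! ### The reduction takes subcubic time. -/

namespace WordRAM

open Filter Asymptotics

section asymptotics

variable {q a c : ℕ} {ε : ℝ}

theorem size_isBigO {η : ℝ} (hη : 0 < η) :
    (fun n : ℕ => (Nat.size n : ℝ)) =O[positiveNat] fun n : ℕ => (n : ℝ) ^ η := by
  have hl : 0 < Real.log 2 := Real.log_pos (by norm_num)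
  refine isBigO_of_le (1 + 1 / (η * Real.log 2)) (fun n hn => ⟨by positivity, ?_⟩)
    fun n _ => by positivity
  have h1 : (1 : ℝ) ≤ (n : ℝ) ^ η := Real.one_le_rpow (by exact_mod_cast hn) hη.le
  obtain ⟨l, hl'⟩ := Nat.exists_eq_succ_of_ne_zero (Nat.size_pos.2 hn).ne'
  have h₁ : 2 ^ l ≤ n := Nat.lt_size.1 (by omega)
  have h₂ : (l : ℝ) * Real.log 2 ≤ (n : ℝ) ^ η / η := by
    rw [← Real.log_pow]
    refine (Real.log_le_log (by positivity) ?_).trans (Real.log_le_rpow_div (by positivity) hη)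
    exact_mod_cast h₁
  have h₃ : (l : ℝ) ≤ 1 / (η * Real.log 2) * (n : ℝ) ^ η := by
    rw [div_mul_eq_mul_div, one_mul, mul_comm η, ← div_div, div_right_comm, le_div_iff₀ hl]
    exact h₂
  rw [hl', Nat.cast_succ, add_mul, one_mul]
  linarith

theorem size_pow_le (n e : ℕ) : Nat.size (n ^ e) ≤ e * Nat.size n + 1 := by
  rw [Nat.size_le]
  calc n ^ e ≤ (2 ^ Nat.size n) ^ e := Nat.pow_le_pow_left (Nat.lt_size_self n).le e
    _ = 2 ^ (e * Nat.size n) := by rw [← pow_mul, Nat.mul_comm]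
    _ < 2 ^ (e * Nat.size n + 1) := Nat.pow_lt_pow_right (by norm_num) (Nat.lt_succ_self _)

/-- The exponent of the time that is spent on the blocks of one phase. -/
noncomputable def phaseExponent (ε : ℝ) (q : ℕ) : ℝ := 3 - ε / (6 * q : ℕ)

theorem phaseExponent_ge (hq : 0 < q) (hε : ε ≤ 1) : 5 / 2 ≤ phaseExponent ε q := by
  have hq1 : (1 : ℝ) ≤ q := by exact_mod_cast hq
  have : ε / (6 * q : ℕ) ≤ 1 / 2 := by
    push_cast
    rw [div_le_div_iff₀ (by positivity) (by norm_num)]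
    linarith
  rw [phaseExponent]
  linarith

/-- The searches of all blocks: the number of blocks cancels the cubic part of the call, and the
saving `base q n ^ ε` is at least `n ^ (ε / (6 * q))`. -/
theorem blocks_mul_isBigO (hq : 0 < q) (hε : 0 ≤ ε) :
    (fun n : ℕ => (n : ℝ) ^ 3 / base q n ^ (a + 2 * q) * base q n ^ ((a + 2 * q : ℕ) - ε : ℝ))
      =O[positiveNat] fun n : ℕ => (n : ℝ) ^ phaseExponent ε q := by
  refine isBigO_of_le 1 (fun n hn => ?_) fun n _ => by positivity
  have hb := one_le_base hq hn
  have hpos : 0 < base q n := by linarith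
  have hn0 : (0 : ℝ) < n := by exact_mod_cast hn
  refine ⟨by positivity, ?_⟩
  rw [one_mul, Real.rpow_sub hpos, Real.rpow_natCast, div_mul_div_cancel₀ (by positivity),
    phaseExponent, Real.rpow_sub hn0]
  rw [show (3 : ℝ) = ((3 : ℕ) : ℝ) by norm_num, Real.rpow_natCast]
  refine div_le_div_of_nonneg_left (by positivity) (by positivity) ?_
  calc (n : ℝ) ^ (ε / (6 * q : ℕ)) = ((n : ℝ) ^ (1 / (6 * q : ℕ) : ℝ)) ^ ε := by
        rw [← Real.rpow_mul hn0.le]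
        congr 1
        ring
    _ ≤ base q n ^ ε := Real.rpow_le_rpow (by positivity) (le_base hq hn) hε

/-- The successful searches: as `a ≤ q`, a call costs at most `base q n ^ (3 * q) = O(n ^ (1 / 2))`.
The `6` in the root is chosen for this. -/
theorem sq_mul_isBigO (hq : 0 < q) (haq : a ≤ q) (hε : 0 ≤ ε) (hε₁ : ε ≤ 1) :
    (fun n : ℕ => (n : ℝ) ^ 2 * base q n ^ ((a + 2 * q : ℕ) - ε : ℝ))
      =O[positiveNat] fun n : ℕ => (n : ℝ) ^ phaseExponent ε q := by
  refine isBigO_of_le (8 ^ (3 * q)) (fun n hn => ?_) fun n _ => by positivity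
  have hb := one_le_base hq hn
  have hpos : 0 < base q n := by linarith
  have hn0 : (0 : ℝ) < n := by exact_mod_cast hn
  have hn1 : (1 : ℝ) ≤ n := by exact_mod_cast hn
  have hq0 : (q : ℝ) ≠ 0 := by positivity
  refine ⟨by positivity, ?_⟩
  calc (n : ℝ) ^ 2 * base q n ^ ((a + 2 * q : ℕ) - ε : ℝ)
      ≤ (n : ℝ) ^ 2 * base q n ^ ((3 * q : ℕ) : ℝ) := by
        refine mul_le_mul_of_nonneg_left (Real.rpow_le_rpow_of_exponent_le hb ?_) (by positivity)
        have : ((a + 2 * q : ℕ) : ℝ) ≤ (3 * q : ℕ) := by exact_mod_cast (by omega)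
        linarith
    _ ≤ (n : ℝ) ^ 2 * (8 * (n : ℝ) ^ (1 / (6 * q : ℕ) : ℝ)) ^ (3 * q) := by
        rw [Real.rpow_natCast]
        exact mul_le_mul_of_nonneg_left (pow_le_pow_left₀ hpos.le (base_le hq hn) _)
          (by positivity)
    _ = 8 ^ (3 * q) * (n : ℝ) ^ (5 / 2 : ℝ) := by
        rw [mul_pow, rpow_root_pow, show ((3 * q : ℕ) : ℝ) / (6 * q : ℕ) = 1 / 2 by
          push_cast
          field_simp
          norm_num, show (5 / 2 : ℝ) = (2 : ℕ) + 1 / 2 by norm_num, Real.rpow_add hn0,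
          Real.rpow_natCast]
        ring
    _ ≤ 8 ^ (3 * q) * (n : ℝ) ^ phaseExponent ε q :=
        mul_le_mul_of_nonneg_left (Real.rpow_le_rpow_of_exponent_le hn1
          (phaseExponent_ge hq hε₁)) (by positivity)

theorem isBigO_pow {e : ℕ} (he : e ≤ 2) (hq : 0 < q) (hε₁ : ε ≤ 1) :
    (fun n : ℕ => (n : ℝ) ^ e) =O[positiveNat] fun n : ℕ => (n : ℝ) ^ phaseExponent ε q := by
  have h : ((e : ℕ) : ℝ) ≤ phaseExponent ε q := by
    have h₁ : (e : ℝ) ≤ 2 := by exact_mod_cast he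
    have h₂ := phaseExponent_ge hq hε₁
    linarith
  simpa using isBigO_rpow h

theorem phaseTime_isBigO (C : ℝ) (P : Program) (hq : 0 < q) (ha : 0 < a) (haq : a ≤ q)
    (hε : 0 ≤ ε) (hε₁ : ε ≤ 1) :
    (fun n => (phaseTime (params c q a n) P (callTime C ε c q a n) : ℝ)) =O[positiveNat]
      fun n : ℕ => (n : ℝ) ^ phaseExponent ε q := by
  have h1 : ∀ y : ℝ, (fun _ : ℕ => y) =O[positiveNat]
      fun n : ℕ => (n : ℝ) ^ phaseExponent ε q := fun y => by
    simpa using (isBigO_pow (e := 0) (by omega) hq hε₁).const_mul_left y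
  have hδ : (0 : ℝ) ≤ (a + 2 * q : ℕ) - ε := by
    have : (1 : ℝ) ≤ (a + 2 * q : ℕ) := by exact_mod_cast (by omega : 1 ≤ a + 2 * q)
    linarith
  have hb := (blockTime_isBigO (c := c) C P hq ha hε hε₁).add (isBigO_base hq hδ)
  have hbl := ((blocks_isBigO (c := c) hq ha haq).mul hb).trans (blocks_mul_isBigO hq hε)
  have hsq := ((isBigO_refl (fun n : ℕ => (n : ℝ) ^ 2) positiveNat).mul hb).trans
    (sq_mul_isBigO hq haq hε hε₁)
  have e : (fun n => (phaseTime (params c q a n) P (callTime C ε c q a n) : ℝ)) = fun n =>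
      (phaseHead.time : ℝ) + (((((params c q a n).blocks : ℝ) *
        ((blockTime (params c q a n) P (callTime C ε c q a n) : ℝ) + 1) +
        2 * ((n : ℝ) ^ 2 * ((blockTime (params c q a n) P (callTime C ε c q a n) : ℝ) + 1))) + 1) +
        (phaseTail.time : ℝ)) := by
    funext n
    have hs : (params c q a n).steps = (params c q a n).blocks + 2 * (n * n) := rfl
    rw [phaseTime, hs]
    push_cast
    ring
  rw [e]
  exact (h1 _).add (((hbl.add (hsq.const_mul_left 2)).add (h1 _)).add (h1 _))

theorem roundTime_isBigO (C : ℝ) (P : Program) (hq : 0 < q) (ha : 0 < a) (haq : a ≤ q)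
    (hε : 0 ≤ ε) (hε₁ : ε ≤ 1) {η : ℝ} (hη : 0 < η) :
    (fun n => (roundTime (params c q a n) P (callTime C ε c q a n) : ℝ)) =O[positiveNat]
      fun n : ℕ => (n : ℝ) ^ η * (n : ℝ) ^ phaseExponent ε q := by
  have h1 : ∀ y : ℝ, (fun _ : ℕ => y) =O[positiveNat]
      fun n : ℕ => (n : ℝ) ^ phaseExponent ε q := fun y => by
    simpa using (isBigO_pow (e := 0) (by omega) hq hε₁).const_mul_left y
  have up : ∀ {f : ℕ → ℝ}, (f =O[positiveNat] fun n : ℕ => (n : ℝ) ^ phaseExponent ε q) →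
      f =O[positiveNat] fun n : ℕ => (n : ℝ) ^ η * (n : ℝ) ^ phaseExponent ε q := fun h => by
    simpa using (isBigO_one hη.le).mul h
  have hsize : (fun n : ℕ => (Nat.size (n ^ (c + 1)) : ℝ)) =O[positiveNat]
      fun n : ℕ => (n : ℝ) ^ η := by
    refine IsBigO.trans (isBigO_of_le 1 (g := fun n : ℕ => ((c + 1 : ℕ) : ℝ) * Nat.size n + 1)
      (fun n _ => ⟨by positivity, ?_⟩) fun n _ => by positivity)
      (((size_isBigO hη).const_mul_left _).add (isBigO_one hη.le))
    rw [one_mul]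
    exact_mod_cast size_pow_le n (c + 1)
  have hmain := hsize.mul ((phaseTime_isBigO (c := c) C P hq ha haq hε hε₁).add (h1 1))
  have e : (fun n => (roundTime (params c q a n) P (callTime C ε c q a n) : ℝ)) = fun n : ℕ =>
      (copyHead.time : ℝ) + ((((copyBody.time : ℝ) + 1) * (n : ℝ) ^ 2 + 1) + ((roundMid.time : ℝ) +
        (((Nat.size (n ^ (c + 1)) : ℝ) *
          ((phaseTime (params c q a n) P (callTime C ε c q a n) : ℝ) + 1) + 1) +
          (roundTail.time : ℝ)))) := by
    funext n
    have hn : (params c q a n).n = n := rfl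
    have hV : (params c q a n).V = n ^ (c + 1) := rfl
    rw [roundTime, hn, hV]
    push_cast
    ring
  rw [e]
  exact (up (h1 _)).add ((up (((isBigO_pow le_rfl hq hε₁).const_mul_left _).add (h1 _))).add
    ((up (h1 _)).add ((hmain.add (up (h1 _))).add (up (h1 _)))))

/-- With the calls of a subcubic program for the Viterbi path problem, the reduction takes subcubic
time. -/
theorem reductionTime_isBigO (C : ℝ) (P : Program) (hq : 0 < q) (ha : 0 < a) (haq : a ≤ q)
    (hε : 0 < ε) (hε₁ : ε ≤ 1) :
    (fun n => (reductionTime (params c q a n) P c (6 * q) q a (ceilRoot (6 * q) n)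
      (callTime C ε c q a n) : ℝ)) =O[positiveNat]
      fun n : ℕ => ((n : ℝ) ^ 3) ^ (1 - ε / (36 * q)) := by
  have hq0 : (0 : ℝ) < q := by exact_mod_cast hq
  -- Half of the saving `ε / (6 * q)` is given up for the two logarithmic factors, the numbers of
  -- rounds and of phases.
  obtain ⟨η, hη, hη'⟩ : ∃ η : ℝ, 0 < η ∧ η + (η + phaseExponent ε q) = 3 * (1 - ε / (36 * q)) := by
    refine ⟨ε / (24 * q), by positivity, ?_⟩
    rw [phaseExponent]
    push_cast
    field_simp
    ring
  have h1 : ∀ y : ℝ, (fun _ : ℕ => y) =O[positiveNat]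
      fun n : ℕ => (n : ℝ) ^ phaseExponent ε q := fun y => by
    simpa using (isBigO_pow (e := 0) (by omega) hq hε₁).const_mul_left y
  have up : ∀ {f : ℕ → ℝ}, (f =O[positiveNat] fun n : ℕ => (n : ℝ) ^ phaseExponent ε q) →
      f =O[positiveNat] fun n : ℕ => (n : ℝ) ^ η * ((n : ℝ) ^ η * (n : ℝ) ^ phaseExponent ε q) :=
    fun h => by simpa using (isBigO_one hη.le).mul ((isBigO_one hη.le).mul h)
  have hroot : (fun n : ℕ => (ceilRoot (6 * q) n : ℝ)) =O[positiveNat]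
      fun n : ℕ => (n : ℝ) ^ phaseExponent ε q := by
    refine IsBigO.trans (isBigO_of_le 1 (fun n hn => ⟨by positivity, ?_⟩)
      fun n _ => by positivity) (isBigO_pow (e := 1) (by omega) hq hε₁)
    rw [one_mul, pow_one]
    exact_mod_cast ceilRoot_le (by omega) hn
  have hround := (roundTime_isBigO (c := c) C P hq ha haq hε.le hε₁ hη).add
    (by simpa using (isBigO_one hη.le).mul (h1 1))
  have hmain := (size_isBigO hη).mul hround
  have e : (fun n => (reductionTime (params c q a n) P c (6 * q) q a (ceilRoot (6 * q) n)
      (callTime C ε c q a n) : ℝ)) = fun n : ℕ =>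
      ((infCode c).time : ℝ) + ((rootHead.time : ℝ) + (((((rootBody (6 * q)).time : ℝ) + 1) *
        (ceilRoot (6 * q) n : ℝ) + 1) + (((paramsCode q a).time : ℝ) +
        ((((initBody.time : ℝ) + 1) * (n : ℝ) ^ 2 + 1) + ((Nat.size n : ℝ) *
          ((roundTime (params c q a n) P (callTime C ε c q a n) : ℝ) + 1) + 1))))) := by
    funext n
    have hn : (params c q a n).n = n := rfl
    rw [reductionTime, hn]
    push_cast
    ring
  rw [e]
  refine ((up (h1 _)).add ((up (h1 _)).add ((up ((hroot.const_mul_left _).add (h1 _))).add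
    ((up (h1 _)).add ((up (((isBigO_pow le_rfl hq hε₁).const_mul_left _).add (h1 _))).add
      (hmain.add (up (h1 _)))))))).trans ?_
  refine isBigO_of_le 1 (fun n hn => ⟨by positivity, le_of_eq ?_⟩) fun n _ => by positivity
  have hn0 : (0 : ℝ) < n := by exact_mod_cast hn
  rw [one_mul, ← Real.rpow_add hn0, ← Real.rpow_add hn0, hη', Real.rpow_mul hn0.le]
  norm_cast

end asymptotics

end WordRAM

/-! ### Transfer of the lower bound. -/

namespace WordRAM

theorem SearchProblem.RequiresTime.mono {Q : SearchProblem} {D D' : Q.Inst → Prop} {f : Q.Inst → ℝ}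
    (h : Q.RequiresTime D f) (hD : ∀ x, D x → D' x) : Q.RequiresTime D' f := fun ε hε => by
  obtain ⟨c, hc⟩ := h ε hε
  exact ⟨c, fun ⟨P, κ, C, hP⟩ => hc ⟨P, κ, C, fun x hx => hP x ⟨hD x hx.1, hx.2⟩⟩⟩

/-- The length of the path is the prescribed power of the number of states. -/
theorem params_T {c q a n : ℕ} (hq : 0 < q) :
    (params c q a n).T = ⌊((params c q a n).N : ℝ) ^ (a / q : ℝ)⌋₊ := by
  have hq0 : (q : ℝ) ≠ 0 := by positivity
  have hb : (0 : ℝ) ≤ base q n := by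
    rw [base]
    positivity
  rw [cast_N, ← Real.rpow_natCast, ← Real.rpow_mul hb, mul_div_cancel₀ _ hq0, Real.rpow_natCast,
    ← cast_T (c := c), Nat.floor_natCast]

/-- Polynomial bounds in `n` thereby become polynomial bounds in `N`, the size parameter of the
Viterbi instances. -/
theorem params_N_ge {c q a n : ℕ} (hq : 0 < q) (hn : 0 < n) :
    4 ≤ (params c q a n).N ∧ n ≤ (params c q a n).N ^ 6 := by
  obtain ⟨hm, hmn⟩ := ceilRoot_spec (k := 6 * q) (by omega) hn
  have hN : (params c q a n).N = (4 * ceilRoot (6 * q) n) ^ q := rfl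
  rw [hN]
  constructor
  · calc 4 ≤ 4 * ceilRoot (6 * q) n := by omega
      _ ≤ _ := Nat.le_self_pow (by omega) _
  · rw [← pow_mul, Nat.mul_comm q 6]
    exact hmn.trans (Nat.pow_le_pow_left (by omega) _)

theorem params_N_add_two_le {c q a n : ℕ} (hq : 0 < q) (hn : 0 < n) :
    (params c q a n).N + 2 ≤ (n + 2) ^ (2 * q + 1) := by
  have hmn := ceilRoot_le (k := 6 * q) (by omega) hn
  have hN : (params c q a n).N ≤ (n + 2) ^ (2 * q) := by
    change (4 * ceilRoot (6 * q) n) ^ q ≤ _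
    rw [pow_mul]
    refine Nat.pow_le_pow_left ?_ _
    nlinarith
  have h1 : 1 ≤ (n + 2) ^ (2 * q) := Nat.one_le_pow _ _ (by omega)
  have h3 : (n + 2) ^ (2 * q) * 3 ≤ (n + 2) ^ (2 * q) * (n + 2) := Nat.mul_le_mul_left _ (by omega)
  rw [pow_succ]
  omega

/-- The entries are at most `12 * V`, where `12 ≤ N ^ 2` and `V = n ^ (c + 1) ≤ N ^ (6 * (c + 1))`;
this explains the exponent. Replacing `ε` by `min ε 1` weakens the time bound, since `T * N ^ 2 ≥
1`. -/
theorem params_solves {c q a n κ : ℕ} {C ε : ℝ} {P : Program} (hq : 0 < q) (hn : 0 < n)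
    (hP : ∀ x : Viterbi.Instance, (x.σ = 1 ∧ x.T = ⌊(x.n : ℝ) ^ (a / q : ℝ)⌋₊) ∧
      Viterbi.problem.EntriesLE x (x.n ^ (2 + 6 * (c + 1))) → ∃ s t,
        Exec ((x.n + 2) ^ κ) P (Viterbi.problem.input x) s t ∧
          (t : ℝ) ≤ C * ((x.T : ℝ) * (x.n : ℝ) ^ 2) ^ (1 - ε) ∧ Viterbi.problem.Correct x s)
    (hN : 0 < (params c q a n).N) :
    (params c q a n).Solves hN P (((params c q a n).N + 2) ^ κ) (callTime C (min ε 1) c q a n) := by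
  intro w hw
  obtain ⟨h4, h6⟩ := params_N_ge (c := c) (a := a) hq hn
  have hV : 12 * (params c q a n).V ≤ (params c q a n).N ^ (2 + 6 * (c + 1)) := by
    rw [pow_add, pow_mul]
    refine Nat.mul_le_mul ?_ (Nat.pow_le_pow_left h6 _)
    calc 12 ≤ 4 ^ 2 := by norm_num
      _ ≤ _ := Nat.pow_le_pow_left h4 2
  obtain ⟨s, t, ex, ht, hs⟩ := hP ((params c q a n).instance hN w)
    ⟨⟨rfl, params_T (c := c) hq⟩, fun u v => (hw u v).trans hV, fun _ _ => Nat.zero_le _⟩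
  refine ⟨s, t, ex, Nat.le_floor (ht.trans ?_), hs⟩
  have h1 : 1 ≤ ((params c q a n).T : ℝ) * ((params c q a n).N : ℝ) ^ 2 := by
    rw [cast_T, cast_N]
    exact one_le_mul_of_one_le_of_one_le (one_le_pow₀ (one_le_base hq hn))
      (one_le_pow₀ (one_le_pow₀ (one_le_base hq hn)))
  refine mul_le_mul (le_abs_self C) (Real.rpow_le_rpow_of_exponent_le h1 ?_)
    (Real.rpow_nonneg (zero_le_one.trans h1) _) (abs_nonneg C)
  exact sub_le_sub_left (min_le_left ε 1) 1

theorem apsp_input_bounded {B c : ℕ} {x : APSP.Instance} (hW : ∀ u v, x.weight u v ≤ x.n ^ c)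
    (hn : x.n < B) (hc : x.n ^ c < B) : (APSP.problem.input x).Bounded B := by
  have h0 : 0 < B := by omega
  refine ⟨fun r => ?_, fun m i => ?_⟩
  · change (if r = 0 then x.n else 0) < B
    split_ifs <;> assumption
  · change (if m = 0 then rowMajor x.weight else fun _ => 0) i < B
    split_ifs
    · rw [rowMajor]
      split_ifs
      exacts [(hW _ _).trans_lt hc, h0]
    · exact h0

/-- The hardness of the Viterbi path problem for paths of length `⌊n ^ (a / q)⌋`. -/
theorem viterbi_requiresTime (hAPSP : APSP.Conjecture) {a q : ℕ} (ha : 0 < a) (haq : a ≤ q) :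
    Viterbi.problem.RequiresTime
      (fun x : Viterbi.Instance => x.σ = 1 ∧ x.T = ⌊(x.n : ℝ) ^ (a / q : ℝ)⌋₊)
      (fun x : Viterbi.Instance => (x.T : ℝ) * (x.n : ℝ) ^ 2) := by
  intro ε hε
  have hq : 0 < q := by omega
  have hε' : 0 < min ε 1 := lt_min hε one_pos
  obtain ⟨c, hc⟩ := hAPSP (min ε 1 / (36 * q)) (by positivity)
  refine ⟨2 + 6 * (c + 1), fun ⟨P, κ, C, hP⟩ => hc ?_⟩
  obtain ⟨C', hC'⟩ := Asymptotics.isBigO_principal.1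
    (reductionTime_isBigO (c := c) C P hq ha haq hε' (min_le_right ε 1))
  -- The summand `(2 * q + 1) * κ` makes room for the words of `P` on `N` states, as `N + 2 ≤ (n +
  -- 2) ^ (2 * q + 1)`; the rest serves the reduction itself.
  refine ⟨reduction P c (6 * q) q a, 10 * q + c + 10 + (2 * q + 1) * κ, C', fun x hx => ?_⟩
  have hn := x.n_pos
  have hW : ∀ u v, x.weight u v ≤ x.n ^ c := hx.2
  change ∃ s t, Exec ((x.n + 2) ^ (10 * q + c + 10 + (2 * q + 1) * κ)) _ _ _ _ ∧ _
  obtain ⟨hm, hmn⟩ := ceilRoot_spec (k := 6 * q) (by omega) hn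
  have hmle := ceilRoot_le (k := 6 * q) (by omega) hn
  have hfits : (params c q a x.n).Fits ((x.n + 2) ^ (10 * q + c + 10 + (2 * q + 1) * κ)) :=
    params_fits ha haq hn (by omega)
  have hpow : ∀ {y e : ℕ}, y ≤ (x.n + 2) ^ e → e < 10 * q + c + 10 + (2 * q + 1) * κ →
      y < (x.n + 2) ^ (10 * q + c + 10 + (2 * q + 1) * κ) :=
    fun h he => h.trans_lt (Nat.pow_lt_pow_right (by omega) he)
  have hN : 0 < (params c q a x.n).N := by
    have := (params_N_ge (c := c) (a := a) hq hn).1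
    omega
  have hB₀ : ((params c q a x.n).N + 2) ^ κ ≤
      (x.n + 2) ^ (10 * q + c + 10 + (2 * q + 1) * κ) := by
    calc _ ≤ ((x.n + 2) ^ (2 * q + 1)) ^ κ :=
          Nat.pow_le_pow_left (params_N_add_two_le hq hn) κ
      _ = (x.n + 2) ^ ((2 * q + 1) * κ) := (pow_mul _ _ _).symm
      _ ≤ _ := Nat.pow_le_pow_right (by omega) (by omega)
  have hsol := params_solves (n := x.n) hq hn hP hN
  have hrun := runs_reduction (k := 6 * q) hW hfits hsol hB₀ hm hmn (fun _ => ceilRoot_min)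
    (hpow (Nat.pow_le_pow_left (hmle.trans (by omega)) (6 * q)) (by omega))
    (hpow (e := 2) (by nlinarith) (by omega)) (params_budget hn (by omega))
  obtain ⟨s, t, ex, ht, hs⟩ := hrun.exec
    (apsp_input_bounded hW (hpow (e := 1) (by rw [pow_one]; omega) (by omega))
      (hpow (e := c) (Nat.pow_le_pow_left (by omega) c) (by omega)))
    (fun s σ h hs => by
      change x.IsSolution fun u v => σ.mem 1 (u * x.n + v)
      rw [h.2]
      exact hs)
  refine ⟨s, t, ex, ?_, hs⟩
  have h₁ := hC' x.n (Set.mem_Ici.2 hn)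
  rw [Real.norm_of_nonneg (by positivity), Real.norm_of_nonneg (by positivity)] at h₁
  exact (Nat.cast_le.2 ht).trans h₁

end WordRAM

/-- Assuming the APSP conjecture, the Viterbi path problem over a unary alphabet requires
`Ω(T n ^ 2) ^ (1 - o(1))` time when `T ≤ n`; this holds at every polynomial length of the
observation sequence: it persists when only `T = ⌊n ^ α⌋` is allowed, for any fixed rational
`0 < α ≤ 1`. -/
theorem theorem6 (hAPSP : APSP.Conjecture) :
    Viterbi.problem.RequiresTime
      (fun x : Viterbi.Instance => x.σ = 1 ∧ 1 ≤ x.T ∧ x.T ≤ x.n)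
      (fun x : Viterbi.Instance => (x.T : ℝ) * (x.n : ℝ) ^ 2) ∧
    ∀ α : ℚ, 0 < α → α ≤ 1 →
      Viterbi.problem.RequiresTime
        (fun x : Viterbi.Instance => x.σ = 1 ∧ x.T = ⌊(x.n : ℝ) ^ (α : ℝ)⌋₊)
        (fun x : Viterbi.Instance => (x.T : ℝ) * (x.n : ℝ) ^ 2) := by
  constructor
  · refine (WordRAM.viterbi_requiresTime hAPSP one_pos le_rfl).mono fun x hx => ⟨hx.1, ?_⟩
    have hT := hx.2
    rw [Nat.cast_one, div_one, Real.rpow_one, Nat.floor_natCast] at hT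
    exact ⟨hT ▸ x.n_pos, hT.le⟩
  · intro α h₀ h₁
    obtain ⟨a, ha⟩ := Int.eq_ofNat_of_zero_le (Rat.num_pos.2 h₀).le
    have ha₀ : 0 < a := by
      have := Rat.num_pos.2 h₀
      omega
    have haq : a ≤ α.den := by
      have := Rat.num_le_denom_iff.2 h₁
      omega
    have hα : (α : ℝ) = a / α.den := by
      rw [Rat.cast_def, ha]
      exact congrArg (· / (α.den : ℝ)) (Int.cast_natCast a)
    rw [hα]
    exact WordRAM.viterbi_requiresTime hAPSP ha₀ haq
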